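/- **Setting.** Let $0<R<r$, $a>0$, $d>R$, $k>0$, and let $N\ge 1$ be an integer. Let $\Omega=\{\mathbf x=(x,y,z)\in\mathbb R^3:|x|,|y|,|z|<R\}$ and $\Gamma=\{|x|,|y|<R,\ z=-R\}$. For $\alpha\in[-a,a]$ put $\mathbf x_\alpha=(\alpha,0,-d)$, $$\tilde{\mathbf x}_\alpha=\frac{ik(\mathbf x-\mathbf x_\alpha)}{|\mathbf x-\mathbf x_\alpha|}-\frac{\mathbf x-\mathbf x_\alpha}{|\mathbf x-\mathbf x_\alpha|^2},\qquad \widehat{\mathbf x}_\alpha=\partial_\alpha\tilde{\mathbf x}_\alpha .$$ Let $\Psi_0,\Psi_1,\dots$ be obtained from $\alpha^n e^{\alpha}$, $n=0,1,\dots$, by Gram–Schmidt orthonormalization in $L^2(-a,a)$, and let $S_N=(s_{mn})_{m,n=0}^{N-1}$, $s_{mn}=\int_{-a}^a\Psi_n'\Psi_m\,d\alpha$. For $V=(v_0,\dots,v_{N-1}):\Omega\to\mathbb C^N$ let $L(V)=\Delta V+K(\nabla V)$, $K(\nabla V)=S_N^{-1}f(\nabla V)$, where, with the bilinear (non-conjugated)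 dot product, $$f_m(\nabla V)=2\sum_{n,l=0}^{N-1}\nabla v_n\cdot\nabla v_l\int_{-a}^a\Psi_m\Psi_n\Psi_l'\,d\alpha+2\sum_{n=0}^{N-1}\int_{-a}^a\Psi_m\Psi_n'\,\nabla v_n\cdot\tilde{\mathbf x}_\alpha\,d\alpha+2\sum_{n=0}^{N-1}\int_{-a}^a\Psi_m\Psi_n\,\widehat{\mathbf x}_\alpha\cdot\nabla v_n\,d\alpha .$$ Let $H^s$ denote the Sobolev space $H^s(\Omega;\mathbb C^N)$, regarded as a real Hilbert space ($2N$ real components), with $\|V\|_{H^s}^2=\sum_{n}\sum_{|\beta|\le s}\|\partial^\beta v_n\|_{L^2(\Omega)}^2$. For $\lambda>0$, $\gamma\in(0,1)$ and $V\in H^3$ let $$J_{\lambda,\gamma}(V)=e^{-2\lambda(R+r)^2}\int_\Omega|L(V)|^2e^{2\lambda(z-r)^2}\,d\mathbf x+\gamma\|V\|_{H^3}^2 .$$ For $M>0$ and boundary data $\psi_0:\partial\Omega\to\mathbb C^N$, $\psi_1:\Gamma\to\mathbb C^N$ let $$B(M)=\{V\in H^3:\ \|V\|_{H^3}<M,\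 V|_{\partial\Omega}=\psi_0,\ V_z|_\Gamma=\psi_1\},$$ and let $\overline{B(M)}$ be its closure in $H^3$. Call a number $\Lambda>1$ *admissible for $M$* if for every $\lambda\ge\Lambda$ there is $c>0$ such that for all $\gamma\in(0,1)$ and all boundary data $\psi_0,\psi_1$ the functional $J_{\lambda,\gamma}$ is Fréchet differentiable at every point of $\overline{B(M)}$ and $$J_{\lambda,\gamma}(V_2)-J_{\lambda,\gamma}(V_1)-J_{\lambda,\gamma}'(V_1)(V_2-V_1)\ \ge\ c\,\|V_2-V_1\|_{H^2}^2+\gamma\|V_2-V_1\|_{H^3}^2\quad\text{for all }V_1,V_2\in\overline{B(M)} .$$ **Theorem 5.4 (accuracy and stability of minimizers).** (i) There is a function $\lambda_2:(0,\infty)\to(1,\infty)$ such that, for every $M>0$, $\lambda_2(M)$ is admissible for $M$ and $\lambda_2(M)<\lambda_2(3M)$. (ii) Let $M>0$ and let $\lambda_3=\lambda_2(3M)$ be any number admissible for $3M$. There is a constant $C>0$, depending only on $R,r,a,d,k,N,M,\lambda_3$, with the following property. Let $\delta\in(0,1)$, let $(\psi_0,\psi_1)$ and $(\psi_0^*,\psi_1^*)$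 be boundary data, and let $G,G^*,V^*\in H^3$ satisfy $$G|_{\partial\Omega}=\psi_0,\quad G_z|_\Gamma=\psi_1,\qquad G^*|_{\partial\Omega}=V^*|_{\partial\Omega}=\psi_0^*,\quad G^*_z|_\Gamma=V^*_z|_\Gamma=\psi_1^*,\qquad L(V^*)=0\ \text{ a.e. in }\Omega,$$ $$\|G-G^*\|_{H^3}<\delta,\qquad \|V^*\|_{H^3}<M-\delta,\qquad \|G^*\|_{H^3}<M-\delta .$$ Then, for $\lambda=\lambda_3$ and $\gamma=\delta^2$, the functional $J_{\lambda,\gamma}$ has a unique minimizer $V_{\min}$ on $\overline{B(M)}$ (defined with the data $\psi_0,\psi_1$), and $$\|V_{\min}-V^*\|_{H^2}\le C\,\delta .$$ -/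

import Mathlib

open MeasureTheory Set
open scoped ContDiff

noncomputable section

namespace Convexification

/-! ### Geometry -/

/-- Points `x = (x, y, z)` of space, with coordinates `x 0`, `x 1`, `x 2`. -/
abbrev E3 : Type := EuclideanSpace ℝ (Fin 3)

/-- The open cube `Ω = {|x|, |y|, |z| < R}`. -/
def cube (R : ℝ) : Set E3 := {x | ∀ i, |x i| < R}

/-- The measurement face `Γ = {|x|, |y| < R, z = -R}`. -/
def measFace (R : ℝ) : Set E3 := {x | |x 0| < R ∧ |x 1| < R ∧ x 2 = -R}

/-! ### Sobolev spaces on the cube -/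

/-- Complex-valued `L²(Ω)`. -/
abbrev L2 (R : ℝ) : Type := Lp ℂ 2 (volume.restrict (cube R))

/-- Smooth real test functions with compact support inside the cube. -/
structure IsTestFunction (R : ℝ) (φ : E3 → ℝ) : Prop where
  smooth : ContDiff ℝ ∞ φ
  compact : HasCompactSupport φ
  support_subset : tsupport φ ⊆ cube R

/-- `g` is the weak partial derivative `∂ᵢ u` on the cube. -/
def IsWeakDeriv (R : ℝ) (i : Fin 3) (u g : L2 R) : Prop :=
  ∀ φ : E3 → ℝ, IsTestFunction R φ →
    ∫ x in cube R, fderiv ℝ φ x (EuclideanSpace.single i 1) • u x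
      = - ∫ x in cube R, φ x • g x

/-- The multi-indices `α` in three variables with `|α| ≤ s`. -/
def multiIndices (s : ℕ) : Finset (Fin 3 → ℕ) :=
  (Fintype.piFinset fun _ => Finset.range (s + 1)).filter fun α => ∑ i, α i ≤ s

theorem mem_multiIndices {s : ℕ} {α : Fin 3 → ℕ} :
    α ∈ multiIndices s ↔ ∑ i, α i ≤ s := by
  simp only [multiIndices, Finset.mem_filter, Fintype.mem_piFinset, Finset.mem_range,
    and_iff_right_iff_imp]
  intro h i
  have := Finset.single_le_sum (f := α) (fun _ _ => Nat.zero_le _) (Finset.mem_univ i)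
  omega

/-- Families `(u_{n,α})`, `n < N`, `|α| ≤ s`, of `L²(Ω)` functions, with the norm
`(∑ ‖u_{n,α}‖²)^{1/2}`. -/
abbrev DerivFamily (R : ℝ) (N s : ℕ) : Type :=
  PiLp 2 (fun _ : Fin N × multiIndices s => L2 R)

theorem integrable_test_smul {R : ℝ} {c : E3 → ℝ} (hc : Continuous c)
    (hs : HasCompactSupport c) (u : L2 R) :
    Integrable (fun x => c x • u x) (volume.restrict (cube R)) := by
  have hc2 : MemLp c 2 (volume.restrict (cube R)) := hc.memLp_of_hasCompactSupport hs
  have := (Lp.memLp u).integrable_mul (f := fun x => u x)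
    (g := fun x => (c x : ℂ)) (p := 2) (q := 2) hc2.ofReal
  refine this.congr (Filter.Eventually.of_forall fun x => ?_)
  simp [mul_comm]

theorem IsTestFunction.integrable_smul {R : ℝ} {φ : E3 → ℝ} (h : IsTestFunction R φ)
    (u : L2 R) : Integrable (fun x => φ x • u x) (volume.restrict (cube R)) :=
  integrable_test_smul h.smooth.continuous h.compact u

theorem IsTestFunction.integrable_fderiv_smul {R : ℝ} {φ : E3 → ℝ} (h : IsTestFunction R φ)
    (v : E3) (u : L2 R) :
    Integrable (fun x => fderiv ℝ φ x v • u x) (volume.restrict (cube R)) :=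
  integrable_test_smul ((h.smooth.continuous_fderiv (by simp)).clm_apply continuous_const)
    (h.compact.fderiv_apply (𝕜 := ℝ) v) u

theorem IsWeakDeriv.zero (R : ℝ) (i : Fin 3) : IsWeakDeriv R i 0 0 := by
  intro φ _
  have h : ∀ c : E3 → ℝ, ∫ x in cube R, c x • (0 : L2 R) x = 0 := by
    intro c
    apply integral_eq_zero_of_ae
    filter_upwards [Lp.coeFn_zero ℂ 2 (volume.restrict (cube R))] with x hx
    rw [hx, Pi.zero_apply, smul_zero]
  rw [h, h, neg_zero]

theorem IsWeakDeriv.add {R : ℝ} {i : Fin 3} {u g v w : L2 R} (h₁ : IsWeakDeriv R i u g)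
    (h₂ : IsWeakDeriv R i v w) : IsWeakDeriv R i (u + v) (g + w) := by
  intro φ hφ
  have h : ∀ (c : E3 → ℝ) (a b : L2 R),
      Integrable (fun x => c x • a x) (volume.restrict (cube R)) →
      Integrable (fun x => c x • b x) (volume.restrict (cube R)) →
      ∫ x in cube R, c x • (a + b) x
        = (∫ x in cube R, c x • a x) + ∫ x in cube R, c x • b x := by
    intro c a b ha hb
    rw [← integral_add ha hb]
    apply integral_congr_ae
    filter_upwards [Lp.coeFn_add a b] with x hx
    rw [hx, Pi.add_apply, smul_add]
  rw [h _ u v (hφ.integrable_fderiv_smul _ u) (hφ.integrable_fderiv_smul _ v),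
    h _ g w (hφ.integrable_smul g) (hφ.integrable_smul w), h₁ φ hφ, h₂ φ hφ, neg_add]

theorem IsWeakDeriv.smul {R : ℝ} {i : Fin 3} {u g : L2 R} (t : ℝ) (h₁ : IsWeakDeriv R i u g) :
    IsWeakDeriv R i (t • u) (t • g) := by
  intro φ hφ
  have h : ∀ (c : E3 → ℝ) (a : L2 R),
      ∫ x in cube R, c x • (t • a) x = t • ∫ x in cube R, c x • a x := by
    intro c a
    rw [← integral_smul]
    apply integral_congr_ae
    filter_upwards [Lp.coeFn_smul t a] with x hx
    rw [hx, Pi.smul_apply, smul_comm]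
  rw [h, h, h₁ φ hφ, smul_neg]

/-- The Sobolev space `H^s(Ω)` of vector functions with `N` complex (that is, `2N` real)
components. A function is stored together with all its weak derivatives of order at most `s`:
the entry `(n, α)` is `∂^α v_n ∈ L²(Ω)`. The norm inherited from `DerivFamily` is
`(∑_n ∑_{|α| ≤ s} ‖∂^α v_n‖²_{L²(Ω)})^{1/2}`. -/
def Sobolev (R : ℝ) (N s : ℕ) : Submodule ℝ (DerivFamily R N s) where
  carrier := {V | ∀ (n : Fin N) (i : Fin 3) (α β : multiIndices s),
    (β : Fin 3 → ℕ) = (α : Fin 3 → ℕ) + Pi.single i 1 → IsWeakDeriv R i (V (n, α)) (V (n, β))}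
  zero_mem' := fun _ i _ _ _ => IsWeakDeriv.zero R i
  add_mem' := fun hU hV n i α β h => (hU n i α β h).add (hV n i α β h)
  smul_mem' := fun t _ hV n i α β h => (hV n i α β h).smul t

/-- The space `H³(Ω)` of `N` complex components. -/
abbrev H3 (R : ℝ) (N : ℕ) : Type := Sobolev R N 3

/-- The component `v_n` of a vector function in `H³(Ω)`. -/
def comp {R : ℝ} {N : ℕ} (V : H3 R N) (n : Fin N) : L2 R :=
  V.1 (n, ⟨0, mem_multiIndices.2 (by simp)⟩)

/-- The first derivative `∂ᵢ v_n`. -/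
def d1 {R : ℝ} {N : ℕ} (V : H3 R N) (n : Fin N) (i : Fin 3) : L2 R :=
  V.1 (n, ⟨Pi.single i 1, mem_multiIndices.2 (by simp)⟩)

/-- The pure second derivative `∂ᵢ² v_n`. -/
def d2 {R : ℝ} {N : ℕ} (V : H3 R N) (n : Fin N) (i : Fin 3) : L2 R :=
  V.1 (n, ⟨Pi.single i 2, mem_multiIndices.2 (by simp)⟩)

/-- The `H²(Ω)` norm of an element of `H³(Ω)`. -/
def normH2 {R : ℝ} {N : ℕ} (V : H3 R N) : ℝ :=
  √(∑ j : Fin N × multiIndices 3, if ∑ i, (j.2 : Fin 3 → ℕ) i ≤ 2 then ‖V.1 j‖ ^ 2 else 0)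

/-- `u` takes the values `ψ` on the set `S` in the closed cube: the continuous representative
of `u` on the closed cube (unique if it exists, and existing for every `u` in `H²(Ω)`) equals
`ψ` on `S`. -/
def HasBoundaryValue {R : ℝ} (u : L2 R) (S : Set E3) (ψ : E3 → ℂ) : Prop :=
  ∃ w : E3 → ℂ, ContinuousOn w (closure (cube R)) ∧
    (u : E3 → ℂ) =ᵐ[volume.restrict (cube R)] w ∧ ∀ x ∈ S, w x = ψ x

/-- The boundary conditions `V = ψ₀` on `∂Ω` and `∂_z V = ψ₁` on `Γ`. -/
def HasBoundaryData {R : ℝ} {N : ℕ} (V : H3 R N) (ψ₀ ψ₁ : Fin N → E3 → ℂ) : Prop :=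
  ∀ n, HasBoundaryValue (comp V n) (frontier (cube R)) (ψ₀ n) ∧
    HasBoundaryValue (d1 V n 2) (measFace R) (ψ₁ n)

/-! ### The special basis -/

/-- Gram--Schmidt orthonormalization `Ψ_0, Ψ_1, …` in `L²(-a, a)` of the functions
`α ↦ αⁿ e^α`, `n = 0, 1, …`. -/
def basisFn (a : ℝ) (n : ℕ) : ℝ → ℝ :=
  let w : ℝ → ℝ := fun t => t ^ n * Real.exp t
    - ∑ j : Fin n, (∫ s in (-a)..a, (s ^ n * Real.exp s) * basisFn a j s) * basisFn a j t
  fun t => w t / √(∫ s in (-a)..a, w s ^ 2)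
termination_by n
decreasing_by all_goals exact j.2

/-- The matrix `S_N` with entries `s_{mn} = ∫ Ψ_n' Ψ_m` over `(-a, a)`. -/
def matS (a : ℝ) (N : ℕ) : Matrix (Fin N) (Fin N) ℝ :=
  Matrix.of fun m n => ∫ t in (-a)..a, deriv (basisFn a n) t * basisFn a m t

/-! ### The quasilinear system -/

/-- The vector `x - x_t` from the source `x_t = (t, 0, -d)` to `x`. -/
def offset (d : ℝ) (x : E3) (t : ℝ) : Fin 3 → ℝ := ![x 0 - t, x 1, x 2 + d]

/-- The distance `|x - x_t|`. -/
def dist0 (d : ℝ) (x : E3) (t : ℝ) : ℝ := √(∑ i, offset d x t i ^ 2)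

/-- `x̃_t = ∇ log u₀(x, t) = i k (x - x_t) / |x - x_t| - (x - x_t) / |x - x_t|²`. -/
def xTilde (d k : ℝ) (x : E3) (t : ℝ) (i : Fin 3) : ℂ :=
  Complex.I * k * offset d x t i / dist0 d x t - offset d x t i / (dist0 d x t : ℂ) ^ 2

/-- `x̂_t = ∂_t x̃_t`, written out. -/
def xHat (d k : ℝ) (x : E3) (t : ℝ) (i : Fin 3) : ℂ :=
  Complex.I * k / (dist0 d x t : ℂ) ^ 3 *
      ((![-(x 1) ^ 2 - (x 2 + d) ^ 2, (x 0 - t) * x 1, (x 0 - t) * (x 2 + d)] :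
        Fin 3 → ℝ) i : ℝ)
    - 1 / (dist0 d x t : ℂ) ^ 4 *
      ((![(x 0 - t) ^ 2 - (x 1) ^ 2 - (x 2 + d) ^ 2, 2 * (x 0 - t) * x 1,
        2 * (x 0 - t) * (x 2 + d)] : Fin 3 → ℝ) i : ℝ)

/-- The nonlinearity `f_m` at the point `x`, where `p n i` stands for `∂ᵢ v_n(x)`. The dot
products are bilinear (no complex conjugation). -/
def nonlinF (a d k : ℝ) (N : ℕ) (x : E3) (p : Fin N → Fin 3 → ℂ) (m : Fin N) : ℂ :=
  2 * (∑ n : Fin N, ∑ l : Fin N, (∑ i, p n i * p l i) *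
      ((∫ t in (-a)..a, basisFn a m t * basisFn a n t * deriv (basisFn a l) t : ℝ) : ℂ))
  + 2 * (∑ n : Fin N, (∫ t in (-a)..a,
      ((basisFn a m t * deriv (basisFn a n) t : ℝ) : ℂ) * (∑ i, p n i * xTilde d k x t i)))
  + 2 * (∑ n : Fin N, (∫ t in (-a)..a,
      ((basisFn a m t * basisFn a n t : ℝ) : ℂ) * (∑ i, xHat d k x t i * p n i)))

/-- `K = S_N⁻¹ f`. -/
def nonlinK (a d k : ℝ) (N : ℕ) (x : E3) (p : Fin N → Fin 3 → ℂ) (m : Fin N) : ℂ :=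
  ∑ n : Fin N, (((matS a N)⁻¹ m n : ℝ) : ℂ) * nonlinF a d k N x p n

/-- `L(V) = ΔV + K(∇V)`, as a vector function defined almost everywhere on the cube. -/
def opL (a d k : ℝ) {R : ℝ} {N : ℕ} (V : H3 R N) (x : E3) (m : Fin N) : ℂ :=
  (∑ i, d2 V m i x) + nonlinK a d k N x (fun n i => d1 V n i x) m

/-- `V` solves `ΔV + K(∇V) = 0` in the cube. -/
def IsSolution (a d k : ℝ) {R : ℝ} {N : ℕ} (V : H3 R N) : Prop :=
  ∀ᵐ x ∂(volume.restrict (cube R)), ∀ m, opL a d k V x m = 0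

/-! ### The weighted Tikhonov-like functional -/

/-- The Carleman weight function `μ_lam(z) = exp(2 lam (z - r)²)`. -/
def carlemanWeight (r lam z : ℝ) : ℝ := Real.exp (2 * lam * (z - r) ^ 2)

/-- The functional
`J_{lam,γ}(V) = e^{-2 lam (R+r)²} ∫_Ω |L(V)|² μ_lam(z) dx + γ ‖V‖²_{H³(Ω)}`. -/
def J (r a d k lam γ : ℝ) {R : ℝ} {N : ℕ} (V : H3 R N) : ℝ :=
  Real.exp (-2 * lam * (R + r) ^ 2) *
      (∫ x in cube R, (∑ m, ‖opL a d k V x m‖ ^ 2) * carlemanWeight r lam (x 2))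
    + γ * ‖V‖ ^ 2

/-- The set `B(M)` of vector functions of `H³(Ω)` with norm less than `M` and with boundary
data `ψ₀, ψ₁`. -/
def setB (R : ℝ) (N : ℕ) (M : ℝ) (ψ₀ ψ₁ : Fin N → E3 → ℂ) : Set (H3 R N) :=
  {V | ‖V‖ < M ∧ HasBoundaryData V ψ₀ ψ₁}

/-- `Λ` is a value `λ₂(M)` beyond which the functionals are strictly convex on the closure of
`B(M)`: `Λ > 1` and, for every `lam ≥ Λ`, the functional is Fréchet differentiable at the points
of the closure of `B(M)` and satisfies there the strict convexity inequality, with a constant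
`c > 0` that depends neither on the regularization parameter nor on the boundary data. -/
def IsConvexityThreshold (R r a d k : ℝ) (N : ℕ) (M Λ : ℝ) : Prop :=
  1 < Λ ∧ ∀ lam : ℝ, Λ ≤ lam → ∃ c : ℝ, 0 < c ∧
    ∀ γ : ℝ, 0 < γ → γ < 1 → ∀ ψ₀ ψ₁ : Fin N → E3 → ℂ,
      ∀ V₁ ∈ closure (setB R N M ψ₀ ψ₁),
        DifferentiableAt ℝ (J r a d k lam γ : H3 R N → ℝ) V₁ ∧
        ∀ V₂ ∈ closure (setB R N M ψ₀ ψ₁),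
          c * normH2 (V₂ - V₁) ^ 2 + γ * ‖V₂ - V₁‖ ^ 2 ≤
            J r a d k lam γ V₂ - J r a d k lam γ V₁
              - fderiv ℝ (J r a d k lam γ : H3 R N → ℝ) V₁ (V₂ - V₁)

/-- `V` minimizes `J_{lam,γ}` on the closure (in `H³(Ω)`) of `B(M)`. -/
def IsMinimizer (r a d k lam γ : ℝ) {R : ℝ} {N : ℕ} (M : ℝ) (ψ₀ ψ₁ : Fin N → E3 → ℂ)
    (V : H3 R N) : Prop :=
  V ∈ closure (setB R N M ψ₀ ψ₁) ∧
    ∀ W ∈ closure (setB R N M ψ₀ ψ₁), J r a d k lam γ V ≤ J r a d k lam γ W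

end Convexification

end

open Convexification

noncomputable section

namespace Convexification

open Filter Topology

/-! ### The cube -/

/-! Up to the regularization term, `J` is a constant times the sum over `m` of `‖q(V)‖²`, where
`q(V) = A V + B(V, V)` is the weighted `m`-th component of `L(V)`, a quadratic polynomial in `V`
with values in `L²`. Its Taylor remainder at `V₁` in the direction `h = V₂ - V₁` is therefore
explicit (`quadFun_taylor`): a multiple of the sum of `‖q(V₂) - q(V₁)‖² + 2 ⟨q(V₁), B(h, h)⟩`, plus
`γ ‖h‖²`. Gradients of `H³` functions are bounded, because `H²` embeds in `L^∞`. Hence, with the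
Carleman weight `φ`, the remainder dominates the integral of `φ (½ |Δh|² - κ₁ |∇h|² - κ₂ |ΔV₁|
|∇h|²)` (`remainder_pointwise`). Both negative terms must be absorbed for large `λ`.

The term with `κ₁` is absorbed by the Carleman estimate `∫ φ |∇h|² ≤ (C/λ) ∫ φ |Δh|²`
(`exists_carleman`), valid since `h` vanishes on the boundary and `∂_z h` on the lower face.
Conjugation by `√φ` splits the Laplacian into a symmetric and a skew part, whose commutator is
positive; the only boundary term left, on the upper face, has a favourable sign because the weight
decreases for `z < r`. The term with `κ₂` is subtler, since `ΔV₁` is only in `H¹`, hence in `L⁴`.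
Interpolating the `L⁴` norm of `√φ ∇h` between `L²` and `H¹` at scale `1/λ` still yields a gain
`λ^{-1/4}` (`exists_weighted_cubic_le`). What remains controls the `H²` norm of `h`, again by the
Carleman estimate. Convexity passes from `B(M)` to its closure by continuity, which gives (i).

The embedding and the interpolation both come from the averages `∫ η(y) u(x + t (y - x)) dy`. The
cube is convex, so these never look outside it and need no extension of `u`; their derivative in `t`
is an average of the gradient. They also give smooth approximations up to the boundary, which
justify integration by parts for functions with vanishing boundary values.

For (ii), strong convexity makes minimizing sequences Cauchy, so a unique minimizer `U` exists in
the closed convex set. The function `W = V* + G - G*` has the boundary data of the noisy problem,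
lies in `B(M)`, and is `δ`-close to a zero of `L`; thus `J(W) ≤ C δ²` when `γ = δ²`. Since `J'(U)(W
- U) ≥ 0` and `J(U) ≥ 0`, convexity at `U` yields `c ‖W - U‖² ≤ J(W)` in the `H²` norm, and the
triangle inequality finishes the argument. -/

theorem isOpen_cube (R : ℝ) : IsOpen (cube R) := by
  have : cube R = ⋂ i, {x : E3 | |x i| < R} := by ext; simp [cube]
  rw [this]
  exact isOpen_iInter_of_finite fun i => isOpen_lt (by fun_prop) continuous_const

theorem measurableSet_cube (R : ℝ) : MeasurableSet (cube R) := (isOpen_cube R).measurableSet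

theorem convex_cube (R : ℝ) : Convex ℝ (cube R) := by
  intro x hx y hy a b ha hb hab i
  have h1 := hx i
  have h2 := hy i
  rw [abs_lt] at h1 h2 ⊢
  simp only [PiLp.add_apply, PiLp.smul_apply, smul_eq_mul]
  rcases ha.eq_or_lt with h | h
  · subst h
    have : b = 1 := by linarith
    subst this; constructor <;> linarith
  · constructor <;> nlinarith

theorem norm_le_of_mem_cube {R : ℝ} {x : E3} (hx : x ∈ cube R) : ‖x‖ ≤ 3 * R := by
  have hR : 0 ≤ R := (abs_nonneg _).trans (hx 0).le
  rw [EuclideanSpace.norm_eq]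
  apply Real.sqrt_le_iff.2 ⟨by linarith, ?_⟩
  simp only [Fin.sum_univ_three, Real.norm_eq_abs]
  have h : ∀ i, |x i| ^ 2 ≤ R ^ 2 := fun i => pow_le_pow_left₀ (abs_nonneg _) (hx i).le 2
  nlinarith [h 0, h 1, h 2]

theorem isBounded_cube (R : ℝ) : Bornology.IsBounded (cube R) :=
  isBounded_iff_forall_norm_le.2 ⟨3 * R, fun _ hx => norm_le_of_mem_cube hx⟩

theorem volume_cube_lt_top (R : ℝ) : volume (cube R) < ⊤ := (isBounded_cube R).measure_lt_top

instance instIsFiniteMeasureCube (R : ℝ) : IsFiniteMeasure (volume.restrict (cube R)) :=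
  ⟨by simpa using volume_cube_lt_top R⟩

theorem isCompact_closure_cube (R : ℝ) : IsCompact (closure (cube R)) :=
  (isBounded_cube R).isCompact_closure

/-! ### Square integrable functions on the cube -/

/-- The `L²` norm over the cube of a real function. -/
def nrm (R : ℝ) (u : E3 → ℝ) : ℝ := √(∫ x in cube R, u x ^ 2)

theorem nrm_nonneg (R : ℝ) (u : E3 → ℝ) : 0 ≤ nrm R u := Real.sqrt_nonneg _

theorem sq_nrm (R : ℝ) (u : E3 → ℝ) : nrm R u ^ 2 = ∫ x in cube R, u x ^ 2 :=
  Real.sq_sqrt (integral_nonneg fun _ => sq_nonneg _)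

theorem memLp_two_mul_integrable {α : Type*} [MeasurableSpace α] {μ : Measure α} {f g : α → ℝ}
    (hf : MemLp f 2 μ) (hg : MemLp g 2 μ) : Integrable (fun x => f x * g x) μ :=
  hf.integrable_mul hg

theorem abs_integral_mul_le {α : Type*} [MeasurableSpace α] {μ : Measure α} {f g : α → ℝ}
    (hf : MemLp f 2 μ) (hg : MemLp g 2 μ) :
    |∫ x, f x * g x ∂μ| ≤ √(∫ x, f x ^ 2 ∂μ) * √(∫ x, g x ^ 2 ∂μ) := by
  have hfg := memLp_two_mul_integrable hf hg
  have hff := hf.integrable_sq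
  have hgg := hg.integrable_sq
  have hA : 0 ≤ ∫ x, f x ^ 2 ∂μ := integral_nonneg fun _ => sq_nonneg _
  have h : ∀ t : ℝ, 0 ≤ (∫ x, g x ^ 2 ∂μ) * (t * t) + (2 * ∫ x, f x * g x ∂μ) * t
      + ∫ x, f x ^ 2 ∂μ := by
    intro t
    have h0 : 0 ≤ ∫ x, (f x + t * g x) ^ 2 ∂μ := integral_nonneg fun _ => sq_nonneg _
    have h1 : ∫ x, (f x + t * g x) ^ 2 ∂μ = ∫ x, (t * t * g x ^ 2 + (2 * t) * (f x * g x))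
      + f x ^ 2 ∂μ := by congr 1; ext x; ring
    have h2 := integral_add (f := fun x => t * t * g x ^ 2 + (2 * t) * (f x * g x))
      ((hgg.const_mul _).add (hfg.const_mul _)) hff
    rw [h1, h2, integral_add (hgg.const_mul _) (hfg.const_mul _), integral_const_mul,
      integral_const_mul] at h0
    linarith
  have := discrim_le_zero h
  rw [discrim] at this
  rw [← Real.sqrt_mul hA]
  apply Real.abs_le_sqrt
  nlinarith

theorem abs_setIntegral_mul_le {R : ℝ} {f g : E3 → ℝ}
    (hf : MemLp f 2 (volume.restrict (cube R))) (hg : MemLp g 2 (volume.restrict (cube R))) :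
    |∫ x in cube R, f x * g x| ≤ nrm R f * nrm R g := abs_integral_mul_le hf hg

/-! ### Weak derivatives of real functions -/

/-- The classical partial derivative. -/
def pd (i : Fin 3) (φ : E3 → ℝ) (x : E3) : ℝ := fderiv ℝ φ x (EuclideanSpace.single i 1)

/-- `g` is the weak partial derivative `∂ᵢ u` on the cube, both functions being in `L²`. -/
structure HasWD (R : ℝ) (i : Fin 3) (u g : E3 → ℝ) : Prop where
  memLp : MemLp u 2 (volume.restrict (cube R))
  memLp_deriv : MemLp g 2 (volume.restrict (cube R))
  eq : ∀ φ : E3 → ℝ, IsTestFunction R φ →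
    ∫ x in cube R, pd i φ x * u x = - ∫ x in cube R, φ x * g x

theorem pd_mul {i : Fin 3} {φ ψ : E3 → ℝ} {x : E3} (hφ : DifferentiableAt ℝ φ x)
    (hψ : DifferentiableAt ℝ ψ x) :
    pd i (fun y => φ y * ψ y) x = φ x * pd i ψ x + pd i φ x * ψ x := by
  unfold pd
  rw [fderiv_fun_mul hφ hψ]
  simp [mul_comm]

theorem contDiff_pd {i : Fin 3} {φ : E3 → ℝ} (h : ContDiff ℝ ∞ φ) : ContDiff ℝ ∞ (pd i φ) :=
  (h.fderiv_right (m := ∞) le_rfl).clm_apply contDiff_const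

theorem contDiff_coord (i : Fin 3) : ContDiff ℝ ∞ fun x : E3 => x i := by fun_prop

theorem pd_coord (i j : Fin 3) (x : E3) : pd i (fun x : E3 => x j) x = if i = j then 1 else 0 := by
  unfold pd
  have : HasFDerivAt (fun x : E3 => x j) (EuclideanSpace.proj j : E3 →L[ℝ] ℝ) x :=
    (EuclideanSpace.proj (𝕜 := ℝ) j : E3 →L[ℝ] ℝ).hasFDerivAt
  rw [this.fderiv]
  simp [eq_comm]

theorem fderiv_eq_sum_pd (φ : E3 → ℝ) (x v : E3) : fderiv ℝ φ x v = ∑ i, v i * pd i φ x := by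
  have h : v = ∑ i, v i • (EuclideanSpace.single i (1 : ℝ) : E3) := by
    ext j; fin_cases j <;> simp [Fin.sum_univ_three]
  conv_lhs => rw [h]
  simp [pd, map_sum]

theorem IsTestFunction.smooth_mul {R : ℝ} {φ ρ : E3 → ℝ} (h : IsTestFunction R φ)
    (hρ : ContDiff ℝ ∞ ρ) : IsTestFunction R (fun x => ρ x * φ x) where
  smooth := hρ.mul h.smooth
  compact := h.compact.mul_left
  support_subset := (tsupport_mul_subset_right (f := ρ) (g := φ)).trans h.support_subset

/-- The homothety that maps `x + t (y - x)` to `y`. -/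
def zoom (x : E3) (t : ℝ) (z : E3) : E3 := x + t⁻¹ • (z - x)

theorem hasFDerivAt_zoom (x : E3) (t : ℝ) (z : E3) :
    HasFDerivAt (zoom x t) (t⁻¹ • ContinuousLinearMap.id ℝ E3) z := by
  unfold zoom
  exact (((hasFDerivAt_id z).sub_const x).const_smul t⁻¹).const_add x

theorem contDiff_zoom (x : E3) (t : ℝ) : ContDiff ℝ ∞ (zoom x t) := by
  unfold zoom; fun_prop

theorem pd_comp_zoom {η : E3 → ℝ} (hη : ContDiff ℝ ∞ η) (i : Fin 3) (x : E3) (t : ℝ) (z : E3) :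
    pd i (fun z => η (zoom x t z)) z = t⁻¹ * pd i η (zoom x t z) := by
  unfold pd
  have h := ((hη.differentiable (by simp)) (zoom x t z)).hasFDerivAt.comp z (hasFDerivAt_zoom x t z)
  have h2 : fderiv ℝ (fun z => η (zoom x t z)) z = _ := h.fderiv
  rw [h2]; simp

/-- If `y = zoom x t z` lies in the support of `η`, then `z = (1 - t) x + t y` is a convex
combination of two points of the cube. This is where convexity of the domain enters: averages
centred at any `x` in the cube, however close to the boundary, only see values inside. -/
theorem IsTestFunction.comp_zoom {R : ℝ} {η : E3 → ℝ} (h : IsTestFunction R η) {x : E3}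
    (hx : x ∈ cube R) {t : ℝ} (ht : 0 < t) (ht1 : t ≤ 1) :
    IsTestFunction R (fun z => η (zoom x t z)) := by
  let e : E3 ≃ₜ E3 := (Homeomorph.subRight x).trans
    ((Homeomorph.smulOfNeZero t⁻¹ (inv_ne_zero ht.ne')).trans (Homeomorph.addLeft x))
  have he : (fun z => η (zoom x t z)) = η ∘ e := rfl
  refine ⟨h.smooth.comp (contDiff_zoom x t), he ▸ h.compact.comp_homeomorph e, ?_⟩
  intro z hz
  have hz1 : e z ∈ tsupport η := by
    rw [he] at hz
    exact tsupport_comp_subset_preimage η e.continuous hz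
  have hz2 : zoom x t z ∈ cube R := h.support_subset hz1
  have : z = (1 - t) • x + t • zoom x t z := by
    unfold zoom
    rw [smul_add, smul_smul, mul_inv_cancel₀ ht.ne']
    module
  rw [this]
  exact convex_cube R hx hz2 (by linarith) ht.le (by ring)

theorem IsTestFunction.exists_bound {R : ℝ} {η : E3 → ℝ} (h : IsTestFunction R η) :
    ∃ C, 0 ≤ C ∧ ∀ x, |η x| ≤ C := by
  obtain ⟨C, hC⟩ := h.compact.exists_bound_of_continuous h.smooth.continuous
  exact ⟨C, (norm_nonneg _).trans (hC 0), hC⟩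

theorem IsTestFunction.exists_bound_fderiv {R : ℝ} {η : E3 → ℝ} (h : IsTestFunction R η) :
    ∃ C, 0 ≤ C ∧ ∀ x, ‖fderiv ℝ η x‖ ≤ C := by
  obtain ⟨C, hC⟩ := (h.compact.fderiv (𝕜 := ℝ)).exists_bound_of_continuous
    (h.smooth.continuous_fderiv (by simp))
  exact ⟨C, (norm_nonneg _).trans (hC 0), hC⟩

theorem memLp_of_continuous_bound {R : ℝ} {f : E3 → ℝ} (hf : Continuous f) :
    MemLp f 2 (volume.restrict (cube R)) := by
  obtain ⟨C, hC⟩ := (isCompact_closure_cube R).exists_bound_of_continuousOn hf.continuousOn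
  refine MemLp.of_bound hf.aestronglyMeasurable C ?_
  filter_upwards [ae_restrict_mem (measurableSet_cube R)] with x hx
  exact hC x (subset_closure hx)

/-! ### Averages over small homothetic copies of the cube -/

/-- The average `∫ η(y) u(x + t (y - x)) dy`, after the change of variables
`z = x + t (y - x)`. -/
def avg (R : ℝ) (η u : E3 → ℝ) (t : ℝ) (x : E3) : ℝ :=
  t⁻¹ ^ 3 * ∫ z in cube R, η (zoom x t z) * u z

theorem integral_comp_zoom (F : E3 → ℝ) (x : E3) {t : ℝ} (ht : 0 < t) :
    ∫ z, F (zoom x t z) = t ^ 3 * ∫ z, F z := by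
  unfold zoom
  rw [integral_sub_right_eq_self (fun z => F (x + t⁻¹ • z)) x,
    Measure.integral_comp_inv_smul volume (fun z => F (x + z)) t, integral_add_left_eq_self]
  simp [abs_of_pos ht]

theorem inv_pow_three_mul_sqrt {t : ℝ} (ht : 0 < t) :
    t⁻¹ ^ 3 * √(t ^ 3) = t ^ (-(3 / 2) : ℝ) := by
  rw [Real.sqrt_eq_rpow, ← Real.rpow_natCast t 3, ← Real.rpow_mul ht.le, inv_pow,
    ← Real.rpow_natCast t 3, ← Real.rpow_neg ht.le, ← Real.rpow_add ht]
  norm_num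

theorem IsTestFunction.integrable_sq {R : ℝ} {η : E3 → ℝ} (hη : IsTestFunction R η) :
    Integrable (fun z => η z ^ 2) := by
  have h := hη.smooth.continuous.memLp_of_hasCompactSupport (μ := volume) (p := 2) hη.compact
  exact h.integrable_sq

theorem nrm_comp_zoom_le {R : ℝ} {η : E3 → ℝ} (hη : IsTestFunction R η) {t : ℝ} (ht : 0 < t)
    (x : E3) : nrm R (fun z => η (zoom x t z)) ≤ √(t ^ 3 * ∫ y, η y ^ 2) := by
  apply Real.sqrt_le_sqrt
  rw [← integral_comp_zoom (fun y => η y ^ 2) x ht]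
  refine setIntegral_le_integral ?_ (Filter.Eventually.of_forall fun _ => sq_nonneg _)
  have := ((hη.integrable_sq.comp_add_left x).comp_smul (R := t⁻¹)
    (inv_ne_zero ht.ne')).comp_sub_right x
  simpa only [zoom] using this

/-- Cauchy–Schwarz: the dilated kernel has `L²` norm at most `√(t³ ∫ η²)`, and the prefactor `t⁻³`
turns this into `t^{-3/2}`. -/
theorem abs_avg_le {R : ℝ} {η : E3 → ℝ} (hη : IsTestFunction R η) {u : E3 → ℝ}
    (hu : MemLp u 2 (volume.restrict (cube R))) {t : ℝ} (ht : 0 < t) (x : E3) :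
    |avg R η u t x| ≤ √(∫ y, η y ^ 2) * t ^ (-(3 / 2) : ℝ) * nrm R u := by
  have hc : Continuous fun z => η (zoom x t z) :=
    hη.smooth.continuous.comp (contDiff_zoom x t).continuous
  have h1 := abs_setIntegral_mul_le (memLp_of_continuous_bound (R := R) hc) hu
  have h2 := nrm_comp_zoom_le hη ht x
  unfold avg
  rw [abs_mul, abs_of_pos (by positivity : 0 < t⁻¹ ^ 3)]
  calc t⁻¹ ^ 3 * |∫ z in cube R, η (zoom x t z) * u z|
      ≤ t⁻¹ ^ 3 * (√(t ^ 3 * ∫ y, η y ^ 2) * nrm R u) := by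
        gcongr
        exact h1.trans (mul_le_mul_of_nonneg_right h2 (nrm_nonneg _ _))
    _ = √(∫ y, η y ^ 2) * (t⁻¹ ^ 3 * √(t ^ 3)) * nrm R u := by
        rw [Real.sqrt_mul (by positivity)]; ring
    _ = _ := by rw [inv_pow_three_mul_sqrt ht]

/-- The derivative of an average in the dilation parameter. -/
theorem hasDerivAt_avg {R : ℝ} {η : E3 → ℝ} (hη : IsTestFunction R η) {u : E3 → ℝ}
    {g : Fin 3 → E3 → ℝ} (h : ∀ i, HasWD R i u (g i)) {x : E3} (hx : x ∈ cube R) {t : ℝ}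
    (ht : 0 < t) (ht1 : t ≤ 1) :
    HasDerivAt (fun s => avg R η u s x)
      (∑ i, (avg R (fun y => y i * η y) (g i) t x - x i * avg R η (g i) t x)) t := by
  obtain ⟨C, hC0, hC⟩ := hη.exists_bound
  obtain ⟨D, hD0, hD⟩ := hη.exists_bound_fderiv
  have hu := (h 0).memLp
  have hui : Integrable u (volume.restrict (cube R)) := hu.integrable (by norm_num)
  have hR : 0 < R := (abs_nonneg _).trans_lt (hx 0)
  let K : ℝ → E3 → ℝ := fun s z => s⁻¹ ^ 3 * η (zoom x s z)
  let K' : ℝ → E3 → ℝ := fun s z =>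
    -(3 * s⁻¹ ^ 4 * η (zoom x s z)) + s⁻¹ ^ 3 * fderiv ℝ η (zoom x s z) ((-(s ^ 2)⁻¹) • (z - x))
  have hKc : ∀ s, Continuous (K s) := fun s =>
    continuous_const.mul (hη.smooth.continuous.comp (contDiff_zoom x s).continuous)
  have hK'c : ∀ s, Continuous (K' s) := fun s =>
    (continuous_const.mul (hη.smooth.continuous.comp (contDiff_zoom x s).continuous)).neg.add
      (continuous_const.mul
        (((hη.smooth.continuous_fderiv (by simp)).comp (contDiff_zoom x s).continuous).clm_apply
          (by fun_prop)))
  have hKd : ∀ s : ℝ, s ≠ 0 → ∀ z, HasDerivAt (fun s => K s z) (K' s z) s := by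
    intro s hs z
    have h1 : HasDerivAt (fun s : ℝ => zoom x s z) ((-(s ^ 2)⁻¹) • (z - x)) s :=
      ((hasDerivAt_inv hs).smul_const (z - x)).const_add x
    have h2 := ((hη.smooth.differentiable (by simp)) (zoom x s z)).hasFDerivAt.comp_hasDerivAt s h1
    have h3 : HasDerivAt (fun s : ℝ => s⁻¹ ^ 3) (-(3 * s⁻¹ ^ 4)) s := by
      refine ((hasDerivAt_inv hs).pow 3).congr_deriv ?_
      push_cast
      field_simp
    refine (h3.mul h2).congr_deriv ?_
    simp only [K', Function.comp]; ring
  -- The dilation parameter stays above `t / 2`, so `s⁻¹ ≤ 2 / t`; and `‖z - x‖ ≤ 6 R` because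
  -- points of the cube have norm at most `3 R`.
  have hmain := hasDerivAt_integral_of_dominated_loc_of_deriv_le (μ := volume.restrict (cube R))
    (F := fun s z => K s z * u z) (F' := fun s z => K' s z * u z) (x₀ := t)
    (s := Ioi (t / 2)) (bound := fun z => (3 * (2 / t) ^ 4 * C
      + (2 / t) ^ 3 * (D * ((2 / t) ^ 2 * (6 * R)))) * |u z|)
    (Ioi_mem_nhds (by linarith))
    (Filter.Eventually.of_forall fun s =>
      (hKc s).aestronglyMeasurable.mul hu.aestronglyMeasurable)
    (memLp_two_mul_integrable (memLp_of_continuous_bound (hKc t)) hu)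
    ((hK'c t).aestronglyMeasurable.mul hu.aestronglyMeasurable)
    (by
      filter_upwards [ae_restrict_mem (measurableSet_cube R)] with z hz s hs
      have hs0 : 0 < s := lt_trans (by positivity) hs
      have hs' : s⁻¹ ≤ 2 / t := by
        rw [inv_le_comm₀ hs0 (by positivity), inv_div]; exact (mem_Ioi.1 hs).le
      rw [norm_mul, Real.norm_eq_abs, Real.norm_eq_abs]
      refine mul_le_mul_of_nonneg_right ?_ (abs_nonneg _)
      refine (abs_add_le _ _).trans (add_le_add ?_ ?_)
      · rw [abs_neg, abs_mul, abs_of_nonneg (by positivity : 0 ≤ 3 * s⁻¹ ^ 4)]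
        exact mul_le_mul (by gcongr) (hC _) (abs_nonneg _) (by positivity)
      · rw [abs_mul, abs_of_nonneg (by positivity : 0 ≤ s⁻¹ ^ 3)]
        refine mul_le_mul (by gcongr) ?_ (abs_nonneg _) (by positivity)
        refine ((fderiv ℝ η (zoom x s z)).le_opNorm _).trans ?_
        refine mul_le_mul (hD _) ?_ (norm_nonneg _) hD0
        rw [norm_smul, norm_neg, Real.norm_eq_abs, abs_of_nonneg (by positivity), ← inv_pow]
        refine mul_le_mul (by gcongr) ?_ (norm_nonneg _) (by positivity)
        refine (norm_sub_le _ _).trans ?_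
        linarith [norm_le_of_mem_cube hx, norm_le_of_mem_cube hz])
    (hui.abs.const_mul _)
    (by
      filter_upwards with z s hs
      have hs0 : 0 < s := lt_trans (by positivity) hs
      exact (hKd s hs0.ne' z).mul_const (u z))
  have hfun : (fun s => avg R η u s x) = fun s => ∫ z in cube R, K s z * u z := by
    ext s
    simp only [avg, K, ← integral_const_mul, mul_assoc]
  rw [hfun]
  refine hmain.2.congr_deriv ?_
  -- integrate by parts against the test functions `θ i`
  let θ : Fin 3 → E3 → ℝ := fun i z => (t⁻¹ ^ 4 * (z i - x i)) * η (zoom x t z)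
  have hθ : ∀ i, IsTestFunction R (θ i) := fun i =>
    (hη.comp_zoom hx ht ht1).smooth_mul (contDiff_const.mul ((contDiff_coord i).sub contDiff_const))
  have hpd : ∀ i z, pd i (θ i) z
      = t⁻¹ ^ 4 * η (zoom x t z) + t⁻¹ ^ 5 * ((z i - x i) * pd i η (zoom x t z)) := by
    intro i z
    have e1 : DifferentiableAt ℝ (fun z : E3 => t⁻¹ ^ 4 * (z i - x i)) z := by fun_prop
    have e2 : DifferentiableAt ℝ (fun z : E3 => η (zoom x t z)) z :=
      (hη.comp_zoom hx ht ht1).smooth.differentiable (by simp) z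
    have e3 : pd i (fun z : E3 => t⁻¹ ^ 4 * (z i - x i)) z = t⁻¹ ^ 4 := by
      have : (fun z : E3 => t⁻¹ ^ 4 * (z i - x i)) = fun z => t⁻¹ ^ 4 * z i - t⁻¹ ^ 4 * x i := by
        ext; ring
      have h5 := pd_coord i i z
      unfold pd at h5 ⊢
      rw [this, fderiv_sub_const, fderiv_const_mul (by fun_prop)]
      simp only [_root_.smul_apply, h5, smul_eq_mul, if_true, mul_one]
    simp only [θ]
    rw [pd_mul e1 e2, e3, pd_comp_zoom hη.smooth]
    ring
  -- Continuity equation: dilation transports the mass of the kernel, so its `t`-derivative is minus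
  -- the divergence of the flux `θ`. The weak derivatives of `u` can then be tested with the
  -- components of `θ`.
  have hK'eq : ∀ z, K' t z = -∑ i, pd i (θ i) z := by
    intro z
    simp only [K', hpd, fderiv_eq_sum_pd, Fin.sum_univ_three, PiLp.smul_apply, PiLp.sub_apply,
      smul_eq_mul]
    field_simp
    ring
  have hint : ∀ i, Integrable (fun z => pd i (θ i) z * u z) (volume.restrict (cube R)) := fun i =>
    memLp_two_mul_integrable (memLp_of_continuous_bound (contDiff_pd (hθ i).smooth).continuous) hu
  have e1 : ∫ z in cube R, K' t z * u z = -∑ i, ∫ z in cube R, pd i (θ i) z * u z := by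
    rw [← integral_finsetSum _ fun i _ => hint i, ← integral_neg]
    congr 1; ext z
    rw [hK'eq, neg_mul, Finset.sum_mul]
  rw [e1, ← Finset.sum_neg_distrib]
  refine Finset.sum_congr rfl fun i _ => ?_
  rw [(h i).eq _ (hθ i), neg_neg]
  have hgi := (h i).memLp_deriv
  have hc : Continuous fun z => η (zoom x t z) :=
    hη.smooth.continuous.comp (contDiff_zoom x t).continuous
  have hc2 : Continuous fun z => zoom x t z i * η (zoom x t z) :=
    ((contDiff_coord i).continuous.comp (contDiff_zoom x t).continuous).mul hc
  simp only [avg]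
  rw [mul_left_comm, ← mul_sub, ← integral_const_mul (x i), ← integral_sub
    (memLp_two_mul_integrable (memLp_of_continuous_bound hc2) hgi)
    ((memLp_two_mul_integrable (memLp_of_continuous_bound hc) hgi).const_mul _),
    ← integral_const_mul]
  congr 1; ext z
  simp only [θ, zoom, PiLp.add_apply, PiLp.smul_apply, PiLp.sub_apply, smul_eq_mul]
  field_simp
  ring

/-! ### Pointwise bounds of averages -/

/-- Both `G - f` and `G + f` are nondecreasing. This comparison avoids any question of integrability
of `f'`. -/
theorem abs_sub_le_of_abs_deriv_le {f f' G G' : ℝ → ℝ} {s t : ℝ} (hst : s ≤ t)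
    (hf : ∀ x ∈ Icc s t, HasDerivAt f (f' x) x) (hG : ∀ x ∈ Icc s t, HasDerivAt G (G' x) x)
    (h : ∀ x ∈ Icc s t, |f' x| ≤ G' x) : |f t - f s| ≤ G t - G s := by
  have hint : interior (Icc s t) ⊆ Icc s t := interior_subset
  have h1 : MonotoneOn (fun x => G x - f x) (Icc s t) :=
    monotoneOn_of_hasDerivWithinAt_nonneg (convex_Icc s t)
      (fun x hx => ((hG x hx).sub (hf x hx)).continuousAt.continuousWithinAt)
      (fun x hx => ((hG x (hint hx)).sub (hf x (hint hx))).hasDerivWithinAt)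
      (fun x hx => by linarith [(abs_le.1 (h x (hint hx))).2])
  have h2 : MonotoneOn (fun x => G x + f x) (Icc s t) :=
    monotoneOn_of_hasDerivWithinAt_nonneg (convex_Icc s t)
      (fun x hx => ((hG x hx).add (hf x hx)).continuousAt.continuousWithinAt)
      (fun x hx => ((hG x (hint hx)).add (hf x (hint hx))).hasDerivWithinAt)
      (fun x hx => by linarith [(abs_le.1 (h x (hint hx))).1])
  have h3 := h1 (left_mem_Icc.2 hst) (right_mem_Icc.2 hst) hst
  have h4 := h2 (left_mem_Icc.2 hst) (right_mem_Icc.2 hst) hst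
  simp only at h3 h4
  rw [abs_le]; constructor <;> linarith

/-- `u` and its weak derivatives up to order `n` exist and have `L²` norms at most `S`. -/
def HBound (R : ℝ) : ℕ → (E3 → ℝ) → ℝ → Prop
  | 0, u, S => MemLp u 2 (volume.restrict (cube R)) ∧ nrm R u ≤ S
  | n + 1, u, S => (MemLp u 2 (volume.restrict (cube R)) ∧ nrm R u ≤ S) ∧
      ∃ g : Fin 3 → E3 → ℝ, ∀ i, HasWD R i u (g i) ∧ HBound R n (g i) S

theorem HBound.zero {R : ℝ} {n : ℕ} {u : E3 → ℝ} {S : ℝ} (h : HBound R n u S) :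
    MemLp u 2 (volume.restrict (cube R)) ∧ nrm R u ≤ S := by
  cases n with
  | zero => exact h
  | succ n => exact h.1

/-- The class `P` of functions `u` of size at most `S` has averages of size `S t^{-q}`. -/
def AvgBound (R : ℝ) (P : (E3 → ℝ) → ℝ → Prop) (q : ℝ) : Prop :=
  ∀ η, IsTestFunction R η → ∃ C, 0 ≤ C ∧ ∀ u S, P u S → ∀ x ∈ cube R, ∀ t, 0 < t → t ≤ 1 →
    |avg R η u t x| ≤ C * S * t ^ (-q)

theorem IsTestFunction.coord_mul {R : ℝ} {η : E3 → ℝ} (h : IsTestFunction R η) (i : Fin 3) :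
    IsTestFunction R (fun y => y i * η y) := h.smooth_mul (contDiff_coord i)

theorem avgBound_zero (R : ℝ) : AvgBound R (HBound R 0) (3 / 2) := by
  intro η hη
  refine ⟨√(∫ y, η y ^ 2), Real.sqrt_nonneg _, fun u S hu x _ t ht _ => ?_⟩
  refine (abs_avg_le hη hu.1 ht x).trans ?_
  rw [mul_right_comm]
  have := hu.2
  gcongr

/-- The `t`-derivative of an average of `u` consists of averages of its gradient, of size
`t^{-(q+1)}`; integration from `t` to `1` gains one power of `t`. For `q < 0` the integral converges
at zero and the averages merely stay bounded, whence `max q 0`; the excluded value `q = 0` would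
produce a logarithm. -/
theorem AvgBound.succ {R : ℝ} {n : ℕ} {q : ℝ} (h : AvgBound R (HBound R n) (q + 1))
    (hq : q ≠ 0) : AvgBound R (HBound R (n + 1)) (max q 0) := by
  intro η hη
  obtain ⟨A, hA0, hA⟩ := avgBound_zero R η hη
  obtain ⟨B, hB0, hB⟩ := h η hη
  choose D hD0 hD using fun i => h _ (hη.coord_mul i)
  rcases le_or_gt R 0 with hR | hR
  · exact ⟨0, le_rfl, fun u S _ x hx => absurd ((abs_nonneg _).trans_lt (hx 0)) (not_lt.2 hR)⟩
  set E : ℝ := ∑ i : Fin 3, (D i + R * B) with hE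
  have hE0 : 0 ≤ E := Finset.sum_nonneg fun i _ => by have := hD0 i; positivity
  -- `A` bounds the average at `t = 1`, and `E / |q|` bounds the variation between `t` and `1`.
  refine ⟨A + E * |q|⁻¹, by positivity, fun u S hu x hx t ht ht1 => ?_⟩
  obtain ⟨hu0, g, hg⟩ := hu
  have hS : 0 ≤ S := (nrm_nonneg _ _).trans hu0.2
  have h1 : |avg R η u 1 x| ≤ A * S := by
    simpa using hA u S hu0 x hx 1 one_pos le_rfl
  have h2 := abs_sub_le_of_abs_deriv_le (f := fun s => avg R η u s x)
    (f' := fun s => ∑ i, (avg R (fun y => y i * η y) (g i) s x - x i * avg R η (g i) s x))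
    (G := fun s => -(E * S / q) * s ^ (-q)) (G' := fun s => E * S * s ^ (-(q + 1))) ht1
    (fun s hs => hasDerivAt_avg hη (fun i => (hg i).1) hx (ht.trans_le hs.1) hs.2)
    (fun s hs => by
      have := (Real.hasDerivAt_rpow_const (x := s) (p := -q)
        (Or.inl (ht.trans_le hs.1).ne')).const_mul (-(E * S / q))
      refine this.congr_deriv ?_
      rw [neg_add]
      field_simp
      rfl)
    (fun s hs => by
      have hs0 := ht.trans_le hs.1
      rw [hE, Finset.sum_mul, Finset.sum_mul]
      refine (Finset.abs_sum_le_sum_abs _ _).trans (Finset.sum_le_sum fun i _ => ?_)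
      refine (abs_sub _ _).trans ?_
      rw [abs_mul, add_mul, add_mul, mul_assoc R, mul_assoc R]
      exact add_le_add (hD i _ _ (hg i).2 x hx s hs0 hs.2)
        (mul_le_mul (hx i).le (hB _ _ (hg i).2 x hx s hs0 hs.2) (abs_nonneg _) hR.le))
  have h3 : 1 ≤ t ^ (-(max q 0)) := Real.one_le_rpow_of_pos_of_le_one_of_nonpos ht ht1
    (by simp)
  have h4 : |q|⁻¹ * (E * S) * t ^ (-(max q 0)) ≥
      -(E * S / q) * (1 : ℝ) ^ (-q) - -(E * S / q) * t ^ (-q) := by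
    have h5 : 0 ≤ t ^ (-q) := Real.rpow_nonneg ht.le _
    have hES : 0 ≤ E * S := by positivity
    rw [Real.one_rpow]
    rcases lt_or_gt_of_ne hq with hq0 | hq0
    · have : 0 < (-q)⁻¹ := inv_pos.2 (neg_pos.2 hq0)
      rw [max_eq_right hq0.le, abs_of_neg hq0, neg_zero, Real.rpow_zero]
      have e : -(E * S / q) = (-q)⁻¹ * (E * S) := by field_simp
      rw [e]
      have : 0 ≤ (-q)⁻¹ * (E * S) * t ^ (-q) := by positivity
      linarith
    · rw [max_eq_left hq0.le, abs_of_pos hq0]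
      have e : E * S / q = q⁻¹ * (E * S) := by field_simp
      rw [e]
      have : 0 ≤ q⁻¹ * (E * S) := by positivity
      linarith
  have h6 : |avg R η u t x| ≤ |avg R η u 1 x| + |avg R η u 1 x - avg R η u t x| := by
    have := abs_sub_abs_le_abs_sub (avg R η u t x) (avg R η u 1 x)
    rw [abs_sub_comm] at this
    linarith
  have h7 : A * S ≤ A * S * t ^ (-(max q 0)) := le_mul_of_one_le_right (by positivity) h3
  calc |avg R η u t x| ≤ A * S * t ^ (-(max q 0)) + |q|⁻¹ * (E * S) * t ^ (-(max q 0)) := by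
        linarith
    _ = _ := by ring

theorem avgBound_one (R : ℝ) : AvgBound R (HBound R 1) (1 / 2) := by
  have h := AvgBound.succ (q := 1 / 2) (n := 0) (R := R) (by
    have := avgBound_zero R; norm_num at this ⊢; exact this) (by norm_num)
  rwa [max_eq_left (by norm_num)] at h

/-- The exponent descends from `3/2` through `1/2` to `-1/2`, where it is cut off at zero: two
derivatives suffice in dimension three because `2 > 3/2`. -/
theorem avgBound_two (R : ℝ) : AvgBound R (HBound R 2) 0 := by
  have h := AvgBound.succ (q := -(1 / 2)) (n := 1) (R := R) (by
    have := avgBound_one R; norm_num at this ⊢; exact this) (by norm_num)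
  rwa [max_eq_right (by norm_num)] at h

/-! ### Mean square bounds of averages -/

theorem sq_lintegral_mul_le {α : Type*} [MeasurableSpace α] {μ : Measure α} {f g : α → ENNReal}
    (hf : AEMeasurable f μ) (hg : AEMeasurable g μ) :
    (∫⁻ x, f x * g x ∂μ) ^ 2 ≤ (∫⁻ x, f x ^ 2 ∂μ) * ∫⁻ x, g x ^ 2 ∂μ := by
  have h := ENNReal.lintegral_mul_le_Lp_mul_Lq μ (p := 2) (q := 2) ⟨by norm_num, by norm_num, by norm_num⟩ hf hg
  calc (∫⁻ x, f x * g x ∂μ) ^ 2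
      ≤ ((∫⁻ x, f x ^ (2 : ℝ) ∂μ) ^ (1 / 2 : ℝ) * (∫⁻ x, g x ^ (2 : ℝ) ∂μ) ^ (1 / 2 : ℝ)) ^ 2 := by
        gcongr; exact h
    _ = _ := by
        rw [mul_pow, ← ENNReal.rpow_natCast, ← ENNReal.rpow_natCast, ← ENNReal.rpow_mul,
          ← ENNReal.rpow_mul]
        norm_num

theorem sq_lintegral_weight_mul_le {α : Type*} [MeasurableSpace α] {μ : Measure α}
    {k f : α → ENNReal} (hk : AEMeasurable k μ) (hf : AEMeasurable f μ) :
    (∫⁻ x, k x * f x ∂μ) ^ 2 ≤ (∫⁻ x, k x ∂μ) * ∫⁻ x, k x * f x ^ 2 ∂μ := by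
  have e : ∀ x, k x ^ (1 / 2 : ℝ) * k x ^ (1 / 2 : ℝ) = k x := by
    intro x
    rw [← ENNReal.rpow_add_of_nonneg _ _ (by norm_num) (by norm_num)]; norm_num
  have h := sq_lintegral_mul_le (μ := μ) (f := fun x => k x ^ (1 / 2 : ℝ))
    (g := fun x => k x ^ (1 / 2 : ℝ) * f x) (hk.pow_const _) ((hk.pow_const _).mul hf)
  simp only [← mul_assoc, e, mul_pow, sq (_ ^ (1 / 2 : ℝ))] at h
  exact h

/-- The average with absolute values. -/
def lavg (R : ℝ) (η : E3 → ℝ) (f : E3 → ENNReal) (t : ℝ) (x : E3) : ENNReal :=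
  ∫⁻ z in cube R, ‖t⁻¹ ^ 3 * η (zoom x t z)‖ₑ * f z

theorem measurable_zoom : Measurable fun p : ℝ × E3 × E3 => zoom p.2.1 p.1 p.2.2 := by
  unfold zoom
  exact (measurable_fst.comp measurable_snd).add (measurable_fst.inv.smul
    ((measurable_snd.comp measurable_snd).sub (measurable_fst.comp measurable_snd)))

theorem measurable_kernel {η : E3 → ℝ} (hη : Continuous η) :
    Measurable fun p : ℝ × E3 × E3 => ‖p.1⁻¹ ^ 3 * η (zoom p.2.1 p.1 p.2.2)‖ₑ :=
  ((measurable_fst.inv.pow_const 3).mul (hη.measurable.comp measurable_zoom)).enorm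

theorem measurable_lavg {R : ℝ} {η : E3 → ℝ} (hη : Continuous η) {f : E3 → ENNReal}
    (hf : Measurable f) : Measurable fun p : ℝ × E3 => lavg R η f p.1 p.2 := by
  unfold lavg
  refine Measurable.lintegral_prod_right' (f := fun q : (ℝ × E3) × E3 =>
    ‖q.1.1⁻¹ ^ 3 * η (zoom q.1.2 q.1.1 q.2)‖ₑ * f q.2) ?_
  exact ((measurable_kernel hη).comp (f := fun q : (ℝ × E3) × E3 => (q.1.1, q.1.2, q.2))
    (by fun_prop)).mul (hf.comp measurable_snd)

theorem lintegral_kernel_sq_le {R : ℝ} {η : E3 → ℝ} (hη : IsTestFunction R η) {t : ℝ}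
    (ht : 0 < t) (x : E3) :
    ∫⁻ z in cube R, ‖t⁻¹ ^ 3 * η (zoom x t z)‖ₑ ^ 2
      ≤ ENNReal.ofReal (t⁻¹ ^ 3 * ∫ y, η y ^ 2) := by
  have hi : Integrable (fun z => (t⁻¹ ^ 3 * η (zoom x t z)) ^ 2) := by
    simp_rw [mul_pow]
    refine Integrable.const_mul ?_ _
    have := ((hη.integrable_sq.comp_add_left x).comp_smul (R := t⁻¹)
      (inv_ne_zero ht.ne')).comp_sub_right x
    simpa only [zoom] using this
  calc ∫⁻ z in cube R, ‖t⁻¹ ^ 3 * η (zoom x t z)‖ₑ ^ 2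
      ≤ ∫⁻ z, ‖t⁻¹ ^ 3 * η (zoom x t z)‖ₑ ^ 2 := setLIntegral_le_lintegral _ _
    _ = ∫⁻ z, ‖(t⁻¹ ^ 3 * η (zoom x t z)) ^ 2‖ₑ := by simp_rw [enorm_pow]
    _ = ENNReal.ofReal (∫ z, ‖(t⁻¹ ^ 3 * η (zoom x t z)) ^ 2‖) :=
        (ofReal_integral_norm_eq_lintegral_enorm hi).symm
    _ = _ := by
        congr 1
        simp_rw [norm_pow, norm_mul, mul_pow, integral_const_mul, Real.norm_eq_abs, sq_abs]
        rw [integral_comp_zoom (fun y => η y ^ 2) x ht]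
        field_simp

theorem lintegral_kernel_le {R : ℝ} {η : E3 → ℝ} (hη : IsTestFunction R η) {t : ℝ}
    (ht : 0 < t) (x : E3) :
    ∫⁻ z in cube R, ‖t⁻¹ ^ 3 * η (zoom x t z)‖ₑ ≤ ENNReal.ofReal (∫ y, |η y|) := by
  have h0 : Integrable η := hη.smooth.continuous.integrable_of_hasCompactSupport hη.compact
  have hi : Integrable (fun z => t⁻¹ ^ 3 * η (zoom x t z)) := by
    refine Integrable.const_mul ?_ _
    have := ((h0.comp_add_left x).comp_smul (R := t⁻¹) (inv_ne_zero ht.ne')).comp_sub_right x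
    simpa only [zoom] using this
  calc ∫⁻ z in cube R, ‖t⁻¹ ^ 3 * η (zoom x t z)‖ₑ
      ≤ ∫⁻ z, ‖t⁻¹ ^ 3 * η (zoom x t z)‖ₑ := setLIntegral_le_lintegral _ _
    _ = ENNReal.ofReal (∫ z, ‖t⁻¹ ^ 3 * η (zoom x t z)‖) :=
        (ofReal_integral_norm_eq_lintegral_enorm hi).symm
    _ = _ := by
        congr 1
        simp_rw [norm_mul, integral_const_mul, Real.norm_eq_abs]
        rw [integral_comp_zoom (fun y => |η y|) x ht, abs_of_pos (by positivity)]
        field_simp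

/-- Here the integration is over the centre `x`. Since `zoom x t z = (1 - t⁻¹) x + t⁻¹ z`, the
Jacobian combined with `t⁻³` gives `(1 - t)⁻³`, which is at most `8` for `t ≤ 1/2`. -/
theorem lintegral_kernel_le' {R : ℝ} {η : E3 → ℝ} (hη : IsTestFunction R η) {t : ℝ}
    (ht : 0 < t) (ht1 : t ≤ 1 / 2) (z : E3) :
    ∫⁻ x in cube R, ‖t⁻¹ ^ 3 * η (zoom x t z)‖ₑ ≤ ENNReal.ofReal (8 * ∫ y, |η y|) := by
  have h0 : Integrable η := hη.smooth.continuous.integrable_of_hasCompactSupport hη.compact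
  have hz : ∀ x, zoom x t z = (1 - t⁻¹) • x + t⁻¹ • z := by intro x; unfold zoom; module
  have htt : 1 < t⁻¹ := (one_lt_inv₀ ht).2 (by linarith)
  have hne : 1 - t⁻¹ ≠ 0 := by linarith
  have hi : Integrable (fun x => t⁻¹ ^ 3 * η (zoom x t z)) := by
    refine Integrable.const_mul ?_ _
    have := (h0.comp_add_right (t⁻¹ • z)).comp_smul hne
    simpa only [hz] using this
  calc ∫⁻ x in cube R, ‖t⁻¹ ^ 3 * η (zoom x t z)‖ₑ
      ≤ ∫⁻ x, ‖t⁻¹ ^ 3 * η (zoom x t z)‖ₑ := setLIntegral_le_lintegral _ _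
    _ = ENNReal.ofReal (∫ x, ‖t⁻¹ ^ 3 * η (zoom x t z)‖) :=
        (ofReal_integral_norm_eq_lintegral_enorm hi).symm
    _ ≤ _ := by
        apply ENNReal.ofReal_le_ofReal
        simp_rw [norm_mul, integral_const_mul, Real.norm_eq_abs, hz]
        rw [Measure.integral_comp_smul volume (fun x => |η (x + t⁻¹ • z)|) (1 - t⁻¹),
          integral_add_right_eq_self (fun x => |η x|), smul_eq_mul, ← mul_assoc]
        refine mul_le_mul_of_nonneg_right ?_ (integral_nonneg fun _ => abs_nonneg _)
        have e : Module.finrank ℝ E3 = 3 := by simp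
        rw [e, ← abs_mul, ← inv_pow, ← mul_pow, abs_pow]
        have e2 : |t⁻¹ * (1 - t⁻¹)⁻¹| ≤ 2 := by
          rw [← mul_inv, abs_inv, mul_sub, mul_one, mul_inv_cancel₀ ht.ne', abs_of_neg (by linarith),
            inv_le_comm₀ (by linarith) (by norm_num)]
          linarith
        calc |t⁻¹ * (1 - t⁻¹)⁻¹| ^ 3 ≤ 2 ^ 3 := pow_le_pow_left₀ (abs_nonneg _) e2 3
          _ = 8 := by norm_num

theorem lavg_sq_le {R : ℝ} {η : E3 → ℝ} (hη : IsTestFunction R η) {f : E3 → ENNReal}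
    (hf : AEMeasurable f (volume.restrict (cube R))) {t : ℝ} (ht : 0 < t) (x : E3) :
    lavg R η f t x ^ 2 ≤ ENNReal.ofReal (t⁻¹ ^ 3 * ∫ y, η y ^ 2) * ∫⁻ z in cube R, f z ^ 2 := by
  refine (sq_lintegral_mul_le ?_ hf).trans (mul_le_mul_left (lintegral_kernel_sq_le hη ht x) _)
  exact ((measurable_kernel hη.smooth.continuous).comp
    (f := fun z : E3 => (t, x, z)) (by fun_prop)).aemeasurable

/-- Schur test: Cauchy–Schwarz with respect to the kernel in `z`, Tonelli, and the bounds for the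
mass of the kernel in each of the two variables. -/
theorem lintegral_lavg_sq_le {R : ℝ} {η : E3 → ℝ} (hη : IsTestFunction R η) {f : E3 → ENNReal}
    (hf : Measurable f) {t : ℝ} (ht : 0 < t) (ht1 : t ≤ 1 / 2) :
    ∫⁻ x in cube R, lavg R η f t x ^ 2
      ≤ ENNReal.ofReal (8 * (∫ y, |η y|) ^ 2) * ∫⁻ z in cube R, f z ^ 2 := by
  have hk := measurable_kernel hη.smooth.continuous
  have hk' : Measurable fun p : E3 × E3 => ‖t⁻¹ ^ 3 * η (zoom p.1 t p.2)‖ₑ :=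
    hk.comp (f := fun p : E3 × E3 => (t, p.1, p.2)) (by fun_prop)
  have hA : 0 ≤ ∫ y, |η y| := integral_nonneg fun _ => abs_nonneg _
  calc ∫⁻ x in cube R, lavg R η f t x ^ 2
      ≤ ∫⁻ x in cube R, ENNReal.ofReal (∫ y, |η y|) *
          ∫⁻ z in cube R, ‖t⁻¹ ^ 3 * η (zoom x t z)‖ₑ * f z ^ 2 := by
        refine lintegral_mono fun x => (sq_lintegral_weight_mul_le ?_ hf.aemeasurable).trans
          (mul_le_mul_left (lintegral_kernel_le hη ht x) _)
        exact (hk'.comp (f := fun z : E3 => (x, z)) (by fun_prop)).aemeasurable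
    _ = ENNReal.ofReal (∫ y, |η y|) * ∫⁻ z in cube R,
          (∫⁻ x in cube R, ‖t⁻¹ ^ 3 * η (zoom x t z)‖ₑ) * f z ^ 2 := by
        rw [lintegral_const_mul' _ _ ENNReal.ofReal_ne_top, lintegral_lintegral_swap]
        · congr 1
          refine lintegral_congr fun z => ?_
          rw [lintegral_mul_const]
          exact hk'.comp (f := fun x : E3 => (x, z)) (by fun_prop)
        · exact (hk'.mul ((hf.comp measurable_snd).pow_const 2)).aemeasurable
    _ ≤ ENNReal.ofReal (∫ y, |η y|) * ∫⁻ z in cube R,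
          ENNReal.ofReal (8 * ∫ y, |η y|) * f z ^ 2 := by
        gcongr with z
        exact lintegral_kernel_le' hη ht ht1 z
    _ = _ := by
        rw [lintegral_const_mul _ (hf.pow_const 2), ← mul_assoc, ← ENNReal.ofReal_mul hA]
        congr 2; ring

/-! ### Approximation by averages -/

theorem enorm_avg_le {R : ℝ} {η u : E3 → ℝ} (t : ℝ) (x : E3) :
    ‖avg R η u t x‖ₑ ≤ lavg R η (fun z => ‖u z‖ₑ) t x := by
  unfold avg lavg
  rw [← integral_const_mul]
  refine (enorm_integral_le_lintegral_enorm _).trans (lintegral_mono fun z => ?_)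
  rw [← mul_assoc, enorm_mul]

theorem avg_congr {R : ℝ} {η u v : E3 → ℝ} (h : u =ᵐ[volume.restrict (cube R)] v) (t : ℝ) :
    avg R η u t = avg R η v t := by
  ext x
  unfold avg
  congr 1
  apply integral_congr_ae
  filter_upwards [h] with z hz
  rw [hz]

theorem stronglyMeasurable_avg {R : ℝ} {η u : E3 → ℝ} (hη : Continuous η)
    (hu : AEStronglyMeasurable u (volume.restrict (cube R))) (t : ℝ) :
    StronglyMeasurable (avg R η u t) := by
  rw [avg_congr hu.ae_eq_mk t]
  unfold avg
  refine StronglyMeasurable.const_mul (StronglyMeasurable.integral_prod_right'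
    (f := fun p : E3 × E3 => η (zoom p.1 t p.2) * hu.mk u p.2) ?_) _
  have h1 : Measurable fun p : E3 × E3 => η (zoom p.1 t p.2) :=
    (hη.measurable.comp measurable_zoom).comp (f := fun p : E3 × E3 => (t, p.1, p.2))
      (by fun_prop)
  exact h1.stronglyMeasurable.mul (hu.stronglyMeasurable_mk.comp_measurable measurable_snd)

theorem avg_sub {R : ℝ} {η u v : E3 → ℝ} (hη : Continuous η)
    (hu : MemLp u 2 (volume.restrict (cube R))) (hv : MemLp v 2 (volume.restrict (cube R)))
    (t : ℝ) (x : E3) :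
    avg R η (fun y => u y - v y) t x = avg R η u t x - avg R η v t x := by
  have hc : Continuous fun z => η (zoom x t z) := hη.comp (contDiff_zoom x t).continuous
  unfold avg
  rw [← mul_sub, ← integral_sub (memLp_two_mul_integrable (memLp_of_continuous_bound hc) hu)
    (memLp_two_mul_integrable (memLp_of_continuous_bound hc) hv)]
  simp_rw [mul_sub]

theorem eLpNorm_two_le_of_lintegral_le {α : Type*} [MeasurableSpace α] {μ : Measure α}
    {f g : α → ℝ} {C : ENNReal}
    (h : ∫⁻ x, ‖f x‖ₑ ^ 2 ∂μ ≤ C ^ 2 * ∫⁻ x, ‖g x‖ₑ ^ 2 ∂μ) :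
    eLpNorm f 2 μ ≤ C * eLpNorm g 2 μ := by
  rw [eLpNorm_eq_lintegral_rpow_enorm_toReal (by norm_num) (by norm_num),
    eLpNorm_eq_lintegral_rpow_enorm_toReal (by norm_num) (by norm_num)]
  simp only [ENNReal.toReal_ofNat, ENNReal.rpow_ofNat]
  calc (∫⁻ x, ‖f x‖ₑ ^ 2 ∂μ) ^ (1 / 2 : ℝ)
      ≤ (C ^ 2 * ∫⁻ x, ‖g x‖ₑ ^ 2 ∂μ) ^ (1 / 2 : ℝ) := ENNReal.rpow_le_rpow h (by norm_num)
    _ = _ := by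
      rw [ENNReal.mul_rpow_of_nonneg _ _ (by norm_num), ← ENNReal.rpow_natCast,
        ← ENNReal.rpow_mul]
      norm_num

theorem eLpNorm_avg_le {R : ℝ} {η : E3 → ℝ} (hη : IsTestFunction R η) :
    ∃ C : NNReal, ∀ u, MemLp u 2 (volume.restrict (cube R)) → ∀ t, 0 < t → t ≤ 1 / 2 →
      eLpNorm (avg R η u t) 2 (volume.restrict (cube R))
        ≤ C * eLpNorm u 2 (volume.restrict (cube R)) := by
  -- The Schur test gives `8 (∫ |η|)²` for the squared norms; this is at most `(8 ∫ |η|)²`.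
  refine ⟨(8 * ∫ y, |η y|).toNNReal, fun u hu t ht ht1 => ?_⟩
  have hA : 0 ≤ ∫ y, |η y| := integral_nonneg fun _ => abs_nonneg _
  have hm := hu.aestronglyMeasurable
  rw [avg_congr hm.ae_eq_mk t, eLpNorm_congr_ae hm.ae_eq_mk]
  apply eLpNorm_two_le_of_lintegral_le
  calc ∫⁻ x in cube R, ‖avg R η (hm.mk u) t x‖ₑ ^ 2
      ≤ ∫⁻ x in cube R, lavg R η (fun z => ‖hm.mk u z‖ₑ) t x ^ 2 := by
        gcongr; exact enorm_avg_le _ _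
    _ ≤ _ := lintegral_lavg_sq_le hη hm.stronglyMeasurable_mk.measurable.enorm ht ht1
    _ ≤ _ := by
        gcongr
        rw [← ENNReal.ofReal, ← ENNReal.ofReal_pow (by positivity)]
        apply ENNReal.ofReal_le_ofReal
        nlinarith [sq_nonneg (∫ y, |η y|)]

/-- The dilated kernel has total mass one and charges only points within `6 R t` of `x`, so the
average differs from `g x` by at most the oscillation at that scale times `∫ |η|`. -/
theorem avg_sub_self_le {R : ℝ} {η : E3 → ℝ} (hη : IsTestFunction R η) (h1 : ∫ y, η y = 1)
    {g : E3 → ℝ} (hg : Continuous g) {x : E3} (hx : x ∈ cube R) {t : ℝ} (ht : 0 < t)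
    (ht1 : t ≤ 1) {e : ℝ} (he : ∀ z ∈ cube R, ‖z - x‖ ≤ t * (6 * R) → |g z - g x| ≤ e) :
    |avg R η g t x - g x| ≤ e * ∫ y, |η y| := by
  have hz := hη.comp_zoom hx ht ht1
  have hi := hz.smooth.continuous.integrable_of_hasCompactSupport (μ := volume) hz.compact
  have hcube : ∀ z, z ∉ cube R → η (zoom x t z) = 0 := fun z hzz => by
    by_contra hne
    exact hzz (hz.support_subset (subset_tsupport _ hne))
  have e1 : ∫ z in cube R, η (zoom x t z) = t ^ 3 := by
    rw [setIntegral_eq_integral_of_forall_compl_eq_zero hcube, integral_comp_zoom η x ht, h1,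
      mul_one]
  have e2 : avg R η g t x - g x = t⁻¹ ^ 3 * ∫ z in cube R, η (zoom x t z) * (g z - g x) := by
    have : ∫ z in cube R, η (zoom x t z) * (g z - g x)
        = (∫ z in cube R, η (zoom x t z) * g z) - t ^ 3 * g x := by
      simp_rw [mul_sub]
      rw [integral_sub (memLp_two_mul_integrable (memLp_of_continuous_bound hz.smooth.continuous)
        (memLp_of_continuous_bound hg)) (hi.integrableOn.mul_const _), integral_mul_const, e1]
    rw [this, avg, mul_sub]
    field_simp
  rw [e2, abs_mul, abs_of_pos (by positivity)]
  have h3 : |∫ z in cube R, η (zoom x t z) * (g z - g x)| ≤ ∫ z in cube R, |η (zoom x t z)| * e := by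
    refine (abs_integral_le_integral_abs).trans ?_
    refine setIntegral_mono_on ?_ (hi.abs.integrableOn.mul_const _) (measurableSet_cube R) ?_
    · exact (memLp_two_mul_integrable (memLp_of_continuous_bound hz.smooth.continuous)
        (memLp_of_continuous_bound (hg.sub continuous_const))).abs
    · intro z hzc
      rw [abs_mul]
      by_cases h0 : η (zoom x t z) = 0
      · simp [h0]
      · refine mul_le_mul_of_nonneg_left (he z hzc ?_) (abs_nonneg _)
        have hzo : zoom x t z ∈ cube R := hη.support_subset (subset_tsupport _ h0)
        have : z - x = t • (zoom x t z - x) := by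
          unfold zoom; rw [add_sub_cancel_left, smul_smul, mul_inv_cancel₀ ht.ne', one_smul]
        rw [this, norm_smul, Real.norm_eq_abs, abs_of_pos ht]
        gcongr
        refine (norm_sub_le _ _).trans ?_
        linarith [norm_le_of_mem_cube hx, norm_le_of_mem_cube hzo]
  have h4 : ∫ z in cube R, |η (zoom x t z)| = t ^ 3 * ∫ y, |η y| := by
    rw [setIntegral_eq_integral_of_forall_compl_eq_zero (fun z hz => by rw [hcube z hz, abs_zero]),
      integral_comp_zoom (fun y => |η y|) x ht]
  rw [integral_mul_const, h4] at h3
  calc t⁻¹ ^ 3 * |∫ z in cube R, η (zoom x t z) * (g z - g x)|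
      ≤ t⁻¹ ^ 3 * (t ^ 3 * (∫ y, |η y|) * e) := by gcongr
    _ = _ := by field_simp

/-- The averages are bounded on `L²` uniformly in `t ≤ 1/2` and converge uniformly on continuous
functions of compact support, which are dense. -/
theorem tendsto_avg {R : ℝ} {η : E3 → ℝ} (hη : IsTestFunction R η) (h1 : ∫ y, η y = 1)
    {u : E3 → ℝ} (hu : MemLp u 2 (volume.restrict (cube R))) :
    Tendsto (fun t => eLpNorm (fun x => avg R η u t x - u x) 2 (volume.restrict (cube R)))
      (𝓝[>] 0) (𝓝 0) := by
  obtain ⟨C, hC⟩ := eLpNorm_avg_le hη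
  have hA : 0 ≤ ∫ y, |η y| := integral_nonneg fun _ => abs_nonneg _
  set A := ∫ y, |η y| with hAdef
  rcases le_or_gt R 0 with hR | hR
  · have : cube R = ∅ := by
      ext x; simp only [mem_empty_iff_false, iff_false]
      exact fun hx => absurd ((abs_nonneg _).trans_lt (hx 0)) (not_lt.2 hR)
    simp [this]
  rw [ENNReal.tendsto_nhds_zero]
  intro ε hε
  rcases eq_or_ne ε ⊤ with rfl | hεt
  · simp
  set V := (volume.restrict (cube R)) Set.univ with hV
  have hVt : V ≠ ⊤ := measure_ne_top _ _
  -- Three errors are added: `C κ` for the average of `u - g`, and `κ` each for the average of `g`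
  -- minus `g` and for `g - u`.
  set κ : ENNReal := ε / (C + 2) with hκ
  have hκ0 : κ ≠ 0 := (ENNReal.div_pos hε.ne' (by simp)).ne'
  obtain ⟨g, hgc, hge, hgcont, hgm⟩ := hu.exists_hasCompactSupport_eLpNorm_sub_le
    (by norm_num) hκ0
  obtain ⟨e, he0, hee⟩ : ∃ e : ℝ, 0 < e ∧ V ^ (1 / 2 : ℝ) * ENNReal.ofReal (e * A) ≤ κ := by
    have hf : Tendsto (fun e : ℝ => V ^ (1 / 2 : ℝ) * ENNReal.ofReal (e * A)) (𝓝[>] 0)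
        (𝓝 (V ^ (1 / 2 : ℝ) * ENNReal.ofReal (0 * A))) := by
      refine ENNReal.Tendsto.const_mul (ENNReal.tendsto_ofReal ?_)
        (Or.inr (ENNReal.rpow_ne_top_of_nonneg (by norm_num) hVt))
      exact ((continuous_id.mul continuous_const).tendsto 0).mono_left nhdsWithin_le_nhds
    rw [zero_mul, ENNReal.ofReal_zero, mul_zero] at hf
    have := ((ENNReal.tendsto_nhds_zero.1 hf) κ (pos_iff_ne_zero.2 hκ0)).and
      self_mem_nhdsWithin
    obtain ⟨e, h1, h2⟩ := this.exists
    exact ⟨e, h2, h1⟩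
  have huc : UniformContinuous g := hgc.uniformContinuous_of_continuous hgcont
  obtain ⟨δ, hδ, hδg⟩ := Metric.uniformContinuous_iff.1 huc e he0
  have hev : ∀ᶠ t : ℝ in 𝓝[>] 0, 0 < t ∧ t ≤ 1 / 2 ∧ t * (6 * R) < δ := by
    refine (eventually_mem_nhdsWithin (a := (0 : ℝ)) (s := Ioi 0)).and (Eventually.and ?_ ?_)
    · exact nhdsWithin_le_nhds (Iic_mem_nhds (by norm_num))
    · refine nhdsWithin_le_nhds ((isOpen_Iio.preimage
        (continuous_id.mul continuous_const)).mem_nhds (?_ : (0 : ℝ) * (6 * R) ∈ Iio δ))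
      simpa using hδ
  filter_upwards [hev] with t ⟨ht, ht1, htδ⟩
  have hη' := hη.smooth.continuous
  have hsub : MemLp (fun x => u x - g x) 2 (volume.restrict (cube R)) := hu.sub hgm
  have b1 : eLpNorm (avg R η (fun x => u x - g x) t) 2 (volume.restrict (cube R)) ≤ C * κ :=
    (hC _ hsub t ht ht1).trans (by gcongr; exact hge)
  have b2 : eLpNorm (fun x => avg R η g t x - g x) 2 (volume.restrict (cube R)) ≤ κ := by
    refine (eLpNorm_le_of_ae_bound (C := e * A) ?_).trans ?_
    · filter_upwards [ae_restrict_mem (measurableSet_cube R)] with x hx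
      refine avg_sub_self_le hη h1 hgcont hx ht (by linarith) fun z _ hz => ?_
      have := hδg (a := z) (b := x) (by rw [dist_eq_norm]; exact hz.trans_lt htδ)
      rw [Real.dist_eq] at this
      exact this.le
    · simpa [V] using hee
  have b3 : eLpNorm (fun x => g x - u x) 2 (volume.restrict (cube R)) ≤ κ := by
    have := eLpNorm_sub_comm u g 2 (volume.restrict (cube R))
    exact (this ▸ hge : eLpNorm (g - u) 2 (volume.restrict (cube R)) ≤ κ)
  have hm1 := (stronglyMeasurable_avg hη' hsub.aestronglyMeasurable t).aestronglyMeasurable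
    (μ := volume.restrict (cube R))
  have hm2 : AEStronglyMeasurable (fun x => avg R η g t x - g x) (volume.restrict (cube R)) :=
    (stronglyMeasurable_avg hη' hgm.aestronglyMeasurable t).aestronglyMeasurable.sub
      hgm.aestronglyMeasurable
  have hm3 : AEStronglyMeasurable (fun x => g x - u x) (volume.restrict (cube R)) :=
    hgm.aestronglyMeasurable.sub hu.aestronglyMeasurable
  have hsplit : (fun x => avg R η u t x - u x) = avg R η (fun x => u x - g x) t
      + ((fun x => avg R η g t x - g x) + fun x => g x - u x) := by
    ext x
    simp only [Pi.add_apply, avg_sub hη' hu hgm]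
    ring
  rw [hsplit]
  refine (eLpNorm_add_le hm1 (hm2.add hm3) (by norm_num)).trans ?_
  refine (add_le_add b1 ((eLpNorm_add_le hm2 hm3 (by norm_num)).trans (add_le_add b2 b3))).trans ?_
  have : (C : ENNReal) * κ + (κ + κ) = κ * (C + 2) := by ring
  rw [this, hκ]
  rw [mul_comm]
  exact ENNReal.mul_div_le

/-- `L²` convergence gives convergence almost everywhere along a subsequence `t → 0`, and the bound
passes to the limit. The majorant `H` may be infinite at some points, so its finiteness never has to
be proved beforehand. -/
theorem ae_enorm_le_of_avg_le {R : ℝ} {η : E3 → ℝ} (hη : IsTestFunction R η)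
    (h1 : ∫ y, η y = 1) {u : E3 → ℝ} (hu : MemLp u 2 (volume.restrict (cube R)))
    {H : E3 → ENNReal} {e : ℝ} (he : 0 < e)
    (h : ∀ x ∈ cube R, ∀ t, 0 < t → t < e → ‖avg R η u t x‖ₑ ≤ H x) :
    ∀ᵐ x ∂(volume.restrict (cube R)), ‖u x‖ₑ ≤ H x := by
  obtain ⟨s, -, hs, hs0⟩ := exists_seq_strictAnti_tendsto' he
  have hs' : Tendsto s atTop (𝓝[>] 0) :=
    tendsto_nhdsWithin_iff.2 ⟨hs0, Eventually.of_forall fun n => (hs n).1⟩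
  have hm := tendstoInMeasure_of_tendsto_eLpNorm (p := 2) (by norm_num)
    (fun n => (stronglyMeasurable_avg hη.smooth.continuous hu.aestronglyMeasurable
      (s n)).aestronglyMeasurable) hu.aestronglyMeasurable
    ((tendsto_avg hη h1 hu).comp hs')
  obtain ⟨ns, -, hns⟩ := hm.exists_seq_tendsto_ae
  filter_upwards [hns, ae_restrict_mem (measurableSet_cube R)] with x hx hxc
  exact le_of_tendsto hx.enorm (Eventually.of_forall fun n => h x hxc _ (hs _).1 (hs _).2)

theorem exists_normalized_testFunction {R : ℝ} (hR : 0 < R) :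
    ∃ η : E3 → ℝ, IsTestFunction R η ∧ ∫ y, η y = 1 := by
  let f : ContDiffBump (0 : E3) := ⟨R / 4, R / 2, by positivity, by linarith⟩
  refine ⟨f.normed volume, ⟨f.contDiff_normed, f.hasCompactSupport_normed, ?_⟩,
    f.integral_normed⟩
  rw [f.tsupport_normed_eq]
  intro x hx i
  have : ‖x‖ ≤ R / 2 := by simpa using hx
  have h2 := PiLp.norm_apply_le x i
  rw [Real.norm_eq_abs] at h2
  linarith

/-- The embedding of `H²` into `L^∞`. -/
theorem exists_ae_abs_le_of_HBound_two {R : ℝ} (hR : 0 < R) : ∃ C, 0 ≤ C ∧ ∀ u S, HBound R 2 u S →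
    ∀ᵐ x ∂(volume.restrict (cube R)), |u x| ≤ C * S := by
  obtain ⟨η, hη, h1⟩ := exists_normalized_testFunction hR
  obtain ⟨C, hC0, hC⟩ := avgBound_two R η hη
  refine ⟨C, hC0, fun u S hu => ?_⟩
  have := ae_enorm_le_of_avg_le hη h1 hu.zero.1 (H := fun _ => ENNReal.ofReal (C * S)) one_pos
    (fun x hx t ht ht1 => by
      rw [Real.enorm_eq_ofReal_abs]
      apply ENNReal.ofReal_le_ofReal
      simpa using hC u S hu x hx t ht ht1.le)
  have hS : 0 ≤ S := (nrm_nonneg _ _).trans hu.zero.2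
  filter_upwards [this] with x hx
  rw [Real.enorm_eq_ofReal_abs] at hx
  exact (ENNReal.ofReal_le_ofReal_iff (by positivity)).1 hx

/-! ### Interpolation of the `L⁴` norm between `L²` and `H¹`. -/

theorem pow_four_lintegral_weight_mul_le {α : Type*} [MeasurableSpace α] {μ : Measure α}
    {k f : α → ENNReal} (hk : AEMeasurable k μ) (hf : AEMeasurable f μ) :
    (∫⁻ x, k x * f x ∂μ) ^ 4 ≤ (∫⁻ x, k x ∂μ) ^ 3 * ∫⁻ x, k x * f x ^ 4 ∂μ := by
  have h1 := sq_lintegral_weight_mul_le hk hf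
  have h2 := sq_lintegral_weight_mul_le hk (hf.pow_const 2)
  calc (∫⁻ x, k x * f x ∂μ) ^ 4 = ((∫⁻ x, k x * f x ∂μ) ^ 2) ^ 2 := by ring
    _ ≤ ((∫⁻ x, k x ∂μ) * ∫⁻ x, k x * f x ^ 2 ∂μ) ^ 2 := by gcongr
    _ = (∫⁻ x, k x ∂μ) ^ 2 * (∫⁻ x, k x * f x ^ 2 ∂μ) ^ 2 := by ring
    _ ≤ (∫⁻ x, k x ∂μ) ^ 2 * ((∫⁻ x, k x ∂μ) * ∫⁻ x, k x * (f x ^ 2) ^ 2 ∂μ) := by gcongr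
    _ = _ := by simp_rw [← pow_mul]; ring

theorem HasWD.congr {R : ℝ} {i : Fin 3} {u g u' g' : E3 → ℝ} (h : HasWD R i u g)
    (hu : u =ᵐ[volume.restrict (cube R)] u') (hg : g =ᵐ[volume.restrict (cube R)] g') :
    HasWD R i u' g' where
  memLp := (memLp_congr_ae hu).1 h.memLp
  memLp_deriv := (memLp_congr_ae hg).1 h.memLp_deriv
  eq φ hφ := by
    have e1 : ∫ x in cube R, pd i φ x * u' x = ∫ x in cube R, pd i φ x * u x :=
      integral_congr_ae (by filter_upwards [hu] with x hx; rw [hx])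
    have e2 : ∫ x in cube R, φ x * g' x = ∫ x in cube R, φ x * g x :=
      integral_congr_ae (by filter_upwards [hg] with x hx; rw [hx])
    rw [e1, e2, h.eq φ hφ]

theorem nrm_congr {R : ℝ} {u v : E3 → ℝ} (h : u =ᵐ[volume.restrict (cube R)] v) :
    nrm R u = nrm R v := by
  unfold nrm
  congr 1
  exact integral_congr_ae (by filter_upwards [h] with x hx; rw [hx])

theorem lintegral_enorm_sq {R : ℝ} {u : E3 → ℝ} (hu : MemLp u 2 (volume.restrict (cube R))) :
    ∫⁻ x in cube R, ‖u x‖ₑ ^ 2 = ENNReal.ofReal (nrm R u ^ 2) := by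
  rw [sq_nrm, ofReal_integral_eq_lintegral_ofReal hu.integrable_sq
    (Eventually.of_forall fun _ => sq_nonneg _)]
  refine lintegral_congr fun x => ?_
  rw [Real.enorm_eq_ofReal_abs, ← ENNReal.ofReal_pow (abs_nonneg _), sq_abs]

theorem lintegral_rpow_neg_three_quarters {e : ℝ} (he : 0 < e) :
    ∫⁻ t in Ioc 0 e, ENNReal.ofReal (t ^ (-(3 / 4) : ℝ)) = ENNReal.ofReal (4 * e ^ (1 / 4 : ℝ)) := by
  have hi : IntegrableOn (fun t : ℝ => t ^ (-(3 / 4) : ℝ)) (Ioc 0 e) := by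
    have := intervalIntegral.intervalIntegrable_rpow' (a := 0) (b := e) (r := -(3 / 4)) (by norm_num)
    rwa [intervalIntegrable_iff_integrableOn_Ioc_of_le he.le] at this
  rw [← ofReal_integral_eq_lintegral_ofReal hi]
  · rw [← intervalIntegral.integral_of_le he.le, integral_rpow (Or.inl (by norm_num))]
    congr 1
    norm_num
    ring
  · filter_upwards [ae_restrict_mem measurableSet_Ioc] with t ht
    exact Real.rpow_nonneg ht.1.le _

/-- The oscillation of averages is controlled by averages of the gradient. -/
theorem enorm_avg_le_add {R : ℝ} {η : E3 → ℝ} (hη : IsTestFunction R η) {u : E3 → ℝ}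
    {g : Fin 3 → E3 → ℝ} (h : ∀ i, HasWD R i u (g i)) {x : E3}
    (hx : x ∈ cube R) {s e : ℝ} (hs : 0 < s) (hse : s ≤ e) (he : e ≤ 1) :
    ‖avg R η u s x‖ₑ ≤ ‖avg R η u e x‖ₑ
      + ∫⁻ t in Ioc 0 e, ENNReal.ofReal (2 * R) * lavg R η (fun z => ∑ i, ‖g i z‖ₑ) t x := by
  have hR : 0 < R := (abs_nonneg _).trans_lt (hx 0)
  set D : ℝ → ℝ := fun t =>
    ∑ i, (avg R (fun y => y i * η y) (g i) t x - x i * avg R η (g i) t x) with hD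
  have hd : ∀ t ∈ Icc s e, HasDerivAt (fun s => avg R η u s x) (D t) t := fun t ht =>
    hasDerivAt_avg hη h hx (hs.trans_le ht.1) (ht.2.trans he)
  have hDle : ∀ t ∈ Ioc s e, ‖D t‖ₑ
      ≤ ENNReal.ofReal (2 * R) * lavg R η (fun z => ∑ i, ‖g i z‖ₑ) t x := by
    intro t ht
    have ht0 : 0 < t := hs.trans ht.1
    have hc : Continuous fun z => η (zoom x t z) :=
      hη.smooth.continuous.comp (contDiff_zoom x t).continuous
    have hc2 : ∀ i, Continuous fun z => zoom x t z i * η (zoom x t z) := fun i =>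
      ((contDiff_coord i).continuous.comp (contDiff_zoom x t).continuous).mul hc
    have hint : ∀ i, Integrable (fun z => (zoom x t z i * η (zoom x t z)) * g i z
        - x i * (η (zoom x t z) * g i z)) (volume.restrict (cube R)) := fun i =>
      (memLp_two_mul_integrable (memLp_of_continuous_bound (hc2 i)) (h i).memLp_deriv).sub
        ((memLp_two_mul_integrable (memLp_of_continuous_bound hc) (h i).memLp_deriv).const_mul _)
    have e1 : D t = ∫ z in cube R, ∑ i, (t⁻¹ ^ 3 * η (zoom x t z)) * (zoom x t z i - x i) * g i z := by
      have : (fun z => ∑ i, (t⁻¹ ^ 3 * η (zoom x t z)) * (zoom x t z i - x i) * g i z)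
          = fun z => t⁻¹ ^ 3 * ∑ i, ((zoom x t z i * η (zoom x t z)) * g i z
        - x i * (η (zoom x t z) * g i z)) := by
        ext z; rw [Finset.mul_sum]; exact Finset.sum_congr rfl fun i _ => by ring
      rw [this, integral_const_mul, integral_finsetSum _ fun i _ => hint i, hD, Finset.mul_sum]
      refine Finset.sum_congr rfl fun i _ => ?_
      rw [integral_sub (memLp_two_mul_integrable (memLp_of_continuous_bound (hc2 i))
        (h i).memLp_deriv) ((memLp_two_mul_integrable (memLp_of_continuous_bound hc)
        (h i).memLp_deriv).const_mul _), integral_const_mul, avg, avg]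
      ring
    rw [e1]
    refine (enorm_integral_le_lintegral_enorm _).trans ?_
    unfold lavg
    rw [← lintegral_const_mul' _ _ ENNReal.ofReal_ne_top]
    refine lintegral_mono fun z => ?_
    refine (enorm_sum_le _ _).trans ?_
    simp only [Finset.mul_sum]
    refine Finset.sum_le_sum fun i _ => ?_
    rw [enorm_mul, enorm_mul, ← mul_assoc]
    refine mul_le_mul_left ?_ _
    rw [mul_comm]
    by_cases h0 : η (zoom x t z) = 0
    · simp [h0]
    · refine mul_le_mul_left ?_ _
      have hzo : zoom x t z ∈ cube R := hη.support_subset (subset_tsupport _ h0)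
      rw [Real.enorm_eq_ofReal_abs]
      apply ENNReal.ofReal_le_ofReal
      refine (abs_sub _ _).trans ?_
      linarith [hzo i, hx i]
  -- `D` is measurable because it is a derivative on this interval, and bounded because the averages
  -- of the gradient are of order `t^{-3/2} ≤ s^{-3/2}`.
  have hii : IntervalIntegrable D volume s e := by
    obtain ⟨A, hA0, hA⟩ := avgBound_zero R η hη
    choose B hB0 hB using fun i => avgBound_zero R _ (hη.coord_mul i)
    have hmeas : AEStronglyMeasurable D (volume.restrict (Ioc s e)) := by
      have h1 := measurable_deriv (fun s => avg R η u s x)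
      refine (h1.aestronglyMeasurable (μ := volume.restrict (Ioc s e))).congr ?_
      filter_upwards [ae_restrict_mem measurableSet_Ioc] with t ht
      exact (hd t ⟨ht.1.le, ht.2⟩).deriv
    rw [intervalIntegrable_iff_integrableOn_Ioc_of_le hse]
    refine Integrable.mono' (g := fun _ => ∑ i, ((B i + R * A) * nrm R (g i) * s ^ (-(3 / 2) : ℝ)))
      (integrable_const _) hmeas ?_
    filter_upwards [ae_restrict_mem measurableSet_Ioc] with t ht
    have ht0 := hs.trans ht.1
    refine (norm_sum_le _ _).trans (Finset.sum_le_sum fun i _ => ?_)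
    have hst : t ^ (-(3 / 2) : ℝ) ≤ s ^ (-(3 / 2) : ℝ) :=
      Real.rpow_le_rpow_of_nonpos hs ht.1.le (by norm_num)
    have hP : HBound R 0 (g i) (nrm R (g i)) := ⟨(h i).memLp_deriv, le_rfl⟩
    have b1 := (hB i _ _ hP x hx t ht0 (ht.2.trans he)).trans
      (mul_le_mul_of_nonneg_left hst (mul_nonneg (hB0 i) (nrm_nonneg _ _)))
    have b2 := (hA _ _ hP x hx t ht0 (ht.2.trans he)).trans
      (mul_le_mul_of_nonneg_left hst (mul_nonneg hA0 (nrm_nonneg _ _)))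
    rw [Real.norm_eq_abs]
    refine (abs_sub _ _).trans ?_
    rw [abs_mul, add_mul, add_mul, mul_assoc R, mul_assoc R]
    exact add_le_add b1 (mul_le_mul (hx i).le b2 (abs_nonneg _) hR.le)
  have hftc : ∫ t in s..e, D t = avg R η u e x - avg R η u s x :=
    intervalIntegral.integral_eq_sub_of_hasDerivAt (fun t ht => hd t (by
      rwa [uIcc_of_le hse] at ht)) hii
  have e3 : avg R η u s x = avg R η u e x - ∫ t in s..e, D t := by rw [hftc]; ring
  rw [e3]
  refine (enorm_sub_le).trans (add_le_add le_rfl ?_)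
  rw [intervalIntegral.integral_of_le hse]
  refine (enorm_integral_le_lintegral_enorm _).trans ?_
  refine (setLIntegral_mono' measurableSet_Ioc hDle).trans ?_
  exact lintegral_mono_set (Ioc_subset_Ioc_left hs.le)

theorem add_pow_four_le (a b : ENNReal) : (a + b) ^ 4 ≤ 16 * (a ^ 4 + b ^ 4) := by
  wlog h : a ≤ b generalizing a b
  · rw [add_comm a b, add_comm (a ^ 4)]; exact this b a (le_of_not_ge h)
  calc (a + b) ^ 4 ≤ (b + b) ^ 4 := by gcongr
    _ = 16 * b ^ 4 := by ring
    _ ≤ _ := by gcongr; exact le_add_self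

/-- Of the four factors, two are estimated pointwise by Cauchy–Schwarz, at the cost `t⁻³`, and two
are integrated by the Schur test. -/
theorem lintegral_lavg_pow_four_le {R : ℝ} {η : E3 → ℝ} (hη : IsTestFunction R η) :
    ∃ C : ℝ, 0 ≤ C ∧ ∀ f : E3 → ENNReal, Measurable f → ∀ t, 0 < t → t ≤ 1 / 2 →
      ∫⁻ x in cube R, lavg R η f t x ^ 4
        ≤ ENNReal.ofReal (C * t⁻¹ ^ 3) * (∫⁻ z in cube R, f z ^ 2) ^ 2 := by
  have hA : 0 ≤ ∫ y, η y ^ 2 := integral_nonneg fun _ => sq_nonneg _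
  refine ⟨(∫ y, η y ^ 2) * (8 * (∫ y, |η y|) ^ 2), by positivity, fun f hf t ht ht1 => ?_⟩
  calc ∫⁻ x in cube R, lavg R η f t x ^ 4
      = ∫⁻ x in cube R, lavg R η f t x ^ 2 * lavg R η f t x ^ 2 := by
        refine lintegral_congr fun x => ?_
        ring
    _ ≤ ∫⁻ x in cube R, (ENNReal.ofReal (t⁻¹ ^ 3 * ∫ y, η y ^ 2) * ∫⁻ z in cube R, f z ^ 2)
          * lavg R η f t x ^ 2 := by
        gcongr with x
        exact lavg_sq_le hη hf.aemeasurable ht x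
    _ = (ENNReal.ofReal (t⁻¹ ^ 3 * ∫ y, η y ^ 2) * ∫⁻ z in cube R, f z ^ 2)
          * ∫⁻ x in cube R, lavg R η f t x ^ 2 := by
        rw [lintegral_const_mul]
        exact ((measurable_lavg (R := R) hη.smooth.continuous hf).comp
          (f := fun x : E3 => (t, x)) (by fun_prop)).pow_const 2
    _ ≤ (ENNReal.ofReal (t⁻¹ ^ 3 * ∫ y, η y ^ 2) * ∫⁻ z in cube R, f z ^ 2)
          * (ENNReal.ofReal (8 * (∫ y, |η y|) ^ 2) * ∫⁻ z in cube R, f z ^ 2) := by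
        gcongr
        exact lintegral_lavg_sq_le hη hf ht ht1
    _ = (ENNReal.ofReal (t⁻¹ ^ 3 * ∫ y, η y ^ 2) * ENNReal.ofReal (8 * (∫ y, |η y|) ^ 2))
          * (∫⁻ z in cube R, f z ^ 2) ^ 2 := by ring
    _ = _ := by
        rw [← ENNReal.ofReal_mul (by positivity)]
        congr 2; ring

/-- Hölder in `t` with the weight `t^{-3/4}`, which is integrable at zero. The fourth power of its
reciprocal is `t³`, exactly cancelling the factor `t⁻³` of the fixed-`t` bound; the fourth power of
the mass `4 e^{1/4}` of the weight is `256 e`. -/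
theorem lintegral_lintegral_lavg_pow_four_le {R : ℝ} {η : E3 → ℝ} (hη : IsTestFunction R η) :
    ∃ C : ℝ, 0 ≤ C ∧ ∀ f : E3 → ENNReal, Measurable f → ∀ e, 0 < e → e ≤ 1 / 2 →
      ∫⁻ x in cube R, (∫⁻ t in Ioc 0 e, lavg R η f t x) ^ 4
        ≤ ENNReal.ofReal (C * e) * (∫⁻ z in cube R, f z ^ 2) ^ 2 := by
  obtain ⟨C, hC0, hC⟩ := lintegral_lavg_pow_four_le hη
  refine ⟨C * 256, by positivity, fun f hf e he he1 => ?_⟩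
  set G := (∫⁻ z in cube R, f z ^ 2) ^ 2 with hG
  set K := ∫⁻ t in Ioc 0 e, ENNReal.ofReal (t ^ (-(3 / 4) : ℝ)) with hK
  have hKe := lintegral_rpow_neg_three_quarters he
  have hm := measurable_lavg (R := R) hη.smooth.continuous hf
  have hk : Measurable fun t : ℝ => ENNReal.ofReal (t ^ (-(3 / 4) : ℝ)) := by fun_prop
  have hk2 : Measurable fun t : ℝ => ENNReal.ofReal (t ^ (3 / 4 : ℝ)) := by fun_prop
  calc ∫⁻ x in cube R, (∫⁻ t in Ioc 0 e, lavg R η f t x) ^ 4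
      = ∫⁻ x in cube R, (∫⁻ t in Ioc 0 e, ENNReal.ofReal (t ^ (-(3 / 4) : ℝ)) *
          (ENNReal.ofReal (t ^ (3 / 4 : ℝ)) * lavg R η f t x)) ^ 4 := by
        refine lintegral_congr fun x => ?_
        congr 1
        refine setLIntegral_congr_fun measurableSet_Ioc fun t ht => ?_
        rw [← mul_assoc, ← ENNReal.ofReal_mul (Real.rpow_nonneg ht.1.le _), ← Real.rpow_add ht.1]
        norm_num
    _ ≤ ∫⁻ x in cube R, K ^ 3 * ∫⁻ t in Ioc 0 e, ENNReal.ofReal (t ^ (-(3 / 4) : ℝ)) *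
          (ENNReal.ofReal (t ^ (3 / 4 : ℝ)) * lavg R η f t x) ^ 4 := by
        refine lintegral_mono fun x => pow_four_lintegral_weight_mul_le hk.aemeasurable ?_
        exact (hk2.mul (hm.comp (f := fun t : ℝ => (t, x)) (by fun_prop))).aemeasurable
    _ = K ^ 3 * ∫⁻ t in Ioc 0 e, ENNReal.ofReal (t ^ (-(3 / 4) : ℝ)) *
          (ENNReal.ofReal (t ^ (3 / 4 : ℝ)) ^ 4 * ∫⁻ x in cube R, lavg R η f t x ^ 4) := by
        rw [lintegral_const_mul' _ _ (by rw [hK, hKe]; exact ENNReal.pow_ne_top ENNReal.ofReal_ne_top),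
          lintegral_lintegral_swap]
        · congr 1
          refine lintegral_congr fun t => ?_
          have hmt : Measurable fun x : E3 => lavg R η f t x ^ 4 :=
            (hm.comp (f := fun x : E3 => (t, x)) (by fun_prop)).pow_const 4
          simp_rw [mul_pow]
          rw [lintegral_const_mul _ (hmt.const_mul _), lintegral_const_mul _ hmt]
        · exact ((hk.comp measurable_snd).mul (((hk2.comp measurable_snd).mul
            (hm.comp measurable_swap)).pow_const 4)).aemeasurable
    _ ≤ K ^ 3 * ∫⁻ t in Ioc 0 e, ENNReal.ofReal (t ^ (-(3 / 4) : ℝ)) * (ENNReal.ofReal C * G) := by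
        refine mul_le_mul_right (setLIntegral_mono' measurableSet_Ioc fun t ht => ?_) _
        refine mul_le_mul_right ?_ _
        refine (mul_le_mul_right (hC f hf t ht.1 (ht.2.trans he1)) _).trans (le_of_eq ?_)
        rw [← mul_assoc, ← ENNReal.ofReal_pow (Real.rpow_nonneg ht.1.le _),
          ← ENNReal.ofReal_mul (by have := Real.rpow_nonneg ht.1.le (3 / 4); positivity),
          ← Real.rpow_natCast, ← Real.rpow_mul ht.1.le]
        congr 2
        have h3 : t ^ ((3 / 4 : ℝ) * (4 : ℕ)) = t ^ 3 := by
          rw [← Real.rpow_natCast]; norm_num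
        rw [h3]
        have := ht.1.ne'
        field_simp
    _ = K ^ 4 * (ENNReal.ofReal C * G) := by
        rw [lintegral_mul_const _ hk]; ring
    _ = _ := by
        rw [hK, hKe, ← ENNReal.ofReal_pow (by positivity), ← mul_assoc,
          ← ENNReal.ofReal_mul (by positivity), mul_pow, ← Real.rpow_natCast, ← Real.rpow_natCast,
          ← Real.rpow_mul he.le]
        congr 2
        norm_num
        ring

/-- The interpolation inequality for the `L⁴` norm of functions in `H¹`. -/
theorem exists_lintegral_pow_four_le {R : ℝ} (hR : 0 < R) : ∃ C, 0 ≤ C ∧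
    ∀ (u : E3 → ℝ) (g : Fin 3 → E3 → ℝ) (S T : ℝ), (∀ i, HasWD R i u (g i)) → nrm R u ≤ S →
      (∀ i, nrm R (g i) ≤ T) → ∀ e, 0 < e → e ≤ 1 / 2 →
      ∫⁻ x in cube R, ‖u x‖ₑ ^ 4 ≤ ENNReal.ofReal (C * (e⁻¹ ^ 3 * S ^ 4 + e * T ^ 4)) := by
  obtain ⟨η, hη, h1⟩ := exists_normalized_testFunction hR
  obtain ⟨A, hA0, hA⟩ := lintegral_lavg_pow_four_le hη
  obtain ⟨B, hB0, hB⟩ := lintegral_lintegral_lavg_pow_four_le hη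
  -- `16` comes from `(a + b)⁴ ≤ 16 (a⁴ + b⁴)`, `2 R` bounds `|y_i - x_i|` in the derivative of the
  -- average, and `9 T²` bounds the squared `L²` norm of the sum of the three `|∂ᵢ u|`.
  set K : ℝ := 16 * (A + (2 * R) ^ 4 * B * 9 ^ 2) with hK
  refine ⟨K, by positivity, ?_⟩
  -- the statement for measurable representatives
  have key : ∀ (u : E3 → ℝ) (g : Fin 3 → E3 → ℝ) (S T : ℝ), Measurable u → (∀ i, Measurable (g i)) →
      (∀ i, HasWD R i u (g i)) → nrm R u ≤ S →
      (∀ i, nrm R (g i) ≤ T) → ∀ e, 0 < e → e ≤ 1 / 2 →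
      ∫⁻ x in cube R, ‖u x‖ₑ ^ 4 ≤ ENNReal.ofReal (K * (e⁻¹ ^ 3 * S ^ 4 + e * T ^ 4)) := by
    intro u g S T hum hgm hg hS hT e he he1
    have hS0 : 0 ≤ S := (nrm_nonneg _ _).trans hS
    have hT0 : 0 ≤ T := (nrm_nonneg _ _).trans (hT 0)
    set f : E3 → ENNReal := fun z => ∑ i, ‖g i z‖ₑ with hf
    have hfm : Measurable f := Finset.measurable_sum _ fun i _ => (hgm i).enorm
    have hum' : Measurable fun z => ‖u z‖ₑ := hum.enorm
    have hU : ∫⁻ z in cube R, ‖u z‖ₑ ^ 2 ≤ ENNReal.ofReal (S ^ 2) := by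
      rw [lintegral_enorm_sq (hg 0).memLp]
      exact ENNReal.ofReal_le_ofReal (pow_le_pow_left₀ (nrm_nonneg _ _) hS 2)
    have hF : ∫⁻ z in cube R, f z ^ 2 ≤ ENNReal.ofReal (9 * T ^ 2) := by
      have h3 : ∀ z, f z ^ 2 ≤ 3 * ∑ i, ‖g i z‖ₑ ^ 2 := by
        intro z

        have e0 : f z = ENNReal.ofReal (∑ i, |g i z|) := by
          rw [ENNReal.ofReal_sum_of_nonneg fun _ _ => abs_nonneg _]
          exact Finset.sum_congr rfl fun i _ => Real.enorm_eq_ofReal_abs _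
        have e2 : ∑ i, ‖g i z‖ₑ ^ 2 = ENNReal.ofReal (∑ i, |g i z| ^ 2) := by
          rw [ENNReal.ofReal_sum_of_nonneg fun _ _ => sq_nonneg _]
          exact Finset.sum_congr rfl fun i _ => by
            rw [Real.enorm_eq_ofReal_abs, ENNReal.ofReal_pow (abs_nonneg _)]
        rw [e0, e2, ← ENNReal.ofReal_pow (Finset.sum_nonneg fun _ _ => abs_nonneg _),
          ← ENNReal.ofReal_ofNat 3, ← ENNReal.ofReal_mul (by norm_num)]
        apply ENNReal.ofReal_le_ofReal
        have := sq_sum_le_card_mul_sum_sq (s := (Finset.univ : Finset (Fin 3)))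
          (f := fun i => |g i z|)
        simpa using this
      calc ∫⁻ z in cube R, f z ^ 2 ≤ ∫⁻ z in cube R, 3 * ∑ i, ‖g i z‖ₑ ^ 2 :=
            lintegral_mono h3
        _ = 3 * ∑ i, ∫⁻ z in cube R, ‖g i z‖ₑ ^ 2 := by
            rw [lintegral_const_mul _ (Finset.measurable_sum _ fun i _ => (hgm i).enorm.pow_const 2),
              lintegral_finsetSum _ fun i _ => (hgm i).enorm.pow_const 2]
        _ ≤ 3 * ∑ i : Fin 3, ENNReal.ofReal (T ^ 2) := by
            gcongr with i
            rw [lintegral_enorm_sq (hg i).memLp_deriv]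
            exact ENNReal.ofReal_le_ofReal (pow_le_pow_left₀ (nrm_nonneg _ _) (hT i) 2)
        _ = _ := by
            rw [Finset.sum_const, Finset.card_univ, Fintype.card_fin, nsmul_eq_mul, ← mul_assoc,
              ENNReal.ofReal_mul (by norm_num)]
            norm_num
    set I : E3 → ENNReal := fun x => ∫⁻ t in Ioc 0 e, lavg R η f t x with hI
    -- Passing to the limit `s → 0`, `u` is bounded by its average at scale `e`, responsible for
    -- `e⁻³ S⁴`, plus the accumulated averages of the gradient over smaller scales, responsible for
    -- `e T⁴`.
    have hle := ae_enorm_le_of_avg_le hη h1 (hg 0).memLp (H := fun x =>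
      lavg R η (fun z => ‖u z‖ₑ) e x + ENNReal.ofReal (2 * R) * I x) he (fun x hx s hs hse => by
        refine (enorm_avg_le_add hη hg hx hs hse.le (by linarith)).trans ?_
        rw [lintegral_const_mul' _ _ ENNReal.ofReal_ne_top]
        exact add_le_add (enorm_avg_le _ _) le_rfl)
    have hm1 : Measurable fun x => lavg R η (fun z => ‖u z‖ₑ) e x ^ 4 :=
      ((measurable_lavg (R := R) hη.smooth.continuous hum').comp
        (f := fun x : E3 => (e, x)) (by fun_prop)).pow_const 4
    calc ∫⁻ x in cube R, ‖u x‖ₑ ^ 4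
        ≤ ∫⁻ x in cube R, 16 * (lavg R η (fun z => ‖u z‖ₑ) e x ^ 4
            + (ENNReal.ofReal (2 * R)) ^ 4 * I x ^ 4) := by
          refine lintegral_mono_ae ?_
          filter_upwards [hle] with x hx
          rw [← mul_pow]
          exact (pow_le_pow_left₀ (by positivity) hx 4).trans (add_pow_four_le _ _)
      _ = 16 * ((∫⁻ x in cube R, lavg R η (fun z => ‖u z‖ₑ) e x ^ 4)
            + (ENNReal.ofReal (2 * R)) ^ 4 * ∫⁻ x in cube R, I x ^ 4) := by
          rw [lintegral_const_mul' _ _ (by norm_num), lintegral_add_left hm1,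
            lintegral_const_mul' _ _ (ENNReal.pow_ne_top ENNReal.ofReal_ne_top)]
      _ ≤ 16 * (ENNReal.ofReal (A * e⁻¹ ^ 3) * ENNReal.ofReal (S ^ 2) ^ 2
            + (ENNReal.ofReal (2 * R)) ^ 4 *
              (ENNReal.ofReal (B * e) * ENNReal.ofReal (9 * T ^ 2) ^ 2)) := by
          gcongr
          · exact (hA _ hum' e he he1).trans (by gcongr)
          · exact (hB _ hfm e he he1).trans (by gcongr)
      _ = ENNReal.ofReal (16 * (A * e⁻¹ ^ 3 * (S ^ 2) ^ 2
            + (2 * R) ^ 4 * (B * e * (9 * T ^ 2) ^ 2))) := by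
          have E : ∀ a b c d s : ℝ, 0 ≤ a → 0 ≤ b → 0 ≤ c → 0 ≤ d → 0 ≤ s →
              16 * (ENNReal.ofReal a * ENNReal.ofReal s ^ 2 + ENNReal.ofReal c ^ 4 *
                (ENNReal.ofReal b * ENNReal.ofReal d ^ 2))
              = ENNReal.ofReal (16 * (a * s ^ 2 + c ^ 4 * (b * d ^ 2))) := by
            intro a b c d s ha hb hc hd hs
            rw [ENNReal.ofReal_mul (by norm_num), ENNReal.ofReal_add (by positivity)
              (by positivity), ENNReal.ofReal_mul ha, ENNReal.ofReal_mul (by positivity),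
              ENNReal.ofReal_mul hb, ENNReal.ofReal_pow hs, ENNReal.ofReal_pow hc,
              ENNReal.ofReal_pow hd]
            norm_num
          exact E _ _ _ _ _ (by positivity) (by positivity) (by positivity) (by positivity)
            (by positivity)
      _ ≤ _ := by
          apply ENNReal.ofReal_le_ofReal
          rw [hK]
          have h5 : 0 ≤ A * (e * T ^ 4) := by positivity
          have h6 : 0 ≤ (2 * R) ^ 4 * B * 9 ^ 2 * (e⁻¹ ^ 3 * S ^ 4) := by positivity
          nlinarith
  intro u g S T hg hS hT e he he1
  have hu := (hg 0).memLp.aestronglyMeasurable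
  have hgs := fun i => (hg i).memLp_deriv.aestronglyMeasurable
  have := key (hu.mk u) (fun i => (hgs i).mk (g i)) S T hu.stronglyMeasurable_mk.measurable
    (fun i => (hgs i).stronglyMeasurable_mk.measurable)
    (fun i => (hg i).congr hu.ae_eq_mk (hgs i).ae_eq_mk)
    ((nrm_congr hu.ae_eq_mk) ▸ hS) (fun i => (nrm_congr (hgs i).ae_eq_mk) ▸ hT i) e he he1
  refine le_trans (le_of_eq ?_) this
  apply lintegral_congr_ae
  filter_upwards [hu.ae_eq_mk] with x hx
  rw [hx]

/-! ### Smoothness of averages -/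

theorem zoom_eq (x z : E3) {t : ℝ} (ht : 0 < t) : zoom x t z = -(t⁻¹ • ((1 - t) • x - z)) := by
  ext i
  simp only [zoom, PiLp.add_apply, PiLp.smul_apply, PiLp.sub_apply, PiLp.neg_apply, smul_eq_mul]
  field_simp
  ring

theorem avg_eq_convolution {R : ℝ} (η u : E3 → ℝ) {t : ℝ} (ht : 0 < t) (x : E3) :
    avg R η u t x = t⁻¹ ^ 3 * convolution ((cube R).indicator u) (fun y => η (-(t⁻¹ • y)))
      (ContinuousLinearMap.mul ℝ ℝ) volume ((1 - t) • x) := by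
  rw [avg, convolution_mul, ← integral_indicator (measurableSet_cube R)]
  congr 2
  ext z
  by_cases hz : z ∈ cube R
  · simp [hz, zoom_eq x z ht, mul_comm]
  · simp [hz]

/-- The average is the convolution of `u`, extended by zero, with a rescaled `η`, evaluated at `(1 -
t) x`. It is therefore smooth on the whole space, and the inner dilation contributes the factor `1 -
t`. Differentiation is moved onto `u` only for `x` in the cube, where the kernel is a test function
of `z`. -/
theorem contDiff_avg_and_pd {R : ℝ} {η : E3 → ℝ} (hη : IsTestFunction R η) {u g : E3 → ℝ}
    {i : Fin 3} (h : HasWD R i u g) {t : ℝ} (ht : 0 < t) (ht1 : t ≤ 1) :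
    ContDiff ℝ ∞ (avg R η u t) ∧ ∀ x ∈ cube R, pd i (avg R η u t) x = (1 - t) * avg R η g t x := by
  set k : E3 → ℝ := fun y => η (-(t⁻¹ • y)) with hk
  have hkc : ContDiff ℝ ∞ k := hη.smooth.comp (by fun_prop)
  let e : E3 ≃ₜ E3 := (Homeomorph.smulOfNeZero t⁻¹ (inv_ne_zero ht.ne')).trans (Homeomorph.neg E3)
  have hks : HasCompactSupport k := hη.compact.comp_homeomorph e
  have hloc : LocallyIntegrable ((cube R).indicator u) volume := by
    have := h.memLp.integrable (q := 2) (by norm_num)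
    exact ((integrable_indicator_iff (measurableSet_cube R)).2 this).locallyIntegrable
  have hcd := hks.contDiff_convolution_right (ContinuousLinearMap.mul ℝ ℝ) hloc hkc
  have heq : avg R η u t = fun x => t⁻¹ ^ 3 * convolution ((cube R).indicator u) k
      (ContinuousLinearMap.mul ℝ ℝ) volume ((1 - t) • x) := by
    ext x; exact avg_eq_convolution η u ht x
  refine ⟨?_, fun x hx => ?_⟩
  · rw [heq]
    exact contDiff_const.mul (hcd.comp (by fun_prop))
  · have h1 := hks.hasFDerivAt_convolution_right (ContinuousLinearMap.mul ℝ ℝ) hloc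
      (hkc.of_le (by simp)) ((1 - t) • x)
    have h2 : HasFDerivAt (fun x : E3 => (1 - t) • x) ((1 - t) • ContinuousLinearMap.id ℝ E3) x :=
      (hasFDerivAt_id x).const_smul (1 - t)
    have h3 := (h1.comp x h2).const_mul (t⁻¹ ^ 3)
    unfold pd
    rw [heq]
    erw [h3.fderiv]
    simp only [_root_.smul_apply, ContinuousLinearMap.comp_apply, ContinuousLinearMap.id_apply,
      smul_eq_mul, map_smul]
    rw [convolution_precompR_apply (ContinuousLinearMap.mul ℝ ℝ) hloc (hks.fderiv (𝕜 := ℝ))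
      (hkc.continuous_fderiv (by simp)), convolution_mul]
    have h5 := h.eq _ (hη.comp_zoom hx ht ht1)
    have h6 : ∫ z, (cube R).indicator u z * (fderiv ℝ k ((1 - t) • x - z))
        (EuclideanSpace.single i 1) = - ∫ z in cube R, pd i (fun z => η (zoom x t z)) z * u z := by
      rw [← integral_indicator (measurableSet_cube R), ← integral_neg]
      congr 1; ext z
      by_cases hz : z ∈ cube R
      · have hz2 : (fun z => η (zoom x t z)) = fun z => k ((1 - t) • x - z) := by
          ext z; rw [zoom_eq x z ht]
        have hz3 : HasFDerivAt (fun z : E3 => (1 - t) • x - z) (-ContinuousLinearMap.id ℝ E3) z :=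
          (hasFDerivAt_id z).const_sub _
        have hz4 := ((hkc.differentiable (by simp)) ((1 - t) • x - z)).hasFDerivAt.comp z hz3
        have hz5 : fderiv ℝ (fun z => k ((1 - t) • x - z)) z = _ := hz4.fderiv
        unfold pd
        rw [hz2, indicator_of_mem hz, indicator_of_mem hz, hz5]
        simp [mul_comm]
      · simp [hz]
    rw [h6, h5, neg_neg, avg]
    ring

/-! ### Functions with zero boundary values in one direction -/

/-- The extension of `u` by zero has the weak derivative `g`, extended by zero, in the direction
`i`: `u` vanishes on the two faces of the cube orthogonal to this direction. -/
def ZeroTrace (R : ℝ) (i : Fin 3) (u g : E3 → ℝ) : Prop :=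
  ∀ φ : E3 → ℝ, ContDiff ℝ ∞ φ → ∫ x in cube R, pd i φ x * u x = - ∫ x in cube R, φ x * g x

theorem nrm_eq_toReal {R : ℝ} {u : E3 → ℝ} (hu : MemLp u 2 (volume.restrict (cube R))) :
    nrm R u = (eLpNorm u 2 (volume.restrict (cube R))).toReal := by
  rw [nrm, eLpNorm_eq_lintegral_rpow_enorm_toReal (by norm_num) (by norm_num)]
  simp only [ENNReal.toReal_ofNat, ENNReal.rpow_ofNat]
  rw [lintegral_enorm_sq hu, ← ENNReal.toReal_rpow, ENNReal.toReal_ofReal (sq_nonneg _),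
    sq_nrm, Real.sqrt_eq_rpow]

theorem tendsto_integral_mul_of_tendsto_eLpNorm {R : ℝ} {ι : Type*} {l : Filter ι}
    {f : ι → E3 → ℝ} {f₀ v : E3 → ℝ} (hf : ∀ᶠ n in l, MemLp (f n) 2 (volume.restrict (cube R)))
    (hf₀ : MemLp f₀ 2 (volume.restrict (cube R))) (hv : MemLp v 2 (volume.restrict (cube R)))
    (h : Tendsto (fun n => eLpNorm (fun x => f n x - f₀ x) 2 (volume.restrict (cube R))) l (𝓝 0)) :
    Tendsto (fun n => ∫ x in cube R, f n x * v x) l (𝓝 (∫ x in cube R, f₀ x * v x)) := by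
  rw [tendsto_iff_norm_sub_tendsto_zero]
  have h2 : Tendsto (fun n => (eLpNorm (fun x => f n x - f₀ x) 2
      (volume.restrict (cube R))).toReal * nrm R v) l (𝓝 0) := by
    have := ((ENNReal.tendsto_toReal (by simp)).comp h).mul_const (nrm R v)
    simpa using this
  refine squeeze_zero' (Eventually.of_forall fun _ => norm_nonneg _) ?_ h2
  filter_upwards [hf] with n hn
  have hs : MemLp (fun x => f n x - f₀ x) 2 (volume.restrict (cube R)) := hn.sub hf₀
  rw [← nrm_eq_toReal hs, ← integral_sub (memLp_two_mul_integrable hn hv)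
    (memLp_two_mul_integrable hf₀ hv)]
  simp_rw [← sub_mul]
  exact abs_setIntegral_mul_le hs hv

theorem memLp_avg {R : ℝ} {η : E3 → ℝ} (hη : IsTestFunction R η) {u : E3 → ℝ}
    (hu : MemLp u 2 (volume.restrict (cube R))) {t : ℝ} (ht : 0 < t) (ht1 : t ≤ 1 / 2) :
    MemLp (avg R η u t) 2 (volume.restrict (cube R)) := by
  obtain ⟨C, hC⟩ := eLpNorm_avg_le hη
  refine ⟨(stronglyMeasurable_avg hη.smooth.continuous hu.aestronglyMeasurable
    t).aestronglyMeasurable, (hC u hu t ht ht1).trans_lt ?_⟩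
  exact ENNReal.mul_lt_top ENNReal.coe_lt_top hu.2

/-- Integration by parts. -/
theorem ZeroTrace.integral_mul {R : ℝ} {i : Fin 3} {u g v w : E3 → ℝ}
    (h : ZeroTrace R i u g) (hu : MemLp u 2 (volume.restrict (cube R)))
    (hg : MemLp g 2 (volume.restrict (cube R))) (hv : HasWD R i v w) :
    ∫ x in cube R, u x * w x = - ∫ x in cube R, g x * v x := by
  rcases le_or_gt R 0 with hR | hR
  · have : cube R = ∅ := by
      ext x; simp only [mem_empty_iff_false, iff_false]
      exact fun hx => absurd ((abs_nonneg _).trans_lt (hx 0)) (not_lt.2 hR)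
    simp [this]
  obtain ⟨η, hη, h1⟩ := exists_normalized_testFunction hR
  have hev : ∀ᶠ t : ℝ in 𝓝[>] 0, 0 < t ∧ t ≤ 1 / 2 :=
    (eventually_mem_nhdsWithin (a := (0 : ℝ)) (s := Ioi 0)).and
      (nhdsWithin_le_nhds (Iic_mem_nhds (by norm_num)))
  have l1 := tendsto_integral_mul_of_tendsto_eLpNorm
    (hev.mono fun t ht => memLp_avg hη hv.memLp ht.1 ht.2) hv.memLp hg (tendsto_avg hη h1 hv.memLp)
  have l2 := tendsto_integral_mul_of_tendsto_eLpNorm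
    (hev.mono fun t ht => memLp_avg hη hv.memLp_deriv ht.1 ht.2) hv.memLp_deriv hu
    (tendsto_avg hη h1 hv.memLp_deriv)
  -- The averages of `v` are smooth on the whole space, hence allowed in `ZeroTrace`, and their
  -- derivatives are `(1 - t)` times the averages of `w`; both sides converge as `t → 0`.
  have l3 : Tendsto (fun t : ℝ => (1 - t) * ∫ x in cube R, avg R η w t x * u x) (𝓝[>] 0)
      (𝓝 ((1 - 0) * ∫ x in cube R, w x * u x)) :=
    ((tendsto_const_nhds.sub tendsto_id).mono_left nhdsWithin_le_nhds).mul l2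
  have l4 : (fun t : ℝ => (1 - t) * ∫ x in cube R, avg R η w t x * u x) =ᶠ[𝓝[>] 0]
      fun t => - ∫ x in cube R, avg R η v t x * g x := by
    filter_upwards [hev] with t ht
    obtain ⟨c1, c2⟩ := contDiff_avg_and_pd hη hv ht.1 (by linarith [ht.2])
    rw [← h _ c1, ← integral_const_mul]
    refine setIntegral_congr_fun (measurableSet_cube R) fun x hx => ?_
    rw [c2 x hx, mul_assoc]
  have l5 := tendsto_nhds_unique (l3.congr' l4) l1.neg
  rw [sub_zero, one_mul] at l5
  simp_rw [mul_comm (u _), mul_comm (g _)]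
  exact l5

theorem HasWD.smooth_mul {R : ℝ} {i : Fin 3} {u g ρ : E3 → ℝ} (h : HasWD R i u g)
    (hρ : ContDiff ℝ ∞ ρ) :
    HasWD R i (fun x => ρ x * u x) (fun x => ρ x * g x + pd i ρ x * u x) := by
  have hm : ∀ (σ : E3 → ℝ), Continuous σ → ∀ v, MemLp v 2 (volume.restrict (cube R)) →
      MemLp (fun x => σ x * v x) 2 (volume.restrict (cube R)) := by
    intro σ hσ v hv
    obtain ⟨C, hC⟩ := (isCompact_closure_cube R).exists_bound_of_continuousOn hσ.continuousOn
    refine MemLp.of_le_mul (c := C) hv (hσ.aestronglyMeasurable.mul hv.aestronglyMeasurable) ?_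
    filter_upwards [ae_restrict_mem (measurableSet_cube R)] with x hx
    rw [norm_mul]
    exact mul_le_mul_of_nonneg_right (hC x (subset_closure hx)) (norm_nonneg _)
  have hpc := (contDiff_pd (i := i) hρ).continuous
  refine ⟨hm _ hρ.continuous _ h.memLp, (hm _ hρ.continuous _ h.memLp_deriv).add
    (hm _ hpc _ h.memLp), fun φ hφ => ?_⟩
  have h1 := h.eq _ (hφ.smooth_mul hρ)
  have i1 : Integrable (fun x => pd i φ x * (ρ x * u x)) (volume.restrict (cube R)) :=
    memLp_two_mul_integrable (memLp_of_continuous_bound (contDiff_pd hφ.smooth).continuous)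
      (hm _ hρ.continuous _ h.memLp)
  have i2 : Integrable (fun x => φ x * (pd i ρ x * u x)) (volume.restrict (cube R)) :=
    memLp_two_mul_integrable (memLp_of_continuous_bound hφ.smooth.continuous)
      (hm _ hpc _ h.memLp)
  have i3 : Integrable (fun x => φ x * (ρ x * g x)) (volume.restrict (cube R)) :=
    memLp_two_mul_integrable (memLp_of_continuous_bound hφ.smooth.continuous)
      (hm _ hρ.continuous _ h.memLp_deriv)
  have e1 : ∫ x in cube R, pd i (fun x => ρ x * φ x) x * u x
      = (∫ x in cube R, pd i φ x * (ρ x * u x)) + ∫ x in cube R, φ x * (pd i ρ x * u x) := by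
    rw [← integral_add i1 i2]
    congr 1; ext x
    rw [pd_mul (hρ.differentiable (by simp) x) (hφ.smooth.differentiable (by simp) x)]
    ring
  have e2 : ∫ x in cube R, (ρ x * φ x) * g x = ∫ x in cube R, φ x * (ρ x * g x) := by
    congr 1; ext x; ring
  rw [e1, e2] at h1
  simp_rw [mul_add]
  rw [integral_add i3 i2]
  linarith

/-! ### Cut-off functions -/

/-- A smooth ramp: zero for `s ≤ e` and one for `2 e ≤ s`. -/
def ramp (e s : ℝ) : ℝ := Real.smoothTransition (s / e - 1)

theorem contDiff_ramp (e : ℝ) : ContDiff ℝ ∞ (ramp e) :=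
  Real.smoothTransition.contDiff.comp (by fun_prop)

theorem ramp_nonneg (e s : ℝ) : 0 ≤ ramp e s := Real.smoothTransition.nonneg _

theorem ramp_le_one (e s : ℝ) : ramp e s ≤ 1 := Real.smoothTransition.le_one _

theorem ramp_eq_zero {e s : ℝ} (he : 0 < e) (hs : s ≤ e) : ramp e s = 0 :=
  Real.smoothTransition.zero_of_nonpos (by rw [sub_nonpos, div_le_one he]; exact hs)

theorem ramp_eq_one {e s : ℝ} (he : 0 < e) (hs : 2 * e ≤ s) : ramp e s = 1 :=
  Real.smoothTransition.one_of_one_le (by rw [le_sub_iff_add_le, le_div_iff₀ he]; linarith)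

theorem monotone_ramp {e : ℝ} (he : 0 < e) : Monotone (ramp e) := fun _ _ h =>
  Real.smoothTransition.monotone (by gcongr)

theorem exists_abs_deriv_smoothTransition_le :
    ∃ C, 0 ≤ C ∧ ∀ s, |deriv Real.smoothTransition s| ≤ C := by
  have hc : Continuous (deriv Real.smoothTransition) :=
    (Real.smoothTransition.contDiff (n := 1)).continuous_deriv_one
  obtain ⟨C, hC⟩ := (isCompact_Icc (a := (0 : ℝ)) (b := 1)).exists_bound_of_continuousOn
    hc.continuousOn
  have hC0 : 0 ≤ C := (norm_nonneg _).trans (hC 0 (by simp))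
  refine ⟨C, hC0, fun s => ?_⟩
  by_cases hs : s ∈ Icc (0 : ℝ) 1
  · exact hC s hs
  · have : deriv Real.smoothTransition s = 0 := by
      rw [mem_Icc, not_and_or, not_le, not_le] at hs
      rcases hs with hs | hs
      · have : Real.smoothTransition =ᶠ[𝓝 s] fun _ => 0 := by
          filter_upwards [Iio_mem_nhds hs] with y hy
          exact Real.smoothTransition.zero_of_nonpos (mem_Iio.1 hy).le
        rw [this.deriv_eq, deriv_const]
      · have : Real.smoothTransition =ᶠ[𝓝 s] fun _ => 1 := by
          filter_upwards [Ioi_mem_nhds hs] with y hy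
          exact Real.smoothTransition.one_of_one_le (mem_Ioi.1 hy).le
        rw [this.deriv_eq, deriv_const]
    rw [this, abs_zero]; exact hC0

/-- A cut-off function of one coordinate: one for `|s| ≤ R - 2 e`, zero for `R - e ≤ |s|`. -/
def cut (R e s : ℝ) : ℝ := ramp e (R - s) * ramp e (R + s)

theorem contDiff_cut (R e : ℝ) : ContDiff ℝ ∞ (cut R e) :=
  ((contDiff_ramp e).comp (by fun_prop)).mul ((contDiff_ramp e).comp (by fun_prop))

theorem cut_nonneg (R e s : ℝ) : 0 ≤ cut R e s := mul_nonneg (ramp_nonneg _ _) (ramp_nonneg _ _)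

theorem cut_le_one (R e s : ℝ) : cut R e s ≤ 1 :=
  mul_le_one₀ (ramp_le_one _ _) (ramp_nonneg _ _) (ramp_le_one _ _)

theorem cut_eq_zero {R e s : ℝ} (he : 0 < e) (hs : R - e ≤ |s|) : cut R e s = 0 := by
  unfold cut
  rcases abs_cases s with ⟨h, -⟩ | ⟨h, -⟩
  · rw [ramp_eq_zero he (by linarith), zero_mul]
  · rw [ramp_eq_zero (s := R + s) he (by linarith), mul_zero]

theorem cut_eq_one {R e s : ℝ} (he : 0 < e) (hs : |s| ≤ R - 2 * e) : cut R e s = 1 := by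
  rw [abs_le] at hs
  unfold cut
  rw [ramp_eq_one he (by linarith), ramp_eq_one he (by linarith), one_mul]

theorem deriv_cut_eq_zero {R e s : ℝ} (he : 0 < e) (hs : |s| < R - 2 * e) :
    deriv (cut R e) s = 0 := by
  have : cut R e =ᶠ[𝓝 s] fun _ => 1 := by
    filter_upwards [(isOpen_lt continuous_abs continuous_const).mem_nhds hs] with y hy
    exact cut_eq_one he (le_of_lt hy)
  rw [this.deriv_eq, deriv_const]

theorem exists_abs_deriv_cut_le :
    ∃ C, 0 ≤ C ∧ ∀ R e s, 0 < e → |deriv (cut R e) s| ≤ C / e := by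
  obtain ⟨C, hC0, hC⟩ := exists_abs_deriv_smoothTransition_le
  refine ⟨2 * C, by positivity, fun R e s he => ?_⟩
  have hT : ∀ s, HasDerivAt Real.smoothTransition (deriv Real.smoothTransition s) s := fun s =>
    ((Real.smoothTransition.contDiff (n := 1)).differentiable (by simp) s).hasDerivAt
  have hr : ∀ s, HasDerivAt (ramp e) (deriv Real.smoothTransition (s / e - 1) * (1 / e)) s := by
    intro s
    exact (hT _).comp s (((hasDerivAt_id s).div_const e).sub_const 1)
  have h1 : HasDerivAt (cut R e) _ s :=
    ((hr (R - s)).comp s ((hasDerivAt_id s).const_sub R)).mul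
      ((hr (R + s)).comp s ((hasDerivAt_id s).const_add R))
  have hb : ∀ s, |deriv Real.smoothTransition s * (1 / e)| ≤ C / e := by
    intro s
    rw [abs_mul, abs_of_pos (by positivity : 0 < 1 / e)]
    calc _ ≤ C * (1 / e) := by gcongr; exact hC s
      _ = C / e := by ring
  have hCe : 0 ≤ C / e := by positivity
  rw [h1.deriv]
  refine (abs_add_le _ _).trans ?_
  simp only [Function.comp]
  rw [abs_mul, abs_mul (ramp _ _), mul_one, mul_neg, mul_one, abs_neg,
    abs_of_nonneg (ramp_nonneg _ _), abs_of_nonneg (ramp_nonneg _ _)]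
  have a1 := mul_le_mul (hb ((R - s) / e - 1)) (ramp_le_one e (R + s)) (ramp_nonneg _ _) hCe
  have a2 := mul_le_mul (ramp_le_one e (R - s)) (hb ((R + s) / e - 1)) (abs_nonneg _) zero_le_one

  calc _ ≤ C / e * 1 + 1 * (C / e) := add_le_add a1 a2
    _ = 2 * C / e := by ring

theorem pd_comp_coord {χ : ℝ → ℝ} (hχ : Differentiable ℝ χ) (i j : Fin 3) (x : E3) :
    pd i (fun x : E3 => χ (x j)) x = if i = j then deriv χ (x j) else 0 := by
  have h1 : HasFDerivAt (fun x : E3 => x j) (EuclideanSpace.proj j : E3 →L[ℝ] ℝ) x :=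
    (EuclideanSpace.proj (𝕜 := ℝ) j : E3 →L[ℝ] ℝ).hasFDerivAt
  have h2 := (hχ (x j)).hasDerivAt.comp_hasFDerivAt x h1
  have h3 : fderiv ℝ (fun x : E3 => χ (x j)) x = _ := h2.fderiv
  unfold pd
  rw [h3]
  by_cases h : i = j
  · subst h; simp
  · have h' : j ≠ i := fun e => h e.symm
    simp [h, h']

/-- Product of cut-off functions in the coordinates belonging to `s`. -/
def mcut (R e : ℝ) (s : Finset (Fin 3)) (x : E3) : ℝ := ∏ l ∈ s, cut R e (x l)

theorem contDiff_mcut (R e : ℝ) (s : Finset (Fin 3)) : ContDiff ℝ ∞ (mcut R e s) :=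
  contDiff_prod fun l _ => (contDiff_cut R e).comp (contDiff_coord l)

theorem mcut_nonneg (R e : ℝ) (s : Finset (Fin 3)) (x : E3) : 0 ≤ mcut R e s x :=
  Finset.prod_nonneg fun _ _ => cut_nonneg _ _ _

theorem mcut_le_one (R e : ℝ) (s : Finset (Fin 3)) (x : E3) : mcut R e s x ≤ 1 :=
  Finset.prod_le_one (fun _ _ => cut_nonneg _ _ _) fun _ _ => cut_le_one _ _ _

theorem pd_mcut_eq_zero {R e : ℝ} {s : Finset (Fin 3)} {i : Fin 3} (hi : i ∉ s) (x : E3) :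
    pd i (mcut R e s) x = 0 := by
  have h := ((contDiff_mcut R e s).differentiable (by simp) x).hasFDerivAt.hasLineDerivAt
    (EuclideanSpace.single i (1 : ℝ))
  have h2 := h.deriv
  unfold pd
  rw [← h2]
  have : (fun t : ℝ => mcut R e s (x + t • EuclideanSpace.single i (1 : ℝ)))
      = fun _ => mcut R e s x := by
    ext t
    refine Finset.prod_congr rfl fun l hl => ?_
    have : l ≠ i := fun h => hi (h ▸ hl)
    simp [this]
  rw [this, deriv_const]

theorem tendsto_mcut {R : ℝ} {x : E3} (hx : x ∈ cube R) (s : Finset (Fin 3)) :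
    Tendsto (fun e => mcut R e s x) (𝓝[>] 0) (𝓝 1) := by
  have h : ∀ l, ∀ᶠ e : ℝ in 𝓝[>] 0, cut R e (x l) = 1 := by
    intro l
    have h1 : ∀ᶠ e : ℝ in 𝓝[>] 0, e < (R - |x l|) / 2 :=
      nhdsWithin_le_nhds (Iio_mem_nhds (by linarith [hx l]))
    filter_upwards [h1, self_mem_nhdsWithin] with e he he0
    exact cut_eq_one he0 (by linarith)
  refine tendsto_const_nhds.congr' ?_
  filter_upwards [eventually_all.2 h] with e he
  exact (Finset.prod_eq_one fun l _ => he l).symm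

theorem tendsto_integral_mcut {R : ℝ} {F : E3 → ℝ}
    (hF : Integrable F (volume.restrict (cube R))) (s : Finset (Fin 3)) :
    Tendsto (fun e => ∫ x in cube R, mcut R e s x * F x) (𝓝[>] 0) (𝓝 (∫ x in cube R, F x)) := by
  refine tendsto_integral_filter_of_dominated_convergence (fun x => |F x|) ?_ ?_ hF.abs ?_
  · exact Eventually.of_forall fun e =>
      (contDiff_mcut R e s).continuous.aestronglyMeasurable.mul hF.aestronglyMeasurable
  · refine Eventually.of_forall fun e => Eventually.of_forall fun x => ?_
    rw [norm_mul, Real.norm_eq_abs, Real.norm_eq_abs, abs_of_nonneg (mcut_nonneg _ _ _ _)]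
    exact mul_le_of_le_one_left (abs_nonneg _) (mcut_le_one _ _ _ _)
  · filter_upwards [ae_restrict_mem (measurableSet_cube R)] with x hx
    simpa using (tendsto_mcut hx s).mul_const (F x)

theorem isTestFunction_of_vanishing {R e : ℝ} (he : 0 < e) {φ : E3 → ℝ} (hφ : ContDiff ℝ ∞ φ)
    (h : ∀ x : E3, ∀ l, R - e ≤ |x l| → φ x = 0) : IsTestFunction R φ := by
  have hcl : IsClosed {x : E3 | ∀ l, |x l| ≤ R - e} := by
    simp only [ofPred_forall]
    exact isClosed_iInter fun l => isClosed_le (by fun_prop) continuous_const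
  have hsub : tsupport φ ⊆ {x : E3 | ∀ l, |x l| ≤ R - e} := by
    refine closure_minimal (fun x hx l => ?_) hcl
    by_contra hl
    exact hx (h x l (not_le.1 hl).le)
  have hsub2 : {x : E3 | ∀ l, |x l| ≤ R - e} ⊆ cube R := fun x hx l =>
    (hx l).trans_lt (by linarith)
  refine ⟨hφ, ?_, hsub.trans hsub2⟩
  exact HasCompactSupport.of_support_subset_isCompact
    (Metric.isCompact_of_isClosed_isBounded hcl ((isBounded_cube R).subset hsub2))
    ((subset_tsupport φ).trans hsub)

theorem mcut_eq_zero {R e : ℝ} (he : 0 < e) {s : Finset (Fin 3)} {l : Fin 3} (hl : l ∈ s)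
    {x : E3} (hx : R - e ≤ |x l|) : mcut R e s x = 0 :=
  Finset.prod_eq_zero hl (cut_eq_zero he hx)

theorem integrable_smooth_mul {R : ℝ} {φ u : E3 → ℝ} (hφ : Continuous φ)
    (hu : MemLp u 2 (volume.restrict (cube R))) :
    Integrable (fun x => φ x * u x) (volume.restrict (cube R)) :=
  memLp_two_mul_integrable (memLp_of_continuous_bound hφ) hu

/-- A weak derivative may be tested with functions that vanish near the two faces orthogonal to
the direction of differentiation only. -/
theorem HasWD.eq_of_vanishing {R : ℝ} {i : Fin 3} {u g : E3 → ℝ} (h : HasWD R i u g)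
    {φ : E3 → ℝ} (hφ : ContDiff ℝ ∞ φ) {e : ℝ} (he : 0 < e)
    (hv : ∀ x : E3, R - e ≤ |x i| → φ x = 0) :
    ∫ x in cube R, pd i φ x * u x = - ∫ x in cube R, φ x * g x := by
  -- The cut-off acts in the other two coordinates only, so its `i`-th derivative vanishes and no
  -- boundary-layer term arises as its width tends to zero.
  set s : Finset (Fin 3) := Finset.univ.erase i with hs
  have l1 := tendsto_integral_mcut
    (integrable_smooth_mul (contDiff_pd (i := i) hφ).continuous h.memLp) s
  have l2 := tendsto_integral_mcut (integrable_smooth_mul hφ.continuous h.memLp_deriv) s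
  refine tendsto_nhds_unique (l1.congr' ?_) l2.neg
  filter_upwards [self_mem_nhdsWithin] with e' he'
  have he'0 : 0 < e' := he'
  have ht : IsTestFunction R (fun x => mcut R e' s x * φ x) := by
    refine isTestFunction_of_vanishing (lt_min he he'0) ((contDiff_mcut R e' s).mul hφ)
      fun x l hx => ?_
    by_cases hl : l = i
    · subst hl
      rw [hv x (by linarith [min_le_left e e']), mul_zero]
    · rw [mcut_eq_zero he'0 (by simp [hs, hl] : l ∈ s) (by linarith [min_le_right e e']), zero_mul]
  have := h.eq _ ht
  have e1 : ∀ x, pd i (fun x => mcut R e' s x * φ x) x = mcut R e' s x * pd i φ x := by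
    intro x
    rw [pd_mul ((contDiff_mcut R e' s).differentiable (by simp) x)
      (hφ.differentiable (by simp) x), pd_mcut_eq_zero (by simp [hs]), zero_mul, add_zero]
  simp_rw [e1, mul_assoc] at this
  exact this

theorem pd_comm {φ : E3 → ℝ} (hφ : ContDiff ℝ ∞ φ) (i j : Fin 3) (x : E3) :
    pd i (pd j φ) x = pd j (pd i φ) x := by
  have hsym := ((hφ.of_le (m := 2) ENat.LEInfty.out).contDiffAt
    (x := x)).isSymmSndFDerivAt (by simp)
  have hd : DifferentiableAt ℝ (fderiv ℝ φ) x :=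
    (hφ.fderiv_right (m := ∞) le_rfl).differentiable (by simp) x
  have h : ∀ i j : Fin 3, pd i (pd j φ) x
      = fderiv ℝ (fderiv ℝ φ) x (EuclideanSpace.single i 1) (EuclideanSpace.single j 1) := by
    intro i j
    unfold pd
    rw [fderiv_clm_apply hd (by fun_prop)]
    simp
  rw [h, h]
  exact hsym _ _

/-- Tangential derivatives of a function that vanishes on two opposite faces vanish there. -/
theorem ZeroTrace.tangential {R : ℝ} {i j : Fin 3} (hij : j ≠ i) {u g u' g' : E3 → ℝ}
    (h : ZeroTrace R i u g) (hu : HasWD R j u u') (hg : HasWD R j g g') :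
    ZeroTrace R i u' g' := by
  intro φ hφ
  have l1 := tendsto_integral_mcut
    (integrable_smooth_mul (contDiff_pd (i := i) hφ).continuous hu.memLp_deriv) {j}
  have l2 := tendsto_integral_mcut (integrable_smooth_mul hφ.continuous hg.memLp_deriv) {j}
  refine tendsto_nhds_unique (l1.congr' ?_) l2.neg
  filter_upwards [self_mem_nhdsWithin] with e he
  have he0 : 0 < e := he
  -- With a cut-off in `x_j`, the weak derivatives in direction `j` can be tested without any
  -- boundary condition on the `j`-faces; the cut-off commutes with `∂ᵢ`. The zero trace of `u` is
  -- then used with the test function `∂_j` of the cut-off `φ`.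
  have hφe : ContDiff ℝ ∞ (fun x => mcut R e {j} x * φ x) := (contDiff_mcut R e {j}).mul hφ
  have hpd : pd i (fun x => mcut R e {j} x * φ x) = fun x => mcut R e {j} x * pd i φ x := by
    ext x
    rw [pd_mul ((contDiff_mcut R e {j}).differentiable (by simp) x)
      (hφ.differentiable (by simp) x), pd_mcut_eq_zero (by simpa using hij.symm), zero_mul, add_zero]
  have e1 := hu.eq_of_vanishing (contDiff_pd (i := i) hφe) he0 (fun x hx => by
    rw [hpd]; simp only
    rw [mcut_eq_zero he0 (Finset.mem_singleton_self j) hx, zero_mul])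
  have e2 := hg.eq_of_vanishing hφe he0 (fun x hx => by
    rw [mcut_eq_zero he0 (Finset.mem_singleton_self j) hx, zero_mul])
  have e3 := h _ (contDiff_pd (i := j) hφe)
  have e4 : ∫ x in cube R, pd j (pd i fun x => mcut R e {j} x * φ x) x * u x
      = ∫ x in cube R, pd i (pd j fun x => mcut R e {j} x * φ x) x * u x := by
    congr 1; ext x; rw [pd_comm hφe]
  have e5 : ∫ x in cube R, mcut R e {j} x * (pd i φ x * u' x)
      = ∫ x in cube R, pd i (fun x => mcut R e {j} x * φ x) x * u' x := by
    rw [hpd]; congr 1; ext x; ring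
  have e6 : ∫ x in cube R, mcut R e {j} x * (φ x * g' x)
      = ∫ x in cube R, (mcut R e {j} x * φ x) * g' x := by
    congr 1; ext x; ring
  rw [e5, e6]
  linarith

/-! ### Boundary values -/

theorem mem_closure_cube {R : ℝ} (hR : 0 < R) {x : E3} : x ∈ closure (cube R) ↔ ∀ l, |x l| ≤ R := by
  constructor
  · intro hx
    have hcl : IsClosed {x : E3 | ∀ l, |x l| ≤ R} := by
      simp only [ofPred_forall]
      exact isClosed_iInter fun l => isClosed_le (by fun_prop) continuous_const
    exact closure_minimal (fun y hy l => (hy l).le) hcl hx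
  · intro hx
    have h1 : Tendsto (fun s : ℝ => (1 - s) • x) (𝓝[>] 0) (𝓝 x) := by
      have : Tendsto (fun s : ℝ => (1 - s) • x) (𝓝 0) (𝓝 ((1 - (0 : ℝ)) • x)) :=
        (Continuous.tendsto (by fun_prop) 0)
      simpa using this.mono_left nhdsWithin_le_nhds
    refine mem_closure_of_tendsto h1 ?_
    have h2 : ∀ᶠ s : ℝ in 𝓝[>] 0, s < 1 := nhdsWithin_le_nhds (Iio_mem_nhds one_pos)
    filter_upwards [h2, self_mem_nhdsWithin] with s hs hs0
    intro l
    have hs0' : 0 < s := hs0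
    simp only [PiLp.smul_apply, smul_eq_mul, abs_mul]
    rw [abs_of_pos (by linarith)]
    nlinarith [hx l, abs_nonneg (x l)]

theorem volume_strip_le {R e : ℝ} (hR : 0 < R) (he : 0 < e) (i : Fin 3) :
    volume (cube R ∩ {x : E3 | R - 2 * e ≤ |x i|}) ≤ ENNReal.ofReal (4 * e * (2 * R) ^ 2) := by
  set B : Fin 3 → Set ℝ := fun l =>
    if l = i then Icc (R - 2 * e) R ∪ Icc (-R) (-(R - 2 * e)) else Icc (-R) R with hB
  have hBm : ∀ l, MeasurableSet (B l) := by
    intro l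
    simp only [hB]
    split_ifs
    · exact measurableSet_Icc.union measurableSet_Icc
    · exact measurableSet_Icc
  have hsub : cube R ∩ {x : E3 | R - 2 * e ≤ |x i|} ⊆ (@WithLp.ofLp 2 (Fin 3 → ℝ)) ⁻¹' (Set.pi univ B) := by
    rintro x ⟨hx, hxi⟩ l -
    have hxl := abs_lt.1 (hx l)
    simp only [hB]
    split_ifs with h
    · subst h
      have hxi' : R - 2 * e ≤ |x l| := hxi
      rcases abs_cases (x l) with ⟨h1, -⟩ | ⟨h1, -⟩
      · left; constructor <;> linarith
      · right; constructor <;> linarith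
    · constructor <;> linarith
  refine (measure_mono hsub).trans ?_
  rw [(PiLp.volume_preserving_ofLp (Fin 3)).measure_preimage
    (MeasurableSet.univ_pi hBm).nullMeasurableSet, volume_pi_pi]
  have hBv : ∀ l, volume (B l) ≤ if l = i then ENNReal.ofReal (4 * e) else ENNReal.ofReal (2 * R) := by
    intro l
    simp only [hB]
    split_ifs
    · refine (measure_union_le _ _).trans ?_
      rw [Real.volume_Icc, Real.volume_Icc, ← ENNReal.ofReal_add (by linarith) (by linarith)]
      exact ENNReal.ofReal_le_ofReal (by linarith)
    · rw [Real.volume_Icc]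
      exact ENNReal.ofReal_le_ofReal (by linarith)
  refine (Finset.prod_le_prod' fun l _ => hBv l).trans (le_of_eq ?_)
  rw [ENNReal.ofReal_mul (p := 4 * e) (by positivity), ENNReal.ofReal_pow (by positivity)]
  fin_cases i <;> simp [Fin.prod_univ_three] <;> ring

/-- A weakly differentiable function whose continuous representative vanishes on two opposite
faces has zero trace there. -/
theorem HasWD.zeroTrace {R : ℝ} (hR : 0 < R) {i : Fin 3} {u g w : E3 → ℝ} (h : HasWD R i u g)
    (hw : ContinuousOn w (closure (cube R))) (huw : u =ᵐ[volume.restrict (cube R)] w)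
    (h0 : ∀ x ∈ closure (cube R), |x i| = R → w x = 0) : ZeroTrace R i u g := by
  intro φ hφ
  obtain ⟨Φ, hΦ⟩ := (isCompact_closure_cube R).exists_bound_of_continuousOn
    hφ.continuous.continuousOn
  have hΦ0 : 0 ≤ Φ := (norm_nonneg _).trans (hΦ 0 (subset_closure (by intro l; simpa using hR)))
  obtain ⟨C, hC0, hC⟩ := exists_abs_deriv_cut_le
  have hmc : ∀ e, mcut R e {i} = fun x => cut R e (x i) := fun e => by ext x; simp [mcut]
  have l1 := tendsto_integral_mcut
    (integrable_smooth_mul (contDiff_pd (i := i) hφ).continuous h.memLp) {i}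
  have l2 := tendsto_integral_mcut (integrable_smooth_mul hφ.continuous h.memLp_deriv) {i}
  have hcdc : ∀ e, Continuous (deriv (cut R e)) := fun e =>
    ((contDiff_cut R e).of_le (m := 1) (by simp)).continuous_deriv_one
  have hint : ∀ e, Integrable (fun x => (deriv (cut R e) (x i) * φ x) * u x)
      (volume.restrict (cube R)) := fun e =>
    integrable_smooth_mul (((hcdc e).comp (by fun_prop)).mul hφ.continuous) h.memLp
  -- A point near one of the two faces is compared with its projection onto it, where `w` vanishes;
  -- uniform continuity on the compact closed cube makes `w` uniformly small there.
  have hvan : ∀ κ : ℝ, 0 < κ → ∃ δ : ℝ, 0 < δ ∧ ∀ x ∈ cube R, R - 2 * δ ≤ |x i| → |w x| ≤ κ := by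
    intro κ hκ
    obtain ⟨δ, hδ, hδw⟩ := Metric.uniformContinuousOn_iff.1
      ((isCompact_closure_cube R).uniformContinuousOn_of_continuous hw) κ hκ
    refine ⟨δ / 4, by positivity, fun x hx hxi => ?_⟩
    obtain ⟨b, hb, hbx⟩ : ∃ b : ℝ, |b| = R ∧ |x i - b| ≤ δ / 2 := by
      have h1 := abs_lt.1 (hx i)
      rcases abs_cases (x i) with ⟨h2, -⟩ | ⟨h2, -⟩
      · exact ⟨R, abs_of_pos hR, by rw [abs_le]; constructor <;> linarith⟩
      · exact ⟨-R, by rw [abs_neg, abs_of_pos hR], by rw [abs_le]; constructor <;> linarith⟩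
    set y : E3 := x + EuclideanSpace.single i (b - x i) with hy
    have hyl : ∀ l, y l = if l = i then b else x l := by
      intro l
      by_cases hl : l = i
      · subst hl; simp [hy]
      · simp [hy, hl]
    have hyc : y ∈ closure (cube R) := by
      rw [mem_closure_cube hR]
      intro l
      rw [hyl]
      split_ifs
      · exact hb.le
      · exact (hx l).le
    have hd : dist x y < δ := by
      rw [dist_eq_norm, hy, sub_add_cancel_left, norm_neg, PiLp.norm_single,
        Real.norm_eq_abs, abs_sub_comm]
      linarith
    have h3 := hδw x (subset_closure hx) y hyc hd
    rw [h0 y hyc (by rw [hyl, if_pos rfl, hb]), Real.dist_eq, sub_zero] at h3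
    exact h3.le
  -- The boundary-layer term: the derivative of the cut-off is of order `1/e`, the layer has volume
  -- of order `e`, and `w` tends to zero uniformly on it.
  have l3 : Tendsto (fun e => ∫ x in cube R, (deriv (cut R e) (x i) * φ x) * u x) (𝓝[>] 0)
      (𝓝 0) := by
    rw [Metric.tendsto_nhds]
    intro κ' hκ'
    set K : ℝ := C * Φ * (4 * (2 * R) ^ 2) + 1 with hK
    have hK0 : 0 < K := by positivity
    obtain ⟨δ, hδ, hδw⟩ := hvan (κ' / (2 * K)) (by positivity)
    have hev : ∀ᶠ e : ℝ in 𝓝[>] 0, e < δ := nhdsWithin_le_nhds (Iio_mem_nhds hδ)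
    filter_upwards [hev, self_mem_nhdsWithin] with e he he0
    have he0 : 0 < e := he0
    set T := {x : E3 | R - 2 * e ≤ |x i|} with hT
    have hTm : MeasurableSet T := (isClosed_le continuous_const (by fun_prop)).measurableSet
    have e1 : ∫ x in cube R, (deriv (cut R e) (x i) * φ x) * u x
        = ∫ x in cube R, (deriv (cut R e) (x i) * φ x) * w x :=
      integral_congr_ae (by filter_upwards [huw] with x hx; rw [hx])
    have e2 : ∫ x in cube R, (deriv (cut R e) (x i) * φ x) * w x
        = ∫ x in cube R ∩ T, (deriv (cut R e) (x i) * φ x) * w x := by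
      refine setIntegral_eq_of_subset_of_forall_sdiff_eq_zero (measurableSet_cube R)
        inter_subset_left fun x hx => ?_
      have : |x i| < R - 2 * e := by
        by_contra hc
        exact hx.2 ⟨hx.1, not_lt.1 hc⟩
      rw [deriv_cut_eq_zero he0 this, zero_mul, zero_mul]
    have hvol := volume_strip_le hR he0 i
    have hvt : volume (cube R ∩ T) < ⊤ := hvol.trans_lt ENNReal.ofReal_lt_top
    have e3 : ‖∫ x in cube R ∩ T, (deriv (cut R e) (x i) * φ x) * w x‖
        ≤ (C / e * Φ * (κ' / (2 * K))) * volume.real (cube R ∩ T) := by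
      refine norm_setIntegral_le_of_norm_le_const hvt fun x hx => ?_
      rw [norm_mul, norm_mul]
      refine mul_le_mul (mul_le_mul (hC R e _ he0) (hΦ x (subset_closure hx.1)) (norm_nonneg _)
        (by positivity)) (hδw x hx.1 ?_) (norm_nonneg _) (by positivity)
      have hx2 : R - 2 * e ≤ |x i| := hx.2
      linarith
    have e4 : volume.real (cube R ∩ T) ≤ 4 * e * (2 * R) ^ 2 :=
      ENNReal.toReal_le_of_le_ofReal (by positivity) hvol
    rw [dist_zero_right, e1, e2]
    refine e3.trans_lt ?_
    calc (C / e * Φ * (κ' / (2 * K))) * volume.real (cube R ∩ T)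
        ≤ (C / e * Φ * (κ' / (2 * K))) * (4 * e * (2 * R) ^ 2) := by gcongr
      _ = (C * Φ * (4 * (2 * R) ^ 2)) / K * (κ' / 2) := by field_simp
      _ ≤ 1 * (κ' / 2) := by
          gcongr
          rw [div_le_one hK0]; linarith
      _ < κ' := by linarith
  have l4 := l1.add l3
  rw [add_zero] at l4
  refine tendsto_nhds_unique (l4.congr' ?_) l2.neg
  filter_upwards [self_mem_nhdsWithin] with e he
  have he0 : 0 < e := he
  have := h.eq_of_vanishing ((contDiff_mcut R e {i}).mul hφ) he0 (fun x hx => by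
    rw [mcut_eq_zero he0 (Finset.mem_singleton_self i) hx, zero_mul])
  have e1 : ∀ x, pd i (fun x => mcut R e {i} x * φ x) x * u x
      = mcut R e {i} x * (pd i φ x * u x) + (deriv (cut R e) (x i) * φ x) * u x := by
    intro x
    rw [pd_mul ((contDiff_mcut R e {i}).differentiable (by simp) x)
      (hφ.differentiable (by simp) x), hmc, pd_comp_coord ((contDiff_cut R e).differentiable
      (by simp)), if_pos rfl]
    ring
  simp_rw [e1, mul_assoc (mcut R e {i} _)] at this
  rw [integral_add ?_ (hint e)] at this
  · exact this
  · have := integrable_smooth_mul (R := R) ((contDiff_mcut R e {i}).continuous.mul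
      (contDiff_pd (i := i) hφ).continuous) h.memLp
    simpa only [mul_assoc, Pi.mul_apply] using this

theorem HasWD.coord_mul {R : ℝ} {i : Fin 3} {u g : E3 → ℝ} (h : HasWD R i u g) {ρ : ℝ → ℝ}
    (hρ : ContDiff ℝ ∞ ρ) (j : Fin 3) :
    HasWD R i (fun x => ρ (x j) * u x)
      (fun x => ρ (x j) * g x + (if i = j then deriv ρ (x j) else 0) * u x) := by
  have := h.smooth_mul (ρ := fun x => ρ (x j)) (hρ.comp (contDiff_coord j))
  simp_rw [pd_comp_coord (hρ.differentiable (by simp))] at this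
  exact this

theorem contDiff_deriv {ρ : ℝ → ℝ} (hρ : ContDiff ℝ ∞ ρ) : ContDiff ℝ ∞ (deriv ρ) :=
  ((contDiff_infty_iff_deriv).1 hρ).2

/-- The boundary term at the upper face in an integration by parts has a sign. -/
theorem HasWD.neg_integral_sq_le {R : ℝ} (hR : 0 < R) {i : Fin 3} {p g w : E3 → ℝ}
    (h : HasWD R i p g)
    (hw : ContinuousOn w (closure (cube R))) (hpw : p =ᵐ[volume.restrict (cube R)] w)
    (h0 : ∀ x ∈ closure (cube R), x i = -R → w x = 0) {ρ : ℝ → ℝ} (hρ : ContDiff ℝ ∞ ρ)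
    (hρ0 : ∀ s, |s| < R → 0 ≤ ρ s) :
    - ∫ x in cube R, deriv ρ (x i) * (p x * p x) ≤ 2 * ∫ x in cube R, ρ (x i) * (p x * g x) := by
  have hpp : Integrable (fun x => p x * p x) (volume.restrict (cube R)) :=
    memLp_two_mul_integrable h.memLp h.memLp
  have hpg : Integrable (fun x => p x * g x) (volume.restrict (cube R)) :=
    memLp_two_mul_integrable h.memLp h.memLp_deriv
  have hbd : ∀ σ : ℝ → ℝ, Continuous σ → ∀ F : E3 → ℝ, Integrable F (volume.restrict (cube R)) →
      Integrable (fun x => σ (x i) * F x) (volume.restrict (cube R)) := by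
    intro σ hσ F hF
    have hσ' : Continuous fun x : E3 => σ (x i) := hσ.comp (by fun_prop)
    obtain ⟨C, hC⟩ := (isCompact_closure_cube R).exists_bound_of_continuousOn hσ'.continuousOn
    refine hF.bdd_mul (c := C) hσ'.aestronglyMeasurable ?_
    filter_upwards [ae_restrict_mem (measurableSet_cube R)] with x hx
    exact hC x (subset_closure hx)
  have hρc := hρ.continuous
  have hρ'c := (contDiff_deriv hρ).continuous
  -- Nothing is assumed about `p` on the upper face, so `χ` cuts off there only; on the lower face
  -- `w` itself vanishes. The product has zero trace in direction `i`.
  set χ : ℝ → ℝ → ℝ := fun e s => ramp e (R - s) with hχ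
  have hχs : ∀ e, ContDiff ℝ ∞ (χ e) := fun e => (contDiff_ramp e).comp (by fun_prop)
  have hlim : ∀ F : E3 → ℝ, Integrable F (volume.restrict (cube R)) →
      Tendsto (fun e => ∫ x in cube R, χ e (x i) * F x) (𝓝[>] 0) (𝓝 (∫ x in cube R, F x)) := by
    intro F hF
    refine tendsto_integral_filter_of_dominated_convergence (fun x => |F x|) ?_ ?_ hF.abs ?_
    · exact Eventually.of_forall fun e =>
        ((hχs e).continuous.comp (by fun_prop)).aestronglyMeasurable.mul hF.aestronglyMeasurable
    · refine Eventually.of_forall fun e => Eventually.of_forall fun x => ?_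
      rw [norm_mul, Real.norm_eq_abs, Real.norm_eq_abs, abs_of_nonneg (ramp_nonneg _ _)]
      exact mul_le_of_le_one_left (abs_nonneg _) (ramp_le_one _ _)
    · filter_upwards [ae_restrict_mem (measurableSet_cube R)] with x hx
      have h1 : ∀ᶠ e : ℝ in 𝓝[>] 0, e < (R - x i) / 2 :=
        nhdsWithin_le_nhds (Iio_mem_nhds (by linarith [(abs_lt.1 (hx i)).2]))
      refine tendsto_const_nhds.congr' ?_
      filter_upwards [h1, self_mem_nhdsWithin] with e he he0
      simp only [hχ]
      rw [ramp_eq_one he0 (by linarith), one_mul]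
  have l1 := (hlim _ (hbd _ hρ'c _ hpp)).neg
  have l2 := (hlim _ (hbd _ hρc _ hpg)).const_mul 2
  refine le_of_tendsto_of_tendsto l1 l2 ?_
  filter_upwards [self_mem_nhdsWithin] with e he
  have he0 : 0 < e := he
  have hwd := h.coord_mul (hχs e) i
  have hcont : ContinuousOn (fun x => χ e (x i) * w x) (closure (cube R)) :=
    (((hχs e).continuous.comp (by fun_prop)).continuousOn).mul hw
  have hzt := hwd.zeroTrace hR hcont (by filter_upwards [hpw] with x hx; rw [hx])
    (fun x hx hxi => by
      rcases abs_cases (x i) with ⟨h1, -⟩ | ⟨h1, -⟩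
      · have : χ e (x i) = 0 := ramp_eq_zero he0 (by linarith)
        rw [this, zero_mul]
      · rw [h0 x hx (by linarith), mul_zero])
  have hibp := hzt.integral_mul hwd.memLp hwd.memLp_deriv (h.coord_mul hρ i)
  simp only [if_true] at hibp
  have hχ'c := (contDiff_deriv (hχs e)).continuous
  have i1 := hbd _ (hχs e).continuous _ (hbd _ hρc _ hpg)
  have i2 := hbd _ (hχs e).continuous _ (hbd _ hρ'c _ hpp)
  have i3 := hbd _ hχ'c _ (hbd _ hρc _ hpp)
  have e1 : ∫ x in cube R, χ e (x i) * p x * (ρ (x i) * g x + deriv ρ (x i) * p x)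
      = (∫ x in cube R, χ e (x i) * (ρ (x i) * (p x * g x)))
        + ∫ x in cube R, χ e (x i) * (deriv ρ (x i) * (p x * p x)) := by
    rw [← integral_add i1 i2]; congr 1; ext x; ring
  have e2 : ∫ x in cube R, (χ e (x i) * g x + deriv (χ e) (x i) * p x) * (ρ (x i) * p x)
      = (∫ x in cube R, χ e (x i) * (ρ (x i) * (p x * g x)))
        + ∫ x in cube R, deriv (χ e) (x i) * (ρ (x i) * (p x * p x)) := by
    rw [← integral_add i1 i3]; congr 1; ext x; ring
  -- The regularized boundary term. The cut-off is nonincreasing and `ρ ≥ 0`, so it can be dropped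
  -- without computing its limit.
  have hneg : ∫ x in cube R, deriv (χ e) (x i) * (ρ (x i) * (p x * p x)) ≤ 0 := by
    refine setIntegral_nonpos (measurableSet_cube R) fun x hx => ?_
    refine mul_nonpos_of_nonpos_of_nonneg ?_ (mul_nonneg (hρ0 _ (hx i)) (mul_self_nonneg _))
    have hanti : Antitone (χ e) := fun a b hab => monotone_ramp he0 (by linarith)
    exact hanti.deriv_nonpos
  rw [e1, e2] at hibp
  linarith

/-! ### Weighted integration by parts -/

/-- The unit multi-index in the direction `i`. -/
abbrev unitIdx (i : Fin 3) : Fin 3 → ℕ := Pi.single i 1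

/-- The functions `D α`, `|α| ≤ 3`, are the weak derivatives of `D 0`. -/
def IsSob3 (R : ℝ) (D : (Fin 3 → ℕ) → E3 → ℝ) : Prop :=
  ∀ α i, ∑ j, α j ≤ 2 → HasWD R i (D α) (D (α + unitIdx i))

/-- An integral with a weight that depends on the third coordinate. -/
def wint (R : ℝ) (ρ : ℝ → ℝ) (F : E3 → ℝ) : ℝ := ∫ x in cube R, ρ (x 2) * F x

theorem integrable_weight_mul {R : ℝ} {ρ : ℝ → ℝ} (hρ : Continuous ρ) {F : E3 → ℝ}
    (hF : Integrable F (volume.restrict (cube R))) :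
    Integrable (fun x => ρ (x 2) * F x) (volume.restrict (cube R)) := by
  have hσ' : Continuous fun x : E3 => ρ (x 2) := hρ.comp (by fun_prop)
  obtain ⟨C, hC⟩ := (isCompact_closure_cube R).exists_bound_of_continuousOn hσ'.continuousOn
  refine hF.bdd_mul (c := C) hσ'.aestronglyMeasurable ?_
  filter_upwards [ae_restrict_mem (measurableSet_cube R)] with x hx
  exact hC x (subset_closure hx)

theorem wint_add {R : ℝ} {ρ σ : ℝ → ℝ} {F G : E3 → ℝ} (hρ : Continuous ρ) (hσ : Continuous σ)
    (hF : Integrable F (volume.restrict (cube R))) (hG : Integrable G (volume.restrict (cube R))) :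
    wint R ρ F + wint R σ G = ∫ x in cube R, (ρ (x 2) * F x + σ (x 2) * G x) :=
  (integral_add (integrable_weight_mul hρ hF) (integrable_weight_mul hσ hG)).symm

section
variable {R : ℝ} {D : (Fin 3 → ℕ) → E3 → ℝ}

theorem IsSob3.wd0 (h : IsSob3 R D) (i : Fin 3) : HasWD R i (D 0) (D (unitIdx i)) := by
  have := h 0 i (by simp)
  rwa [zero_add] at this

theorem IsSob3.wd1 (h : IsSob3 R D) (i j : Fin 3) :
    HasWD R j (D (unitIdx i)) (D (unitIdx i + unitIdx j)) := h _ j (by simp)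

theorem IsSob3.wd1' (h : IsSob3 R D) (i j : Fin 3) :
    HasWD R j (D (unitIdx i)) (D (unitIdx j + unitIdx i)) := by
  rw [add_comm]; exact h.wd1 i j

theorem IsSob3.wd2 (h : IsSob3 R D) (i j k : Fin 3) :
    HasWD R k (D (unitIdx i + unitIdx j)) (D (unitIdx i + unitIdx j + unitIdx k)) :=
  h _ k (by simp [Finset.sum_add_distrib])

theorem IsSob3.mem0 (h : IsSob3 R D) : MemLp (D 0) 2 (volume.restrict (cube R)) := (h.wd0 0).memLp

theorem IsSob3.mem1 (h : IsSob3 R D) (i : Fin 3) :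
    MemLp (D (unitIdx i)) 2 (volume.restrict (cube R)) := (h.wd1 i 0).memLp

theorem IsSob3.mem2 (h : IsSob3 R D) (i j : Fin 3) :
    MemLp (D (unitIdx i + unitIdx j)) 2 (volume.restrict (cube R)) := (h.wd2 i j 0).memLp

theorem IsSob3.mem3 (h : IsSob3 R D) (i j k : Fin 3) :
    MemLp (D (unitIdx i + unitIdx j + unitIdx k)) 2 (volume.restrict (cube R)) :=
  (h.wd2 i j k).memLp_deriv

/-- Integration by parts with a weight. -/
theorem ZeroTrace.wint_eq {i : Fin 3} {u g v w : E3 → ℝ} (h : ZeroTrace R i u g)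
    (hu : MemLp u 2 (volume.restrict (cube R)))
    (hg : MemLp g 2 (volume.restrict (cube R))) (hv : HasWD R i v w) {ρ : ℝ → ℝ}
    (hρ : ContDiff ℝ ∞ ρ) :
    wint R ρ (fun x => u x * w x) + (if i = 2 then wint R (deriv ρ) (fun x => u x * v x) else 0)
      = - wint R ρ (fun x => g x * v x) := by
  have h1 := h.integral_mul hu hg (hv.coord_mul hρ 2)
  have e1 : ∫ x in cube R, g x * (ρ (x 2) * v x) = wint R ρ (fun x => g x * v x) := by
    unfold wint; congr 1; ext x; ring
  rw [e1] at h1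
  rw [← h1]
  by_cases hi : i = 2
  · simp only [hi, if_true]
    rw [wint_add hρ.continuous (contDiff_deriv hρ).continuous
      (memLp_two_mul_integrable hu hv.memLp_deriv) (memLp_two_mul_integrable hu hv.memLp)]
    congr 1; ext x; ring
  · simp only [hi, if_false]
    rw [add_zero]
    unfold wint; congr 1; ext x; ring

theorem wint_second_mul_self (h : IsSob3 R D)
    (hz : ∀ i, ZeroTrace R i (D 0) (D (unitIdx i))) {ρ : ℝ → ℝ} (hρ : ContDiff ℝ ∞ ρ)
    {i : Fin 3} (hi : i ≠ 2) :
    wint R ρ (fun x => D (unitIdx i + unitIdx i) x * D 0 x)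
      = - wint R ρ (fun x => D (unitIdx i) x ^ 2) := by
  have := (hz i).wint_eq h.mem0 (h.mem1 i) (h.wd1 i i) hρ
  simp only [hi, if_false, add_zero] at this
  simp_rw [mul_comm _ (D 0 _), sq]
  exact this

theorem wint_second_mul_self_two (h : IsSob3 R D)
    (hz : ∀ i, ZeroTrace R i (D 0) (D (unitIdx i))) {ρ : ℝ → ℝ} (hρ : ContDiff ℝ ∞ ρ) :
    wint R ρ (fun x => D (unitIdx 2 + unitIdx 2) x * D 0 x)
      = - wint R ρ (fun x => D (unitIdx 2) x ^ 2)
        - wint R (deriv ρ) (fun x => D (unitIdx 2) x * D 0 x) := by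
  have := (hz 2).wint_eq h.mem0 (h.mem1 2) (h.wd1 2 2) hρ
  simp only [if_true] at this
  simp_rw [mul_comm _ (D 0 _), sq]
  linarith

theorem wint_first_mul_self (h : IsSob3 R D)
    (hz : ∀ i, ZeroTrace R i (D 0) (D (unitIdx i))) {ρ : ℝ → ℝ} (hρ : ContDiff ℝ ∞ ρ) :
    2 * wint R ρ (fun x => D (unitIdx 2) x * D 0 x) = - wint R (deriv ρ) (fun x => D 0 x ^ 2) := by
  have := (hz 2).wint_eq h.mem0 (h.mem1 2) (h.wd0 2) hρ
  simp only [if_true] at this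
  simp_rw [mul_comm (D 0 _), ← sq] at this
  linarith

/-- An integration by parts in direction `i`, then one in direction `2` applied to `½ ∂₂ (∂ᵢ u)²`.
Neither leaves a boundary term, because `∂₂ u` vanishes on the `i`-faces and `∂ᵢ u` on the
`2`-faces, both being tangential there. -/
theorem wint_second_mul_first (h : IsSob3 R D)
    (hz : ∀ i, ZeroTrace R i (D 0) (D (unitIdx i))) {ρ : ℝ → ℝ} (hρ : ContDiff ℝ ∞ ρ)
    {i : Fin 3} (hi : i ≠ 2) :
    2 * wint R ρ (fun x => D (unitIdx i + unitIdx i) x * D (unitIdx 2) x)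
      = wint R (deriv ρ) (fun x => D (unitIdx i) x ^ 2) := by
  have z1 : ZeroTrace R i (D (unitIdx 2)) (D (unitIdx i + unitIdx 2)) :=
    (hz i).tangential hi.symm (h.wd0 2) (h.wd1 i 2)
  have z2 : ZeroTrace R 2 (D (unitIdx i)) (D (unitIdx i + unitIdx 2)) :=
    (hz 2).tangential hi (h.wd0 i) (h.wd1' 2 i)
  have e1 := z1.wint_eq (h.mem1 2) (h.mem2 i 2) (h.wd1 i i) hρ
  have e2 := z2.wint_eq (h.mem1 i) (h.mem2 i 2) (h.wd1 i 2) hρ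
  simp only [hi, if_false, if_true, add_zero] at e1 e2
  simp_rw [mul_comm _ (D (unitIdx i + unitIdx i) _)] at e1
  simp_rw [mul_comm _ (D (unitIdx i + unitIdx 2) _), ← sq] at e2
  linarith

/-- One derivative is moved in direction `i` and another in direction `j`; `∂_j² u` vanishes on the
`i`-faces and `∂ᵢ u` on the `j`-faces. The intermediate expression contains a third derivative,
which is why three weak derivatives are required. -/
theorem wint_second_mul_second (h : IsSob3 R D)
    (hz : ∀ i, ZeroTrace R i (D 0) (D (unitIdx i))) {ρ : ℝ → ℝ} (hρ : ContDiff ℝ ∞ ρ)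
    {i j : Fin 3} (hij : i ≠ j) (hi : i ≠ 2) :
    wint R ρ (fun x => D (unitIdx i + unitIdx i) x * D (unitIdx j + unitIdx j) x)
      = wint R ρ (fun x => D (unitIdx i + unitIdx j) x ^ 2)
        + (if j = 2 then wint R (deriv ρ)
            (fun x => D (unitIdx i) x * D (unitIdx i + unitIdx j) x) else 0) := by
  have z1 : ZeroTrace R i (D (unitIdx j)) (D (unitIdx i + unitIdx j)) :=
    (hz i).tangential hij.symm (h.wd0 j) (h.wd1 i j)
  have z2 : ZeroTrace R i (D (unitIdx j + unitIdx j)) (D (unitIdx i + unitIdx j + unitIdx j)) :=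
    z1.tangential hij.symm (h.wd1 j j) (h.wd2 i j j)
  have z3 : ZeroTrace R j (D (unitIdx i)) (D (unitIdx i + unitIdx j)) :=
    (hz j).tangential hij (h.wd0 i) (h.wd1' j i)
  have e1 := z2.wint_eq (h.mem2 j j) (h.mem3 i j j) (h.wd1 i i) hρ
  have e2 := z3.wint_eq (h.mem1 i) (h.mem2 i j) (h.wd2 i j j) hρ
  simp only [hi, if_false, add_zero] at e1
  simp_rw [mul_comm _ (D (unitIdx i + unitIdx i) _)] at e1
  simp_rw [← sq, mul_comm (D (unitIdx i) _) (D (unitIdx i + unitIdx j + unitIdx j) _)] at e2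
  linarith

end

/-! ### The Carleman estimate -/

/-- The Laplacian of `D 0`. -/
def lap (D : (Fin 3 → ℕ) → E3 → ℝ) (x : E3) : ℝ := ∑ i, D (unitIdx i + unitIdx i) x

theorem contDiff_carlemanWeight (r lam : ℝ) : ContDiff ℝ ∞ (carlemanWeight r lam) := by
  unfold carlemanWeight; fun_prop

theorem carlemanWeight_pos (r lam s : ℝ) : 0 < carlemanWeight r lam s := Real.exp_pos _

theorem hasDerivAt_carlemanWeight (r lam s : ℝ) :
    HasDerivAt (carlemanWeight r lam)
      (2 * (2 * lam * (s - r)) * carlemanWeight r lam s) s := by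
  have h1 : HasDerivAt (fun z : ℝ => 2 * lam * (z - r) ^ 2) (2 * lam * (2 * (s - r))) s := by
    have := (((hasDerivAt_id s).sub_const r).pow 2).const_mul (2 * lam)
    refine this.congr_deriv ?_
    simp
  refine h1.exp.congr_deriv ?_
  unfold carlemanWeight; ring

theorem hasDerivAt_psi (r lam s : ℝ) : HasDerivAt (fun s => 2 * lam * (s - r)) (2 * lam) s := by
  have := ((hasDerivAt_id s).sub_const r).const_mul (2 * lam)
  exact this.congr_deriv (by ring)

section
variable {R r lam : ℝ} {D : (Fin 3 → ℕ) → E3 → ℝ}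

theorem IsSob3.memLp_lap (h : IsSob3 R D) : MemLp (lap D) 2 (volume.restrict (cube R)) :=
  memLp_finsetSum _ fun i _ => h.mem2 i i

/-- Boundary conditions: `D 0 = 0` on the boundary of the cube and `∂_z D 0 = 0` on its lower
face. -/
structure ZeroData (R : ℝ) (D : (Fin 3 → ℕ) → E3 → ℝ) : Prop where
  trace : ∀ i, ZeroTrace R i (D 0) (D (unitIdx i))
  normal : ∃ w : E3 → ℝ, ContinuousOn w (closure (cube R)) ∧
    D (unitIdx 2) =ᵐ[volume.restrict (cube R)] w ∧
    ∀ x ∈ closure (cube R), x 2 = -R → w x = 0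

/-- Put `ψ = 2λ(z - r)`, so that `φ' = 2ψφ` and `ψ' = 2λ`, and `b = 2ψ u_z + (2ψ² + 2λ) u`. After
conjugation by `√φ`, the symmetric and skew parts of the Laplacian correspond to `Δu + b` and `-b`.
Dropping both squares leaves `φ |Δu|² ≥ -2φ b (Δu + b)`, and the integral of the right-hand side is
the commutator term: integrated by parts, it dominates the left-hand side of the estimate. -/
theorem carleman_first (hR : 0 < R) (hr : R < r) (hl : 0 < lam) (h : IsSob3 R D)
    (hb : ZeroData R D) :
    8 * lam * ∫ x in cube R, carlemanWeight r lam (x 2) *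
        ((D (unitIdx 2) x + 2 * lam * (x 2 - r) * D 0 x) ^ 2
          + (2 * lam * (x 2 - r)) ^ 2 * D 0 x ^ 2)
      ≤ ∫ x in cube R, carlemanWeight r lam (x 2) * lap D x ^ 2 := by
  set φ := carlemanWeight r lam with hφ
  set ψ : ℝ → ℝ := fun s => 2 * lam * (s - r) with hψ
  have hφc : ContDiff ℝ ∞ φ := contDiff_carlemanWeight r lam
  have hψc : ContDiff ℝ ∞ ψ := by simp only [hψ]; fun_prop
  have hφd : ∀ s, HasDerivAt φ (2 * ψ s * φ s) s := hasDerivAt_carlemanWeight r lam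
  have hψd : ∀ s, HasDerivAt ψ (2 * lam) s := hasDerivAt_psi r lam
  -- The multiplier is `-φ b = P u_z - Q u`, and `P' = -2 Q`. The function `Z` is the coefficient of
  -- a null form that completes the squares at the end.
  set P : ℝ → ℝ := fun s => -(2 * ψ s * φ s) with hP
  set Q : ℝ → ℝ := fun s => (2 * ψ s ^ 2 + 2 * lam) * φ s with hQ
  set Q' : ℝ → ℝ := fun s => (4 * ψ s ^ 3 + 12 * lam * ψ s) * φ s with hQ'
  set Z : ℝ → ℝ := fun s => (4 * ψ s ^ 3 + 4 * lam * ψ s) * φ s with hZ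
  set Z' : ℝ → ℝ := fun s => (8 * ψ s ^ 4 + 32 * lam * ψ s ^ 2 + 8 * lam ^ 2) * φ s with hZ'
  have hPc : ContDiff ℝ ∞ P := by fun_prop
  have hQc : ContDiff ℝ ∞ Q := by fun_prop
  have hQ'c : ContDiff ℝ ∞ Q' := by fun_prop
  have hZc : ContDiff ℝ ∞ Z := by fun_prop
  have hZ'c : ContDiff ℝ ∞ Z' := by fun_prop
  have dP : deriv P = fun s => -2 * Q s := by
    ext s
    refine (((hψd s).const_mul 2).mul (hφd s)).neg.deriv.trans ?_
    simp only [hQ]; ring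
  have dQ : deriv Q = Q' := by
    ext s
    refine (((((hψd s).pow 2).const_mul 2).add_const (2 * lam)).mul (hφd s)).deriv.trans ?_
    simp only [hQ', Pi.pow_apply]; push_cast; ring
  have dZ : deriv Z = Z' := by
    ext s
    refine (((((hψd s).pow 3).const_mul 4).add ((hψd s).const_mul (4 * lam))).mul
      (hφd s)).deriv.trans ?_
    simp only [hZ', Pi.pow_apply, Pi.add_apply]; push_cast; ring
  obtain ⟨w, hw, hwe, hw0⟩ := hb.normal
  -- products of the functions
  have p00 : Integrable (fun x => D 0 x ^ 2) (volume.restrict (cube R)) := h.mem0.integrable_sq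
  have p11 : ∀ i, Integrable (fun x => D (unitIdx i) x ^ 2) (volume.restrict (cube R)) :=
    fun i => (h.mem1 i).integrable_sq
  have p10 : Integrable (fun x => D (unitIdx 2) x * D 0 x) (volume.restrict (cube R)) :=
    memLp_two_mul_integrable (h.mem1 2) h.mem0
  have p21 : ∀ i, Integrable (fun x => D (unitIdx i + unitIdx i) x * D (unitIdx 2) x)
      (volume.restrict (cube R)) := fun i => memLp_two_mul_integrable (h.mem2 i i) (h.mem1 2)
  have p20 : ∀ i, Integrable (fun x => D (unitIdx i + unitIdx i) x * D 0 x)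
      (volume.restrict (cube R)) := fun i => memLp_two_mul_integrable (h.mem2 i i) h.mem0
  have pll : Integrable (fun x => lap D x ^ 2) (volume.restrict (cube R)) :=
    h.memLp_lap.integrable_sq
  -- the terms of the cross product
  set T : Fin 3 → ℝ := fun i => wint R P (fun x => D (unitIdx i + unitIdx i) x * D (unitIdx 2) x)
    + wint R (fun s => -Q s) (fun x => D (unitIdx i + unitIdx i) x * D 0 x) with hT
  have hnegQ : ∀ F : E3 → ℝ, wint R (fun s => -Q s) F = - wint R Q F := by
    intro F; unfold wint; rw [← integral_neg]; congr 1; ext x; ring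
  have hdP : ∀ F : E3 → ℝ, wint R (deriv P) F = - (2 * wint R Q F) := by
    intro F; unfold wint; rw [dP, ← integral_const_mul, ← integral_neg]; congr 1; ext x; ring
  have hTi : ∀ i, i ≠ 2 → T i = 0 := by
    intro i hi
    have e1 := wint_second_mul_first h hb.trace hPc hi
    have e2 := wint_second_mul_self h hb.trace hQc hi
    rw [hdP] at e1
    simp only [hT, hnegQ]
    linarith
  -- Only the third direction has a genuine boundary term. On the lower face `u_z` vanishes; on the
  -- upper face the sign is favourable, since `P ≥ 0` for `z < r`. The two tangential directions
  -- contribute nothing, by `P' = -2 Q`.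
  have hT2 : 2 * wint R Q (fun x => D (unitIdx 2) x ^ 2)
      + wint R Q' (fun x => D (unitIdx 2) x * D 0 x) ≤ T 2 := by
    have e1 := (h.wd1 2 2).neg_integral_sq_le hR hw hwe hw0 hPc (fun s hs => by
      have := abs_lt.1 hs
      simp only [hP, hψ]
      have h1 := carlemanWeight_pos r lam s
      have h2 : 0 ≤ 2 * lam * (r - s) * φ s := by
        have : 0 ≤ r - s := by linarith
        positivity
      nlinarith)
    have e2 := wint_second_mul_self_two h hb.trace hQc
    rw [dQ] at e2
    have e3 := hdP (fun x => D (unitIdx 2) x * D (unitIdx 2) x)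
    unfold wint at e3
    rw [e3] at e1
    have e4 : ∫ x in cube R, P (x 2) * (D (unitIdx 2) x * D (unitIdx 2 + unitIdx 2) x)
        = wint R P (fun x => D (unitIdx 2 + unitIdx 2) x * D (unitIdx 2) x) := by
      unfold wint; congr 1; ext x; ring
    have e5 : ∫ x in cube R, Q (x 2) * (D (unitIdx 2) x * D (unitIdx 2) x)
        = wint R Q (fun x => D (unitIdx 2) x ^ 2) := by
      unfold wint; congr 1; ext x; ring
    rw [e4, e5] at e1
    simp only [hT, hnegQ]
    linarith
  have hsum : 2 * (2 * wint R Q (fun x => D (unitIdx 2) x ^ 2)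
      + wint R Q' (fun x => D (unitIdx 2) x * D 0 x)) ≤ 2 * ∑ i, T i := by
    rw [Fin.sum_univ_three, hTi 0 (by decide), hTi 1 (by decide)]
    linarith
  have hTint : ∀ i, Integrable (fun x => P (x 2) * (D (unitIdx i + unitIdx i) x * D (unitIdx 2) x)
      + -Q (x 2) * (D (unitIdx i + unitIdx i) x * D 0 x)) (volume.restrict (cube R)) := fun i =>
    (integrable_weight_mul hPc.continuous (p21 i)).add
      (integrable_weight_mul hQc.continuous.neg (p20 i))
  have hTsum : ∑ i, T i = ∫ x in cube R, lap D x * (P (x 2) * D (unitIdx 2) x - Q (x 2) * D 0 x) := by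
    have : ∀ i, T i = ∫ x in cube R, (P (x 2) * (D (unitIdx i + unitIdx i) x * D (unitIdx 2) x)
      + -Q (x 2) * (D (unitIdx i + unitIdx i) x * D 0 x)) := fun i =>
      wint_add hPc.continuous hQc.continuous.neg (p21 i) (p20 i)
    simp_rw [this]
    rw [← integral_finsetSum _ fun i _ => hTint i]
    congr 1; ext x
    rw [lap, Finset.sum_mul]
    exact Finset.sum_congr rfl fun i _ => by ring
  -- the square
  set B : E3 → ℝ := fun x => φ (x 2) * (2 * ψ (x 2) * D (unitIdx 2) x
    + (2 * ψ (x 2) ^ 2 + 2 * lam) * D 0 x) ^ 2 with hB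
  have hBi : Integrable B (volume.restrict (cube R)) := by
    have i1 := integrable_weight_mul (ρ := fun s => 4 * ψ s ^ 2 * φ s)
      (by have := hψc.continuous; have := hφc.continuous; fun_prop) (p11 2)
    have i2 := integrable_weight_mul (ρ := fun s => 4 * ψ s * (2 * ψ s ^ 2 + 2 * lam) * φ s)
      (by have := hψc.continuous; have := hφc.continuous; fun_prop) p10
    have i3 := integrable_weight_mul (ρ := fun s => (2 * ψ s ^ 2 + 2 * lam) ^ 2 * φ s)
      (by have := hψc.continuous; have := hφc.continuous; fun_prop) p00
    refine ((i1.add i2).add i3).congr (Eventually.of_forall fun x => ?_)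
    simp only [hB, Pi.add_apply]; ring
  set K : E3 → ℝ := fun x => φ (x 2) * ((D (unitIdx 2) x + ψ (x 2) * D 0 x) ^ 2
          + ψ (x 2) ^ 2 * D 0 x ^ 2) with hK
  have hKi : Integrable K (volume.restrict (cube R)) := by
    have i1 := integrable_weight_mul (ρ := φ) hφc.continuous (p11 2)
    have i2 := integrable_weight_mul (ρ := fun s => 2 * ψ s * φ s)
      (by have := hψc.continuous; have := hφc.continuous; fun_prop) p10
    have i3 := integrable_weight_mul (ρ := fun s => 2 * ψ s ^ 2 * φ s)
      (by have := hψc.continuous; have := hφc.continuous; fun_prop) p00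
    refine ((i1.add i2).add i3).congr (Eventually.of_forall fun x => ?_)
    simp only [hK, Pi.add_apply]; ring
  have hLi : Integrable (fun x => lap D x * (P (x 2) * D (unitIdx 2) x - Q (x 2) * D 0 x))
      (volume.restrict (cube R)) := by
    have i1 := integrable_weight_mul hPc.continuous
      (memLp_two_mul_integrable h.memLp_lap (h.mem1 2))
    have i2 := integrable_weight_mul hQc.continuous (memLp_two_mul_integrable h.memLp_lap h.mem0)
    refine (i1.sub i2).congr (Eventually.of_forall fun x => ?_)
    simp only [Pi.sub_apply]; ring
  have hmain : 2 * (∫ x in cube R, lap D x * (P (x 2) * D (unitIdx 2) x - Q (x 2) * D 0 x))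
      - 2 * ∫ x in cube R, B x ≤ ∫ x in cube R, φ (x 2) * lap D x ^ 2 := by
    rw [← integral_const_mul, ← integral_const_mul, ← integral_sub (hLi.const_mul 2)
      (hBi.const_mul 2)]
    refine integral_mono ((hLi.const_mul 2).sub (hBi.const_mul 2))
      (integrable_weight_mul hφc.continuous pll) fun x => ?_
    have hp : 0 < φ (x 2) := carlemanWeight_pos _ _ _
    set b := 2 * ψ (x 2) * D (unitIdx 2) x + (2 * ψ (x 2) ^ 2 + 2 * lam) * D 0 x with hb
    have e : 2 * (lap D x * (P (x 2) * D (unitIdx 2) x - Q (x 2) * D 0 x)) - 2 * B x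
        = φ (x 2) * lap D x ^ 2 - φ (x 2) * ((lap D x + b) ^ 2 + b ^ 2) := by
      simp only [hB, hP, hQ, hb]; ring
    simp only
    rw [e]
    have : 0 ≤ φ (x 2) * ((lap D x + b) ^ 2 + b ^ 2) := by positivity
    linarith
  -- The integral of `2 Z u_z u + Z' u²` is zero. With this null form added, the quadratic form
  -- obtained from the integrations by parts is exactly `8λφ ((u_z + ψu)² + ψ²u²)`.
  have hzero := wint_first_mul_self h hb.trace hZc
  rw [dZ] at hzero
  have hident : 2 * (2 * wint R Q (fun x => D (unitIdx 2) x ^ 2)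
      + wint R Q' (fun x => D (unitIdx 2) x * D 0 x)) - 2 * (∫ x in cube R, B x)
      - 8 * lam * (∫ x in cube R, K x)
      = - (2 * wint R Z (fun x => D (unitIdx 2) x * D 0 x) + wint R Z' (fun x => D 0 x ^ 2)) := by
    unfold wint
    have j1 := integrable_weight_mul hQc.continuous (p11 2)
    have j2 := integrable_weight_mul hQ'c.continuous p10
    have j3 := integrable_weight_mul hZc.continuous p10
    have j4 := integrable_weight_mul hZ'c.continuous p00
    have j12 : Integrable (fun x => 2 * (Q (x 2) * D (unitIdx 2) x ^ 2)
        + Q' (x 2) * (D (unitIdx 2) x * D 0 x)) (volume.restrict (cube R)) :=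
      (j1.const_mul 2).add j2
    have j12B : Integrable (fun x => 2 * (2 * (Q (x 2) * D (unitIdx 2) x ^ 2)
        + Q' (x 2) * (D (unitIdx 2) x * D 0 x)) - 2 * B x) (volume.restrict (cube R)) :=
      (j12.const_mul 2).sub (hBi.const_mul 2)
    rw [← integral_const_mul 2, ← integral_add (j1.const_mul 2) j2, ← integral_const_mul 2,
      ← integral_const_mul 2, ← integral_sub (j12.const_mul 2)
      (hBi.const_mul 2), ← integral_const_mul, ← integral_sub j12B (hKi.const_mul _),
      ← integral_const_mul 2,
      ← integral_add (j3.const_mul 2) j4, ← integral_neg]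
    congr 1; ext x
    simp only [hB, hK, hQ, hQ', hZ, hZ']
    ring
  linarith

end

section
variable {R r lam : ℝ} {D : (Fin 3 → ℕ) → E3 → ℝ}

theorem deriv_carlemanWeight (r lam : ℝ) :
    deriv (carlemanWeight r lam) = fun s => 2 * (2 * lam * (s - r)) * carlemanWeight r lam s :=
  funext fun s => (hasDerivAt_carlemanWeight r lam s).deriv

theorem deriv_deriv_carlemanWeight (r lam : ℝ) : deriv (deriv (carlemanWeight r lam))
    = fun s => (4 * lam + 4 * (2 * lam * (s - r)) ^ 2) * carlemanWeight r lam s := by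
  rw [deriv_carlemanWeight]
  ext s
  refine (((hasDerivAt_psi r lam s).const_mul 2).mul (hasDerivAt_carlemanWeight r lam s)).deriv.trans
    ?_
  ring

theorem wint_mono {ρ σ : ℝ → ℝ} {F G : E3 → ℝ} (hρ : Continuous ρ) (hσ : Continuous σ)
    (hF : Integrable F (volume.restrict (cube R))) (hG : Integrable G (volume.restrict (cube R)))
    (h : ∀ x ∈ cube R, ρ (x 2) * F x ≤ σ (x 2) * G x) : wint R ρ F ≤ wint R σ G := by
  refine setIntegral_mono_on (integrable_weight_mul hρ hF) (integrable_weight_mul hσ hG)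
    (measurableSet_cube R) h

theorem wint_nonneg {ρ : ℝ → ℝ} {F : E3 → ℝ} (h : ∀ x, 0 ≤ ρ (x 2) * F x) : 0 ≤ wint R ρ F :=
  integral_nonneg h

theorem wint_const_mul (c : ℝ) (ρ : ℝ → ℝ) (F : E3 → ℝ) :
    wint R (fun s => c * ρ s) F = c * wint R ρ F := by
  unfold wint; rw [← integral_const_mul]; congr 1; ext x; ring

/-- Lower-order part of the Carleman estimate. -/
theorem carleman_zero (hR : 0 < R) (hr : R < r) (hl : 0 < lam) (h : IsSob3 R D)
    (hb : ZeroData R D) :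
    8 * lam * wint R (fun s => (2 * lam * (s - r)) ^ 2 * carlemanWeight r lam s)
      (fun x => D 0 x ^ 2) ≤ wint R (carlemanWeight r lam) (fun x => lap D x ^ 2) := by
  refine le_trans ?_ (carleman_first hR hr hl h hb)
  have hφc := (contDiff_carlemanWeight r lam).continuous
  have p00 := h.mem0.integrable_sq
  have p11 := (h.mem1 2).integrable_sq
  have p10 := memLp_two_mul_integrable (h.mem1 2) h.mem0
  gcongr 8 * lam * ?_
  refine integral_mono (integrable_weight_mul (ρ := fun s => (2 * lam * (s - r)) ^ 2 *
    carlemanWeight r lam s) (by fun_prop) p00) ?_ fun x => ?_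
  · have i1 := integrable_weight_mul (ρ := carlemanWeight r lam) hφc p11
    have i2 := integrable_weight_mul (ρ := fun s => 2 * (2 * lam * (s - r)) * carlemanWeight r lam s)
      (by fun_prop) p10
    have i3 := integrable_weight_mul (ρ := fun s => 2 * (2 * lam * (s - r)) ^ 2 *
      carlemanWeight r lam s) (by fun_prop) p00
    refine ((i1.add i2).add i3).congr (Eventually.of_forall fun x => ?_)
    simp only [Pi.add_apply]; ring
  · have hp := carlemanWeight_pos r lam (x 2)
    have : 0 ≤ carlemanWeight r lam (x 2) *
      (D (unitIdx 2) x + 2 * lam * (x 2 - r) * D 0 x) ^ 2 := by positivity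
    simp only; linarith

/-- The energy identity with weight `φ`: the cross term `φ' u_z u` becomes `-½ φ'' u²` by one more
integration by parts. It recovers the full gradient, of which `carleman_first` only sees the `z`
component. -/
theorem wint_lap_mul_self (h : IsSob3 R D) (hb : ZeroData R D) :
    wint R (carlemanWeight r lam) (fun x => lap D x * D 0 x)
      = - ∑ i, wint R (carlemanWeight r lam) (fun x => D (unitIdx i) x ^ 2)
        + wint R (fun s => (2 * lam + 2 * (2 * lam * (s - r)) ^ 2) * carlemanWeight r lam s)
          (fun x => D 0 x ^ 2) := by
  have hφ := contDiff_carlemanWeight r lam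
  have e0 := wint_second_mul_self h hb.trace hφ (i := 0) (by decide)
  have e1 := wint_second_mul_self h hb.trace hφ (i := 1) (by decide)
  have e2 := wint_second_mul_self_two h hb.trace hφ
  have e3 := wint_first_mul_self h hb.trace (contDiff_deriv hφ)
  rw [deriv_deriv_carlemanWeight] at e3
  have e4 : wint R (fun s => (4 * lam + 4 * (2 * lam * (s - r)) ^ 2) * carlemanWeight r lam s)
      (fun x => D 0 x ^ 2) = 2 * wint R (fun s => (2 * lam + 2 * (2 * lam * (s - r)) ^ 2) *
      carlemanWeight r lam s) (fun x => D 0 x ^ 2) := by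
    rw [← wint_const_mul]; congr 1; ext s; ring
  have e5 : wint R (carlemanWeight r lam) (fun x => lap D x * D 0 x)
      = ∑ i, wint R (carlemanWeight r lam) (fun x => D (unitIdx i + unitIdx i) x * D 0 x) := by
    unfold wint
    rw [← integral_finsetSum _ fun i _ => integrable_weight_mul hφ.continuous
      (memLp_two_mul_integrable (h.mem2 i i) h.mem0)]
    congr 1; ext x
    simp only [lap]
    rw [Finset.sum_mul, Finset.mul_sum]
  rw [e5, Fin.sum_univ_three, Fin.sum_univ_three, e0, e1, e2]
  linarith

/-- Each mixed product `u_ii u_jj` is traded for `u_ij²`. The weight depends on `z` alone, so `φ'`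
appears only for the pairs that contain the third direction. -/
theorem wint_lap_sq (h : IsSob3 R D) (hb : ZeroData R D) :
    wint R (carlemanWeight r lam) (fun x => lap D x ^ 2)
      = ∑ i, ∑ j, wint R (carlemanWeight r lam) (fun x => D (unitIdx i + unitIdx j) x ^ 2)
        + 2 * wint R (deriv (carlemanWeight r lam))
            (fun x => D (unitIdx 0) x * D (unitIdx 0 + unitIdx 2) x)
        + 2 * wint R (deriv (carlemanWeight r lam))
            (fun x => D (unitIdx 1) x * D (unitIdx 1 + unitIdx 2) x) := by
  have hφ := contDiff_carlemanWeight r lam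
  have e01 := wint_second_mul_second h hb.trace hφ (i := 0) (j := 1) (by decide) (by decide)
  have e02 := wint_second_mul_second h hb.trace hφ (i := 0) (j := 2) (by decide) (by decide)
  have e12 := wint_second_mul_second h hb.trace hφ (i := 1) (j := 2) (by decide) (by decide)
  have hn : (1 : Fin 3) ≠ 2 := by decide
  simp only [hn, if_false, if_true, add_zero] at e01 e02 e12
  have e5 : wint R (carlemanWeight r lam) (fun x => lap D x ^ 2)
      = ∑ i, ∑ j, wint R (carlemanWeight r lam)
        (fun x => D (unitIdx i + unitIdx i) x * D (unitIdx j + unitIdx j) x) := by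
    have hi : ∀ i j, Integrable (fun x => carlemanWeight r lam (x 2) *
        (D (unitIdx i + unitIdx i) x * D (unitIdx j + unitIdx j) x)) (volume.restrict (cube R)) :=
      fun i j => integrable_weight_mul hφ.continuous
        (memLp_two_mul_integrable (h.mem2 i i) (h.mem2 j j))
    unfold wint
    simp_rw [← integral_finsetSum _ fun j _ => hi _ j]
    rw [← integral_finsetSum _ fun i _ => integrable_finsetSum _ fun j _ => hi i j]
    congr 1; ext x
    simp only [lap]
    rw [sq, Finset.sum_mul_sum, Finset.mul_sum]
    simp_rw [Finset.mul_sum]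
  have hc : ∀ i j, wint R (carlemanWeight r lam) (fun x => D (unitIdx i + unitIdx i) x *
      D (unitIdx j + unitIdx j) x) = wint R (carlemanWeight r lam) (fun x =>
      D (unitIdx j + unitIdx j) x * D (unitIdx i + unitIdx i) x) := by
    intro i j; simp_rw [mul_comm]
  have hd : ∀ i j, wint R (carlemanWeight r lam) (fun x => D (unitIdx i + unitIdx j) x ^ 2)
      = wint R (carlemanWeight r lam) (fun x => D (unitIdx j + unitIdx i) x ^ 2) := by
    intro i j; rw [add_comm]
  rw [e5]
  simp only [Fin.sum_univ_three]
  rw [hc 1 0, hc 2 0, hc 2 1, e01, e02, e12, hd 1 0, hd 2 0, hd 2 1]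
  simp_rw [← sq]
  ring

end

/-- The Carleman estimate. -/
theorem exists_carleman {R r : ℝ} (hR : 0 < R) (hr : R < r) : ∃ C : ℝ, 0 < C ∧
    ∀ lam : ℝ, 1 ≤ lam → ∀ D : (Fin 3 → ℕ) → E3 → ℝ, IsSob3 R D → ZeroData R D →
      lam ^ 3 * wint R (carlemanWeight r lam) (fun x => D 0 x ^ 2)
          ≤ C * wint R (carlemanWeight r lam) (fun x => lap D x ^ 2) ∧
      lam * ∑ i, wint R (carlemanWeight r lam) (fun x => D (unitIdx i) x ^ 2)
          ≤ C * wint R (carlemanWeight r lam) (fun x => lap D x ^ 2) ∧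
      ∑ i, ∑ j, wint R (carlemanWeight r lam) (fun x => D (unitIdx i + unitIdx j) x ^ 2)
          ≤ C * (lam * wint R (carlemanWeight r lam) (fun x => lap D x ^ 2)) := by
  have hκ : 0 < (r - R) ^ 2 := by have : 0 < r - R := by linarith
                                  positivity
  -- The denominator comes from `8λ · 4λ² (r - R)²`, as `|z - r| ≥ r - R` on the cube. In `C₁` the
  -- one absorbs `A/2 + A/4`, and `3 C₀` absorbs the zeroth-order terms `(5/2) λ² H`.
  set C₀ : ℝ := 1 / (32 * (r - R) ^ 2) with hC₀
  have hC₀p : 0 < C₀ := by positivity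
  set C₁ : ℝ := 1 + 3 * C₀ with hC₁
  refine ⟨C₀ + C₁ + (2 + 32 * (R + r) ^ 2 * C₁), by positivity, fun lam hl D h hb => ?_⟩
  have hl0 : 0 < lam := by linarith
  have hφ := contDiff_carlemanWeight r lam
  have hφc := hφ.continuous
  have hφp := carlemanWeight_pos r lam
  set φ := carlemanWeight r lam with hφdef
  set A := wint R φ (fun x => lap D x ^ 2) with hA
  have hA0 : 0 ≤ A := wint_nonneg fun x => by have := hφp (x 2); positivity
  set H := wint R φ (fun x => D 0 x ^ 2) with hH
  have hH0 : 0 ≤ H := wint_nonneg fun x => by have := hφp (x 2); positivity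
  have p00 := h.mem0.integrable_sq
  have pll := h.memLp_lap.integrable_sq
  have plh := memLp_two_mul_integrable h.memLp_lap h.mem0
  have hz := carleman_zero hR hr hl0 h hb
  rw [← hφdef, ← hA] at hz
  set W := wint R (fun s => (2 * lam * (s - r)) ^ 2 * φ s) (fun x => D 0 x ^ 2) with hW
  -- zeroth order
  have b0 : 4 * lam ^ 2 * (r - R) ^ 2 * H ≤ W := by
    rw [hH, ← wint_const_mul]
    refine wint_mono (by fun_prop) (by fun_prop) p00 p00 fun x hx => ?_
    have hx2 := (abs_lt.1 (hx 2)).2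
    have := hφp (x 2)
    have h1 : (r - R) ^ 2 ≤ (x 2 - r) ^ 2 := by nlinarith
    have : 4 * lam ^ 2 * (r - R) ^ 2 ≤ (2 * lam * (x 2 - r)) ^ 2 := by
      rw [mul_pow, mul_pow]; norm_num; gcongr
    gcongr
  have B0 : lam ^ 3 * H ≤ C₀ * A := by
    have : 32 * (r - R) ^ 2 * (lam ^ 3 * H) ≤ A := by
      calc _ = 8 * lam * (4 * lam ^ 2 * (r - R) ^ 2 * H) := by ring
        _ ≤ 8 * lam * W := by gcongr
        _ ≤ A := hz
    rw [hC₀, one_div, inv_mul_eq_div, le_div_iff₀ (by positivity)]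
    linarith
  -- first order
  have hG := wint_lap_mul_self (r := r) (lam := lam) h hb
  rw [← hφdef] at hG
  set G := ∑ i, wint R φ (fun x => D (unitIdx i) x ^ 2) with hGdef
  have hG0 : 0 ≤ G := Finset.sum_nonneg fun i _ => wint_nonneg fun x => by
    have := hφp (x 2); positivity
  have e1 : wint R (fun s => (2 * lam + 2 * (2 * lam * (s - r)) ^ 2) * φ s) (fun x => D 0 x ^ 2)
      = 2 * lam * H + 2 * W := by
    rw [hH, hW, ← wint_const_mul, ← wint_const_mul, wint_add (by fun_prop) (by fun_prop) p00 p00]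
    unfold wint; congr 1; ext x; ring
  have e2 : - (lam * wint R φ (fun x => lap D x * D 0 x)) ≤ 1 / 2 * A + lam ^ 2 / 2 * H := by
    have e3 : - (lam * wint R φ (fun x => lap D x * D 0 x))
        = wint R (fun s => -lam * φ s) (fun x => lap D x * D 0 x) := by
      rw [wint_const_mul]; ring
    rw [e3, hA, hH, ← wint_const_mul, ← wint_const_mul, wint_add (by fun_prop) (by fun_prop) pll p00]
    refine integral_mono (integrable_weight_mul (ρ := fun s => -lam * φ s) (by fun_prop) plh)
      ((integrable_weight_mul (ρ := fun s => 1 / 2 * φ s) (by fun_prop) pll).add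
      (integrable_weight_mul (ρ := fun s => lam ^ 2 / 2 * φ s) (by fun_prop) p00))
      fun x => ?_
    have := hφp (x 2)
    have : 0 ≤ φ (x 2) * (lap D x + lam * D 0 x) ^ 2 := by positivity
    simp only; linarith
  have hll : lam ^ 2 * H ≤ lam ^ 3 * H := by
    have : lam ^ 2 ≤ lam ^ 3 := pow_le_pow_right₀ hl (by norm_num)
    gcongr
  have B1 : lam * G ≤ C₁ * A := by
    rw [e1] at hG
    have : lam * G = - (lam * wint R φ (fun x => lap D x * D 0 x))
        + 2 * (lam ^ 2 * H) + 2 * (lam * W) := by rw [hG]; ring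
    rw [this, hC₁]
    nlinarith
  -- second order
  have hS := wint_lap_sq (r := r) (lam := lam) h hb
  rw [← hφdef, ← hA] at hS
  have hcross : ∀ i, - (2 * wint R (deriv φ) (fun x => D (unitIdx i) x * D (unitIdx i + unitIdx 2) x))
      ≤ wint R φ (fun x => D (unitIdx i + unitIdx 2) x ^ 2)
        + 16 * lam ^ 2 * (R + r) ^ 2 * wint R φ (fun x => D (unitIdx i) x ^ 2) := by
    intro i
    have e3 : - (2 * wint R (deriv φ) (fun x => D (unitIdx i) x * D (unitIdx i + unitIdx 2) x))
        = wint R (fun s => -(4 * (2 * lam * (s - r))) * φ s)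
          (fun x => D (unitIdx i) x * D (unitIdx i + unitIdx 2) x) := by
      rw [← wint_const_mul, hφdef, deriv_carlemanWeight]
      unfold wint; rw [← integral_neg]; congr 1; ext x; ring
    have q1 := (h.mem1 i).integrable_sq
    have q2 := (h.mem2 i 2).integrable_sq
    have q3 := memLp_two_mul_integrable (h.mem1 i) (h.mem2 i 2)
    rw [e3, ← wint_const_mul, wint_add (by fun_prop) (by fun_prop) q2 q1]
    refine setIntegral_mono_on (integrable_weight_mul
      (ρ := fun s => -(4 * (2 * lam * (s - r))) * φ s) (by fun_prop) q3)
      ((integrable_weight_mul (ρ := φ) (by fun_prop) q2).add (integrable_weight_mul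
      (ρ := fun s => 16 * lam ^ 2 * (R + r) ^ 2 * φ s) (by fun_prop) q1))
      (measurableSet_cube R) fun x hx => ?_
    have hx2 := abs_lt.1 (hx 2)
    have hp := hφp (x 2)
    have h1 : (x 2 - r) ^ 2 ≤ (R + r) ^ 2 := by nlinarith
    have h2 : 0 ≤ φ (x 2) * (D (unitIdx i + unitIdx 2) x
      + 2 * (2 * lam * (x 2 - r)) * D (unitIdx i) x) ^ 2 := by positivity
    have h3 : 16 * lam ^ 2 * (x 2 - r) ^ 2 * φ (x 2) * D (unitIdx i) x ^ 2
      ≤ 16 * lam ^ 2 * (R + r) ^ 2 * φ (x 2) * D (unitIdx i) x ^ 2 := by gcongr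
    linarith
  have hd : ∀ i j, wint R φ (fun x => D (unitIdx i + unitIdx j) x ^ 2)
      = wint R φ (fun x => D (unitIdx j + unitIdx i) x ^ 2) := by
    intro i j; rw [add_comm]
  have hnn : ∀ i j, 0 ≤ wint R φ (fun x => D (unitIdx i + unitIdx j) x ^ 2) := fun i j =>
    wint_nonneg fun x => by have := hφp (x 2); positivity
  have hnn1 : ∀ i, 0 ≤ wint R φ (fun x => D (unitIdx i) x ^ 2) := fun i =>
    wint_nonneg fun x => by have := hφp (x 2); positivity
  have B2 : ∑ i, ∑ j, wint R φ (fun x => D (unitIdx i + unitIdx j) x ^ 2)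
      ≤ 2 * A + 32 * (lam ^ 2 * (R + r) ^ 2 * G) := by
    have c0 := hcross 0
    have c1 := hcross 1
    have hge : lam ^ 2 * (R + r) ^ 2 * (wint R φ (fun x => D (unitIdx 0) x ^ 2)
        + wint R φ (fun x => D (unitIdx 1) x ^ 2)) ≤ lam ^ 2 * (R + r) ^ 2 * G := by
      gcongr
      rw [hGdef, Fin.sum_univ_three]
      linarith [hnn1 2]
    have s02 := hd 2 0
    have s12 := hd 2 1
    have s01 := hd 1 0
    -- Each mixed derivative occurs twice in the full Hessian, so the cross terms absorb at most
    -- half of it. This explains the factors `2` and `32` in the second-order bound.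
    have key : 2 * (wint R φ (fun x => D (unitIdx 0 + unitIdx 2) x ^ 2)
      + wint R φ (fun x => D (unitIdx 1 + unitIdx 2) x ^ 2))
      ≤ ∑ i, ∑ j, wint R φ (fun x => D (unitIdx i + unitIdx j) x ^ 2) := by
      simp only [Fin.sum_univ_three]
      rw [s02, s12]
      linarith [hnn 0 0, hnn 0 1, hnn 1 0, hnn 1 1, hnn 2 2]
    linarith
  refine ⟨?_, ?_, ?_⟩
  · refine B0.trans ?_
    gcongr
    nlinarith [sq_nonneg (R + r), mul_nonneg (sq_nonneg (R + r)) (by positivity : 0 ≤ C₁)]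
  · refine B1.trans ?_
    gcongr
    nlinarith [sq_nonneg (R + r), mul_nonneg (sq_nonneg (R + r)) (by positivity : 0 ≤ C₁)]
  · have h1 : lam ^ 2 * (R + r) ^ 2 * G ≤ (R + r) ^ 2 * C₁ * (lam * A) := by
      calc _ = lam * (R + r) ^ 2 * (lam * G) := by ring
        _ ≤ lam * (R + r) ^ 2 * (C₁ * A) := by gcongr
        _ = _ := by ring
    have h2 : A ≤ lam * A := by nlinarith
    have h3 : 0 ≤ (C₀ + C₁) * (lam * A) := by positivity
    calc _ ≤ 2 * A + 32 * (lam ^ 2 * (R + r) ^ 2 * G) := B2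
      _ ≤ 2 * (lam * A) + 32 * ((R + r) ^ 2 * C₁ * (lam * A)) := by linarith
      _ ≤ _ := by linarith

/-! ### The coefficients of the quasilinear system -/

theorem contDiff_basisFn (a : ℝ) (n : ℕ) : ContDiff ℝ ∞ (basisFn a n) := by
  induction n using Nat.strong_induction_on with
  | _ n ih =>
    have h : ContDiff ℝ ∞ fun t : ℝ => t ^ n * Real.exp t
        - ∑ j : Fin n, (∫ s in (-a)..a, (s ^ n * Real.exp s) * basisFn a j s) * basisFn a j t := by
      refine (by fun_prop : ContDiff ℝ ∞ fun t : ℝ => t ^ n * Real.exp t).sub ?_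
      exact ContDiff.sum fun j _ => contDiff_const.mul (ih j j.2)
    rw [basisFn]
    exact h.div_const _

theorem continuous_basisFn (a : ℝ) (n : ℕ) : Continuous (basisFn a n) :=
  (contDiff_basisFn a n).continuous

theorem continuous_deriv_basisFn (a : ℝ) (n : ℕ) : Continuous (deriv (basisFn a n)) :=
  (contDiff_deriv (contDiff_basisFn a n)).continuous

theorem measurable_offset (d : ℝ) (i : Fin 3) :
    Measurable fun q : E3 × ℝ => offset d q.1 q.2 i := by
  fin_cases i <;> simp only [offset] <;> simp <;> fun_prop

theorem measurable_dist0 (d : ℝ) : Measurable fun q : E3 × ℝ => dist0 d q.1 q.2 := by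
  unfold dist0
  exact (Finset.measurable_fun_sum _ fun i _ => (measurable_offset d i).pow_const 2).sqrt

theorem measurable_xTilde (d k : ℝ) (i : Fin 3) :
    Measurable fun q : E3 × ℝ => xTilde d k q.1 q.2 i := by
  have h1 := measurable_offset d i
  have h2 := measurable_dist0 d
  unfold xTilde
  fun_prop

theorem measurable_xHat (d k : ℝ) (i : Fin 3) :
    Measurable fun q : E3 × ℝ => xHat d k q.1 q.2 i := by
  have h2 := measurable_dist0 d
  unfold xHat
  fin_cases i <;> simp <;> fun_prop

theorem sq_dist0 (d : ℝ) (x : E3) (t : ℝ) :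
    dist0 d x t ^ 2 = (x 0 - t) ^ 2 + x 1 ^ 2 + (x 2 + d) ^ 2 := by
  rw [dist0, Real.sq_sqrt (Finset.sum_nonneg fun i _ => sq_nonneg _), Fin.sum_univ_three]
  simp [offset]

/-- The sources lie in the plane `z = -d`, strictly below the cube. The coefficients built from
`xTilde` and `xHat` are therefore free of singularities and uniformly bounded on the cube. -/
theorem lt_dist0 {R d : ℝ} (hd : R < d) {x : E3} (hx : x ∈ cube R) (t : ℝ) :
    d - R < dist0 d x t := by
  have h := (abs_lt.1 (hx 2)).1
  refine lt_of_pow_lt_pow_left₀ 2 (Real.sqrt_nonneg _) ?_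
  rw [sq_dist0]
  nlinarith [sq_nonneg (x 0 - t), sq_nonneg (x 1)]

theorem abs_offset_le (d : ℝ) (x : E3) (t : ℝ) (i : Fin 3) : |offset d x t i| ≤ dist0 d x t := by
  refine Real.abs_le_sqrt ?_
  exact Finset.single_le_sum (f := fun i => offset d x t i ^ 2) (fun _ _ => sq_nonneg _)
    (Finset.mem_univ i)

theorem norm_xTilde_le {R d k : ℝ} (hd : R < d) (hk : 0 < k) {x : E3} (hx : x ∈ cube R) (t : ℝ)
    (i : Fin 3) : ‖xTilde d k x t i‖ ≤ k + (d - R)⁻¹ := by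
  have h0 : 0 < d - R := by linarith
  have h1 := lt_dist0 hd hx t
  have hp : 0 < dist0 d x t := h0.trans h1
  have h2 := abs_offset_le d x t i
  unfold xTilde
  refine (norm_sub_le _ _).trans (add_le_add ?_ ?_)
  · simp only [norm_div, norm_mul, Complex.norm_I, Complex.norm_real, one_mul, Real.norm_eq_abs,
      abs_of_pos hk, abs_of_pos hp]
    rw [div_le_iff₀ hp]; gcongr
  · simp only [norm_div, norm_pow, Complex.norm_real, Real.norm_eq_abs, abs_of_pos hp]
    rw [div_le_iff₀ (by positivity)]
    calc _ ≤ 1 * dist0 d x t := by rw [one_mul]; exact h2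
      _ ≤ ((d - R)⁻¹ * dist0 d x t) * dist0 d x t := by
          gcongr
          rw [← div_eq_inv_mul, one_le_div h0]; exact h1.le
      _ = _ := by ring

theorem norm_xHat_le {R d k : ℝ} (hd : R < d) (hk : 0 < k) {x : E3} (hx : x ∈ cube R) (t : ℝ)
    (i : Fin 3) : ‖xHat d k x t i‖ ≤ k * (d - R)⁻¹ + (d - R)⁻¹ ^ 2 := by
  have h0 : 0 < d - R := by linarith
  have h1 := lt_dist0 hd hx t
  have hp : 0 < dist0 d x t := h0.trans h1
  have h2 := sq_dist0 d x t
  have hinv : (dist0 d x t)⁻¹ ≤ (d - R)⁻¹ := by gcongr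
  have a1 : |(![-(x 1) ^ 2 - (x 2 + d) ^ 2, (x 0 - t) * x 1, (x 0 - t) * (x 2 + d)] :
        Fin 3 → ℝ) i| ≤ dist0 d x t ^ 2 := by
    rw [h2, abs_le]
    fin_cases i <;> simp <;> constructor <;>
      nlinarith [sq_nonneg (x 0 - t), sq_nonneg (x 1), sq_nonneg (x 2 + d),
        sq_nonneg (x 0 - t + x 1), sq_nonneg (x 0 - t - x 1), sq_nonneg (x 0 - t + (x 2 + d)),
        sq_nonneg (x 0 - t - (x 2 + d))]
  have a2 : |(![(x 0 - t) ^ 2 - (x 1) ^ 2 - (x 2 + d) ^ 2, 2 * (x 0 - t) * x 1,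
        2 * (x 0 - t) * (x 2 + d)] : Fin 3 → ℝ) i| ≤ dist0 d x t ^ 2 := by
    rw [h2, abs_le]
    fin_cases i <;> simp <;> constructor <;>
      nlinarith [sq_nonneg (x 0 - t), sq_nonneg (x 1), sq_nonneg (x 2 + d),
        sq_nonneg (x 0 - t + x 1), sq_nonneg (x 0 - t - x 1), sq_nonneg (x 0 - t + (x 2 + d)),
        sq_nonneg (x 0 - t - (x 2 + d))]
  unfold xHat
  refine (norm_sub_le _ _).trans (add_le_add ?_ ?_)
  · simp only [norm_div, norm_mul, norm_pow, Complex.norm_I, Complex.norm_real, one_mul,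
      Real.norm_eq_abs, abs_of_pos hk, abs_of_pos hp]
    calc _ ≤ k / dist0 d x t ^ 3 * dist0 d x t ^ 2 := by gcongr
      _ = k * (dist0 d x t)⁻¹ := by field_simp
      _ ≤ _ := by gcongr
  · simp only [norm_div, norm_mul, norm_pow, norm_one, Complex.norm_real,
      Real.norm_eq_abs, abs_of_pos hp]
    calc _ ≤ 1 / dist0 d x t ^ 4 * dist0 d x t ^ 2 := by gcongr
      _ = (dist0 d x t)⁻¹ ^ 2 := by field_simp
      _ ≤ _ := by gcongr

theorem measurable_integral_mul {g : ℝ → ℝ} (hg : Continuous g) (a : ℝ) (ha : 0 < a)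
    {K : E3 → ℝ → ℂ} (hK : Measurable fun q : E3 × ℝ => K q.1 q.2) :
    Measurable fun x => ∫ t in (-a)..a, (g t : ℂ) * K x t := by
  simp_rw [intervalIntegral.integral_of_le (by linarith : -a ≤ a)]
  have hg' := hg.measurable
  have : Measurable fun q : E3 × ℝ => (g q.2 : ℂ) * K q.1 q.2 := by fun_prop
  exact this.stronglyMeasurable.integral_prod_right.measurable

theorem exists_norm_integral_mul_le {g : ℝ → ℝ} (hg : Continuous g) (a : ℝ) (R β : ℝ)
    {K : E3 → ℝ → ℂ} (hb : ∀ x ∈ cube R, ∀ t, ‖K x t‖ ≤ β) :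
    ∃ C, ∀ x ∈ cube R, ‖∫ t in (-a)..a, (g t : ℂ) * K x t‖ ≤ C := by
  obtain ⟨G, hG⟩ := isCompact_uIcc.exists_bound_of_continuousOn (s := uIcc (-a) a) hg.continuousOn
  refine ⟨G * β * |a - -a|, fun x hx => ?_⟩
  refine intervalIntegral.norm_integral_le_of_norm_le_const fun t ht => ?_
  have h1 := hG t (uIoc_subset_uIcc ht)
  rw [norm_mul, Complex.norm_real]
  exact mul_le_mul h1 (hb x hx t) (norm_nonneg _) ((norm_nonneg _).trans h1)

theorem intervalIntegrable_mul_of_bound {g : ℝ → ℝ} (hg : Continuous g) (a : ℝ) {K : ℝ → ℂ}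
    (hK : Measurable K) {β : ℝ} (hb : ∀ t, ‖K t‖ ≤ β) :
    IntervalIntegrable (fun t => (g t : ℂ) * K t) volume (-a) a := by
  have h1 : IntervalIntegrable (fun t => (g t : ℂ)) volume (-a) a :=
    (Complex.continuous_ofReal.comp hg).intervalIntegrable _ _
  constructor
  · exact h1.1.mul_bdd (c := β) hK.aestronglyMeasurable (Eventually.of_forall hb)
  · exact h1.2.mul_bdd (c := β) hK.aestronglyMeasurable (Eventually.of_forall hb)

theorem integral_mul_sum {g : ℝ → ℝ} (hg : Continuous g) (a : ℝ) {K : ℝ → Fin 3 → ℂ}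
    (hK : ∀ i, Measurable fun t => K t i) {β : ℝ} (hb : ∀ i t, ‖K t i‖ ≤ β) (p : Fin 3 → ℂ) :
    ∫ t in (-a)..a, (g t : ℂ) * ∑ i, K t i * p i
      = ∑ i, (∫ t in (-a)..a, (g t : ℂ) * K t i) * p i := by
  simp_rw [Finset.mul_sum, ← mul_assoc]
  rw [intervalIntegral.integral_finsetSum fun i _ =>
    (intervalIntegrable_mul_of_bound hg a (hK i) (hb i)).mul_const (p i)]
  simp_rw [intervalIntegral.integral_mul_const]

/-- The nonlinearity is a quadratic polynomial in the gradient, with constant coefficients in the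
quadratic part and bounded coefficients in the linear part. -/
theorem exists_nonlinK_eq {R a d k : ℝ} {N : ℕ} (ha : 0 < a) (hd : R < d) (hk : 0 < k) :
    ∃ (c : Fin N → Fin N → Fin N → ℂ) (b : Fin N → Fin N → Fin 3 → E3 → ℂ) (β : ℝ), 0 ≤ β ∧
      (∀ m n i, Measurable (b m n i)) ∧ (∀ m n i, ∀ x ∈ cube R, ‖b m n i x‖ ≤ β) ∧
      ∀ x ∈ cube R, ∀ p m, nonlinK a d k N x p m
        = ∑ n, ∑ l, ∑ i, c m n l * (p n i * p l i) + ∑ n, ∑ i, b m n i x * p n i := by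
  set u : Fin N → Fin N → ℝ → ℝ := fun m n t => basisFn a m t * deriv (basisFn a n) t with hu
  set v : Fin N → Fin N → ℝ → ℝ := fun m n t => basisFn a m t * basisFn a n t with hv
  have huc : ∀ m n, Continuous (u m n) := fun m n =>
    (continuous_basisFn a m).mul (continuous_deriv_basisFn a n)
  have hvc : ∀ m n, Continuous (v m n) := fun m n =>
    (continuous_basisFn a m).mul (continuous_basisFn a n)
  set b₁ : Fin N → Fin N → Fin 3 → E3 → ℂ := fun m n i x =>
    ∫ t in (-a)..a, (u m n t : ℂ) * xTilde d k x t i with hb₁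
  set b₂ : Fin N → Fin N → Fin 3 → E3 → ℂ := fun m n i x =>
    ∫ t in (-a)..a, (v m n t : ℂ) * xHat d k x t i with hb₂
  have h0 : 0 < d - R := by linarith
  have e₁ : ∀ m n i, ∃ C, ∀ x ∈ cube R, ‖b₁ m n i x‖ ≤ C := fun m n i =>
    exists_norm_integral_mul_le (huc m n) a R (k + (d - R)⁻¹)
      fun x hx t => norm_xTilde_le hd hk hx t i
  have e₂ : ∀ m n i, ∃ C, ∀ x ∈ cube R, ‖b₂ m n i x‖ ≤ C := fun m n i =>
    exists_norm_integral_mul_le (hvc m n) a R (k * (d - R)⁻¹ + (d - R)⁻¹ ^ 2)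
      fun x hx t => norm_xHat_le hd hk hx t i
  have m₁ : ∀ m n i, Measurable (b₁ m n i) := fun m n i =>
    measurable_integral_mul (huc m n) a ha (measurable_xTilde d k i)
  have m₂ : ∀ m n i, Measurable (b₂ m n i) := fun m n i =>
    measurable_integral_mul (hvc m n) a ha (measurable_xHat d k i)
  -- The inverse matrix enters only as a table of constants; its invertibility plays no role in the
  -- structure of the nonlinearity.
  set s : Fin N → Fin N → ℂ := fun m n => (((matS a N)⁻¹ m n : ℝ) : ℂ) with hs
  set b : Fin N → Fin N → Fin 3 → E3 → ℂ := fun m n i x =>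
    ∑ m', s m m' * (2 * b₁ m' n i x + 2 * b₂ m' n i x) with hb
  have e : ∀ m n i, ∃ C, ∀ x ∈ cube R, ‖b m n i x‖ ≤ C := by
    intro m n i
    choose C₁ hC₁ using fun m' => e₁ m' n i
    choose C₂ hC₂ using fun m' => e₂ m' n i
    refine ⟨∑ m', ‖s m m'‖ * (2 * C₁ m' + 2 * C₂ m'), fun x hx => ?_⟩
    refine (norm_sum_le _ _).trans (Finset.sum_le_sum fun m' _ => ?_)
    rw [norm_mul]
    gcongr
    refine (norm_add_le _ _).trans ?_
    rw [norm_mul, norm_mul, Complex.norm_ofNat]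
    gcongr
    · exact hC₁ m' x hx
    · exact hC₂ m' x hx
  choose C hC using e
  refine ⟨fun m n l => ∑ m', s m m' * (2 * ((∫ t in (-a)..a, basisFn a m' t * basisFn a n t *
    deriv (basisFn a l) t : ℝ) : ℂ)), b, ∑ m, ∑ n, ∑ i, |C m n i|, by positivity, ?_, ?_, ?_⟩
  · intro m n i
    refine Finset.measurable_fun_sum _ fun m' _ => ?_
    have h1 := m₁ m' n i
    have h2 := m₂ m' n i
    fun_prop
  · intro m n i x hx
    refine (hC m n i x hx).trans ((le_abs_self _).trans ?_)
    refine (Finset.single_le_sum (f := fun i => |C m n i|) (fun _ _ => abs_nonneg _)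
      (Finset.mem_univ i)).trans ?_
    refine (Finset.single_le_sum (f := fun n => ∑ i, |C m n i|) (fun _ _ => by positivity)
      (Finset.mem_univ n)).trans ?_
    exact (Finset.single_le_sum (f := fun m => ∑ n, ∑ i, |C m n i|) (fun _ _ => by positivity)
      (Finset.mem_univ m))
  · intro x hx p m
    have hxt : ∀ i, Measurable fun t => xTilde d k x t i := fun i =>
      Measurable.of_uncurry_left (f := fun x t => xTilde d k x t i) (measurable_xTilde d k i)
    have hxh : ∀ i, Measurable fun t => xHat d k x t i := fun i =>
      Measurable.of_uncurry_left (f := fun x t => xHat d k x t i) (measurable_xHat d k i)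
    have i₁ : ∀ m n : Fin N, ∫ t in (-a)..a, ((basisFn a m t * deriv (basisFn a n) t : ℝ) : ℂ) *
        (∑ i, p n i * xTilde d k x t i) = ∑ i, b₁ m n i x * p n i := by
      intro m n
      rw [← integral_mul_sum (huc m n) a hxt (fun i t => norm_xTilde_le hd hk hx t i)]
      simp_rw [mul_comm (xTilde _ _ _ _ _)]
      rfl
    have i₂ : ∀ m n : Fin N, ∫ t in (-a)..a, ((basisFn a m t * basisFn a n t : ℝ) : ℂ) *
        (∑ i, xHat d k x t i * p n i) = ∑ i, b₂ m n i x * p n i := by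
      intro m n
      rw [← integral_mul_sum (hvc m n) a hxh (fun i t => norm_xHat_le hd hk hx t i)]
    have hF : ∀ m' : Fin N, nonlinF a d k N x p m' = ∑ n : Fin N, ∑ l : Fin N, ∑ i, 2 * ((∫ t in (-a)..a, basisFn a m' t *
        basisFn a n t * deriv (basisFn a l) t : ℝ) : ℂ) * (p n i * p l i)
        + ∑ n : Fin N, ∑ i, (2 * b₁ m' n i x + 2 * b₂ m' n i x) * p n i := by
      intro m'
      unfold nonlinF
      simp_rw [i₁, i₂]
      rw [add_assoc, Finset.mul_sum, Finset.mul_sum, Finset.mul_sum, ← Finset.sum_add_distrib]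
      congr 1
      · refine Finset.sum_congr rfl fun n _ => ?_
        rw [Finset.mul_sum]
        refine Finset.sum_congr rfl fun l _ => ?_
        rw [Finset.sum_mul, Finset.mul_sum]
        refine Finset.sum_congr rfl fun i _ => by ring
      · refine Finset.sum_congr rfl fun n _ => ?_
        rw [Finset.mul_sum, Finset.mul_sum, ← Finset.sum_add_distrib]
        refine Finset.sum_congr rfl fun i _ => by ring
    unfold nonlinK
    simp_rw [hF, mul_add, Finset.sum_add_distrib, Finset.sum_mul, Finset.mul_sum]
    congr 1
    · rw [Finset.sum_comm]
      refine Finset.sum_congr rfl fun n _ => ?_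
      rw [Finset.sum_comm]
      refine Finset.sum_congr rfl fun l _ => ?_
      rw [Finset.sum_comm]
      refine Finset.sum_congr rfl fun i _ => ?_
      refine Finset.sum_congr rfl fun m' _ => by simp only [hs]; ring
    · rw [Finset.sum_comm]
      refine Finset.sum_congr rfl fun n _ => ?_
      rw [Finset.sum_comm]
      refine Finset.sum_congr rfl fun i _ => ?_
      rw [Finset.sum_mul]
      refine Finset.sum_congr rfl fun m' _ => by simp only [hs]; ring

/-! ### Real and imaginary parts of elements of `H³` -/

theorem sq_norm_L2 {R : ℝ} (u : L2 R) : ‖u‖ ^ 2 = ∫ x in cube R, ‖u x‖ ^ 2 := by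
  rw [← real_inner_self_eq_norm_sq, L2.inner_def]
  simp_rw [real_inner_self_eq_norm_sq]

/-- The derivative `∂^α v_n`, or zero if `|α| > 3`. -/
def derivFn {R : ℝ} {N : ℕ} (V : H3 R N) (n : Fin N) (α : Fin 3 → ℕ) : E3 → ℂ :=
  if h : ∑ i, α i ≤ 3 then V.1 (n, ⟨α, mem_multiIndices.2 h⟩) else 0

/-- A real part of `∂^α v_n`, where `ℓ` is `re` or `im`. -/
def realFam {R : ℝ} {N : ℕ} (ℓ : ℂ →L[ℝ] ℝ) (V : H3 R N) (n : Fin N) (α : Fin 3 → ℕ) (x : E3) : ℝ :=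
  ℓ (derivFn V n α x)

section
variable {R : ℝ} {N : ℕ}

theorem derivFn_of_le (V : H3 R N) (n : Fin N) {α : Fin 3 → ℕ} (h : ∑ i, α i ≤ 3) :
    derivFn V n α = V.1 (n, ⟨α, mem_multiIndices.2 h⟩) := by
  rw [derivFn, dif_pos h]

theorem derivFn_zero (V : H3 R N) (n : Fin N) : derivFn V n 0 = comp V n :=
  derivFn_of_le V n (by simp)

theorem derivFn_unitIdx (V : H3 R N) (n : Fin N) (i : Fin 3) :
    derivFn V n (unitIdx i) = d1 V n i := derivFn_of_le V n (by simp)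

theorem derivFn_unitIdx_add (V : H3 R N) (n : Fin N) (i : Fin 3) :
    derivFn V n (unitIdx i + unitIdx i) = d2 V n i := by
  have : (unitIdx i + unitIdx i : Fin 3 → ℕ) = Pi.single i 2 := by
    rw [← Pi.single_add]
  rw [this]
  exact derivFn_of_le V n (by simp)

theorem norm_apply_le (V : H3 R N) (j : Fin N × multiIndices 3) : ‖V.1 j‖ ≤ ‖V‖ :=
  PiLp.norm_apply_le (V.1 : DerivFamily R N 3) j

theorem isSob3_realFam (ℓ : ℂ →L[ℝ] ℝ) (V : H3 R N) (n : Fin N) : IsSob3 R (realFam ℓ V n) := by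
  intro α i hα
  have h3 : ∑ j, (α + unitIdx i) j ≤ 3 := by
    simp only [Pi.add_apply, Finset.sum_add_distrib, unitIdx, Finset.sum_pi_single',
      Finset.mem_univ, if_true]
    omega
  have h3' : ∑ j, α j ≤ 3 := by omega
  unfold realFam
  rw [derivFn_of_le V n h3, derivFn_of_le V n h3']
  set u := V.1 (n, ⟨α, mem_multiIndices.2 h3'⟩) with hu
  set g := V.1 (n, ⟨α + unitIdx i, mem_multiIndices.2 h3⟩) with hg
  have hw : IsWeakDeriv R i u g := V.2 n i _ _ rfl
  refine ⟨ℓ.comp_memLp' (Lp.memLp u), ℓ.comp_memLp' (Lp.memLp g), fun φ hφ => ?_⟩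
  have h := congrArg ℓ (hw φ hφ)
  rw [map_neg, ← ℓ.integral_comp_comm (hφ.integrable_fderiv_smul _ u),
    ← ℓ.integral_comp_comm (hφ.integrable_smul g)] at h
  simp only [map_smul, smul_eq_mul] at h
  exact h

theorem nrm_le_norm {ℓ : ℂ →L[ℝ] ℝ} (hℓ : ∀ z, |ℓ z| ≤ ‖z‖) (u : L2 R) :
    nrm R (fun x => ℓ (u x)) ≤ ‖u‖ := by
  refine Real.sqrt_le_iff.2 ⟨norm_nonneg _, ?_⟩
  rw [sq_norm_L2]
  refine integral_mono (ℓ.comp_memLp' (Lp.memLp u)).integrable_sq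
    ((memLp_two_iff_integrable_sq_norm (Lp.memLp u).1).1 (Lp.memLp u)) fun x => ?_
  simp only
  rw [← sq_abs]
  have := hℓ (u x)
  gcongr

theorem nrm_realFam_le {ℓ : ℂ →L[ℝ] ℝ} (hℓ : ∀ z, |ℓ z| ≤ ‖z‖) (V : H3 R N) (n : Fin N)
    (α : Fin 3 → ℕ) : nrm R (realFam ℓ V n α) ≤ ‖V‖ := by
  unfold realFam
  by_cases h : ∑ i, α i ≤ 3
  · rw [derivFn_of_le V n h]
    exact (nrm_le_norm hℓ _).trans (norm_apply_le V _)
  · rw [derivFn, dif_neg h]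
    simp [nrm]

theorem abs_reCLM_le (z : ℂ) : |Complex.reCLM z| ≤ ‖z‖ := Complex.abs_re_le_norm z

theorem abs_imCLM_le (z : ℂ) : |Complex.imCLM z| ≤ ‖z‖ := Complex.abs_im_le_norm z

/-- The gradient of an element of `H³` is bounded. -/
theorem exists_norm_d1_le (hR : 0 < R) (N : ℕ) : ∃ C, 0 ≤ C ∧ ∀ (V : H3 R N) n i,
    ∀ᵐ x ∂(volume.restrict (cube R)), ‖d1 V n i x‖ ≤ C * ‖V‖ := by
  obtain ⟨C, hC0, hC⟩ := exists_ae_abs_le_of_HBound_two hR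
  have key : ∀ ℓ : ℂ →L[ℝ] ℝ, (∀ z, |ℓ z| ≤ ‖z‖) → ∀ (V : H3 R N) n i,
      ∀ᵐ x ∂(volume.restrict (cube R)), |realFam ℓ V n (unitIdx i) x| ≤ C * ‖V‖ := by
    intro ℓ hℓ V n i
    have h := isSob3_realFam ℓ V n
    refine hC _ _ ⟨⟨h.mem1 i, nrm_realFam_le hℓ V n _⟩, _, fun j => ⟨h.wd1 i j,
      ⟨h.mem2 i j, nrm_realFam_le hℓ V n _⟩, _, fun l => ⟨h.wd2 i j l, h.mem3 i j l,
        nrm_realFam_le hℓ V n _⟩⟩⟩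
  refine ⟨2 * C, by positivity, fun V n i => ?_⟩
  filter_upwards [key _ abs_reCLM_le V n i, key _ abs_imCLM_le V n i] with x h1 h2
  simp only [realFam, derivFn_unitIdx, Complex.reCLM_apply, Complex.imCLM_apply] at h1 h2
  refine (Complex.norm_le_abs_re_add_abs_im _).trans ?_
  linarith

/-! ### Boundary values -/

theorem HasBoundaryValue.sub {u v : L2 R} {S : Set E3} {ψ : E3 → ℂ} (hu : HasBoundaryValue u S ψ)
    (hv : HasBoundaryValue v S ψ) : HasBoundaryValue (u - v) S 0 := by
  obtain ⟨w, hw, hwe, hw0⟩ := hu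
  obtain ⟨w', hw', hwe', hw0'⟩ := hv
  refine ⟨w - w', hw.sub hw', ?_, fun x hx => ?_⟩
  · exact (Lp.coeFn_sub u v).trans (hwe.sub hwe')
  · rw [Pi.sub_apply, hw0 x hx, hw0' x hx, sub_self]; rfl

theorem mem_frontier_cube {x : E3} (hx : x ∈ closure (cube R)) {i : Fin 3}
    (hi : |x i| = R) : x ∈ frontier (cube R) := by
  refine ⟨hx, ?_⟩
  rw [(isOpen_cube R).interior_eq]
  exact fun h => (h i).ne hi

/-- The measurement face omits its edges. A point of the closed face is a limit of points of the
open one, obtained by shrinking the first two coordinates, and `w` is continuous. -/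
theorem eq_zero_of_measFace (hR : 0 < R) {w : E3 → ℝ} (hw : ContinuousOn w (closure (cube R)))
    (h0 : ∀ x ∈ measFace R, w x = 0) {x : E3} (hx : x ∈ closure (cube R)) (h2 : x 2 = -R) :
    w x = 0 := by
  have hxl := (mem_closure_cube hR).1 hx
  set y : ℝ → E3 := fun t => WithLp.toLp 2 ![(1 - t) * x 0, (1 - t) * x 1, x 2] with hy
  have hyc : Continuous y := by
    refine (PiLp.continuous_toLp 2 _).comp (continuous_pi fun i => ?_)
    fin_cases i <;> simp <;> fun_prop
  have hy0 : y 0 = x := by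
    ext i; fin_cases i <;> simp [hy]
  have hyt : ∀ t ∈ Ioo (0 : ℝ) 1, y t ∈ measFace R := by
    intro t ht
    have : ∀ l, |(1 - t) * x l| < R := by
      intro l
      rw [abs_mul, abs_of_pos (by linarith [ht.2])]
      have := hxl l
      nlinarith [ht.1, ht.2, abs_nonneg (x l)]
    exact ⟨by simpa [hy] using this 0, by simpa [hy] using this 1, by simpa [hy] using h2⟩
  have hmc : measFace R ⊆ closure (cube R) := by
    intro z hz
    rw [mem_closure_cube hR]
    intro l
    fin_cases l
    · exact hz.1.le
    · exact hz.2.1.le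
    · have := hz.2.2
      simp [this, abs_of_pos hR]
  have ht : Tendsto (fun t => w (y t)) (𝓝[>] 0) (𝓝 (w x)) := by
    have h1 : Tendsto y (𝓝[>] 0) (𝓝[closure (cube R)] x) := by
      refine tendsto_nhdsWithin_iff.2 ⟨?_, ?_⟩
      · rw [← hy0]; exact (hyc.tendsto 0).mono_left nhdsWithin_le_nhds
      · filter_upwards [Ioo_mem_nhdsGT (zero_lt_one' ℝ)] with t ht using hmc (hyt t ht)
    exact (hw x hx).tendsto.comp h1
  refine tendsto_nhds_unique (ht.congr' ?_) tendsto_const_nhds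
  filter_upwards [Ioo_mem_nhdsGT (zero_lt_one' ℝ)] with t ht using h0 _ (hyt t ht)

theorem zeroData_realFam (hR : 0 < R) (ℓ : ℂ →L[ℝ] ℝ) {V₁ V₂ : H3 R N}
    {ψ₀ ψ₁ : Fin N → E3 → ℂ} (h₁ : HasBoundaryData V₁ ψ₀ ψ₁) (h₂ : HasBoundaryData V₂ ψ₀ ψ₁)
    (n : Fin N) : ZeroData R (realFam ℓ (V₂ - V₁) n) := by
  have h := isSob3_realFam ℓ (V₂ - V₁) n
  constructor
  · intro i
    obtain ⟨w, hw, hwe, hw0⟩ := (h₂ n).1.sub (h₁ n).1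
    refine (h.wd0 i).zeroTrace hR (w := fun x => ℓ (w x)) (ℓ.continuous.comp_continuousOn hw)
      ?_ fun x hx hi => ?_
    · unfold realFam
      rw [derivFn_zero]
      filter_upwards [hwe] with x hx
      exact congrArg ℓ hx
    · rw [hw0 x (mem_frontier_cube hx hi)]; simp
  · obtain ⟨w, hw, hwe, hw0⟩ := (h₂ n).2.sub (h₁ n).2
    refine ⟨fun x => ℓ (w x), ℓ.continuous.comp_continuousOn hw, ?_, fun x hx h2 => ?_⟩
    · unfold realFam
      rw [derivFn_unitIdx]
      filter_upwards [hwe] with x hx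
      exact congrArg ℓ hx
    · refine eq_zero_of_measFace hR (w := fun x => ℓ (w x)) (ℓ.continuous.comp_continuousOn hw)
        (fun y hy => ?_) hx h2
      rw [hw0 y hy]; simp

end

/-! ### A weighted interpolation inequality -/

theorem exists_memLp_sq_nrm_sq_le {R : ℝ} (hR : 0 < R) : ∃ C, 0 ≤ C ∧
    ∀ (u : E3 → ℝ) (g : Fin 3 → E3 → ℝ) (S T : ℝ), (∀ i, HasWD R i u (g i)) → nrm R u ≤ S →
      (∀ i, nrm R (g i) ≤ T) → ∀ e, 0 < e → e ≤ 1 / 2 →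
      MemLp (fun x => u x ^ 2) 2 (volume.restrict (cube R)) ∧
      nrm R (fun x => u x ^ 2) ^ 2 ≤ C * (e⁻¹ ^ 3 * S ^ 4 + e * T ^ 4) := by
  obtain ⟨C, hC0, hC⟩ := exists_lintegral_pow_four_le hR
  refine ⟨C, hC0, fun u g S T hu hS hT e he he2 => ?_⟩
  have h := hC u g S T hu hS hT e he he2
  have hS0 : 0 ≤ S := (nrm_nonneg _ _).trans hS
  have hT0 : 0 ≤ T := (nrm_nonneg _ _).trans (hT 0)
  have hsm : AEStronglyMeasurable (fun x => u x ^ 2) (volume.restrict (cube R)) :=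
    (hu 0).memLp.1.pow 2
  have e4 : ∀ x, ‖u x ^ 2‖ₑ ^ 2 = ‖u x‖ₑ ^ 4 := fun x => by rw [enorm_pow, ← pow_mul]
  have hm : MemLp (fun x => u x ^ 2) 2 (volume.restrict (cube R)) := by
    refine ⟨hsm, ?_⟩
    refine (eLpNorm_lt_top_iff_lintegral_rpow_enorm_lt_top (by norm_num) (by norm_num)).2 ?_
    simp only [ENNReal.toReal_ofNat, ENNReal.rpow_ofNat, e4]
    exact h.trans_lt ENNReal.ofReal_lt_top
  refine ⟨hm, ?_⟩
  have h2 := lintegral_enorm_sq hm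
  simp only [e4] at h2
  rw [h2] at h
  exact (ENNReal.ofReal_le_ofReal_iff (by positivity)).1 h

theorem sq_carlemanWeight_half (r lam s : ℝ) :
    carlemanWeight r (lam / 2) s ^ 2 = carlemanWeight r lam s := by
  unfold carlemanWeight
  rw [← Real.exp_nat_mul]; congr 1; push_cast; ring

/-- Made for `g = |ΔV₁|`, which lies in `L⁴` but need not be bounded. With `q = √φ ∂ᵢu` and `A = ∫ φ
|Δu|²`, Cauchy–Schwarz twice gives `(∫ |g| q²)² ≤ ‖g²‖ ‖q²‖ ‖q‖²`. The Carleman estimate makes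
`‖q‖²` of order `A/λ`, and interpolation makes `‖q²‖` of order `√λ A`. The net gain is `λ^{-1/2}`
for the square. -/
theorem exists_weighted_cubic_le {R r : ℝ} (hR : 0 < R) (hr : R < r) : ∃ C : ℝ, 0 < C ∧
    ∀ lam : ℝ, 2 ≤ lam → ∀ D : (Fin 3 → ℕ) → E3 → ℝ, IsSob3 R D → ZeroData R D →
      ∀ g : E3 → ℝ, AEStronglyMeasurable g (volume.restrict (cube R)) →
        MemLp (fun x => g x ^ 2) 2 (volume.restrict (cube R)) → ∀ i,
      Integrable (fun x => |g x| * (carlemanWeight r lam (x 2) * D (unitIdx i) x ^ 2))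
        (volume.restrict (cube R)) ∧
      √lam * (∫ x in cube R, |g x| * (carlemanWeight r lam (x 2) * D (unitIdx i) x ^ 2)) ^ 2
        ≤ C * nrm R (fun x => g x ^ 2)
          * wint R (carlemanWeight r lam) (fun x => lap D x ^ 2) ^ 2 := by
  obtain ⟨C, hC0, hC⟩ := exists_carleman hR hr
  obtain ⟨K, hK0, hK⟩ := exists_memLp_sq_nrm_sq_le hR
  set C' : ℝ := 2 * C + 8 * (R + r) ^ 2 * C with hC'
  have hC'0 : 0 < C' := by positivity
  refine ⟨√(K * (C ^ 2 + C' ^ 2)) * C + 1, by positivity, fun lam hl D h hb g hg hg2 i => ?_⟩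
  obtain ⟨-, c1, c2⟩ := hC lam (by linarith) D h hb
  have hl0 : 0 < lam := by linarith
  have hφ := contDiff_carlemanWeight r lam
  have hφp := carlemanWeight_pos r lam
  have hec := contDiff_carlemanWeight r (lam / 2)
  have hep := carlemanWeight_pos r (lam / 2)
  have hee := sq_carlemanWeight_half r lam
  have hde := hasDerivAt_carlemanWeight r (lam / 2)
  set φ := carlemanWeight r lam with hφdef
  set e := carlemanWeight r (lam / 2) with hedef
  set A := wint R φ (fun x => lap D x ^ 2) with hA
  have hnn1 : ∀ i, 0 ≤ wint R φ (fun x => D (unitIdx i) x ^ 2) := fun i =>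
    wint_nonneg fun x => by have := hφp (x 2); positivity
  have hnn2 : ∀ i j, 0 ≤ wint R φ (fun x => D (unitIdx i + unitIdx j) x ^ 2) := fun i j =>
    wint_nonneg fun x => by have := hφp (x 2); positivity
  have hA0 : 0 ≤ A := wint_nonneg fun x => by have := hφp (x 2); positivity
  have d1 : lam * wint R φ (fun x => D (unitIdx i) x ^ 2) ≤ C * A := by
    refine le_trans ?_ c1
    gcongr
    exact Finset.single_le_sum (f := fun i => wint R φ (fun x => D (unitIdx i) x ^ 2))
      (fun i _ => hnn1 i) (Finset.mem_univ i)
  have d2 : ∀ j, wint R φ (fun x => D (unitIdx i + unitIdx j) x ^ 2) ≤ C * (lam * A) := by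
    intro j
    refine le_trans ?_ c2
    refine (Finset.single_le_sum (f := fun j => wint R φ (fun x => D (unitIdx i + unitIdx j) x ^ 2))
      (fun j _ => hnn2 i j) (Finset.mem_univ j)).trans ?_
    exact Finset.single_le_sum
      (f := fun i => ∑ j, wint R φ (fun x => D (unitIdx i + unitIdx j) x ^ 2))
      (fun i _ => Finset.sum_nonneg fun j _ => hnn2 i j) (Finset.mem_univ i)
  -- Here `e` is the weight with parameter `λ/2`, the square root of `φ`. Differentiating it costs a
  -- factor of order `λ`, so `‖∇q‖²` is of order `λ A`, the same order as the weighted Hessian.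
  set q : E3 → ℝ := fun x => e (x 2) * D (unitIdx i) x with hq
  have hwd := fun j => (h.wd1 i j).coord_mul hec 2
  have hqm : MemLp q 2 (volume.restrict (cube R)) := (hwd 0).memLp
  -- size of `q`
  have n0 : nrm R q ^ 2 = wint R φ (fun x => D (unitIdx i) x ^ 2) := by
    rw [sq_nrm]; unfold wint
    refine integral_congr_ae (Eventually.of_forall fun x => ?_)
    simp only [hq]; rw [mul_pow, hee]
  have S0 : nrm R q ≤ √(C / lam * A) := by
    refine Real.le_sqrt_of_sq_le ?_
    rw [n0, div_mul_eq_mul_div, le_div_iff₀ hl0, mul_comm]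
    exact d1
  have T0 : ∀ j, nrm R (fun x => e (x 2) * D (unitIdx i + unitIdx j) x
      + (if j = 2 then deriv e (x 2) else 0) * D (unitIdx i) x) ≤ √(C' * lam * A) := by
    intro j
    refine Real.le_sqrt_of_sq_le ?_
    have q1 := (h.mem1 i).integrable_sq
    have q2 := (h.mem2 i j).integrable_sq
    have hφc := hφ.continuous
    calc _ ≤ 2 * wint R φ (fun x => D (unitIdx i + unitIdx j) x ^ 2)
          + 8 * lam ^ 2 * (R + r) ^ 2 * wint R φ (fun x => D (unitIdx i) x ^ 2) := by
          rw [sq_nrm, ← wint_const_mul, ← wint_const_mul, wint_add (by fun_prop) (by fun_prop) q2 q1]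
          refine setIntegral_mono_on (hwd j).memLp_deriv.integrable_sq
            ((integrable_weight_mul (ρ := fun s => 2 * φ s) (by fun_prop) q2).add
            (integrable_weight_mul (ρ := fun s => 8 * lam ^ 2 * (R + r) ^ 2 * φ s)
              (by fun_prop) q1)) (measurableSet_cube R) fun x hx => ?_
          have hx2 := abs_lt.1 (hx 2)
          have h1 : (x 2 - r) ^ 2 ≤ (R + r) ^ 2 := by nlinarith
          have hp := hφp (x 2)
          have h3 : (if j = 2 then deriv e (x 2) else 0) ^ 2 ≤ 4 * lam ^ 2 * (R + r) ^ 2 * φ (x 2) := by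
            split_ifs
            · rw [(hde _).deriv, mul_pow, hee]
              have : (2 * (2 * (lam / 2) * (x 2 - r))) ^ 2 = 4 * lam ^ 2 * (x 2 - r) ^ 2 := by ring
              rw [this]; gcongr
            · rw [zero_pow two_ne_zero]; positivity
          set y := (if j = 2 then deriv e (x 2) else 0) with hy
          have h4 : y ^ 2 * D (unitIdx i) x ^ 2
            ≤ 4 * lam ^ 2 * (R + r) ^ 2 * φ (x 2) * D (unitIdx i) x ^ 2 := by gcongr
          have h5 : e (x 2) ^ 2 * D (unitIdx i + unitIdx j) x ^ 2
            = φ (x 2) * D (unitIdx i + unitIdx j) x ^ 2 := by rw [hee]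
          nlinarith [sq_nonneg (e (x 2) * D (unitIdx i + unitIdx j) x - y * D (unitIdx i) x)]
      _ = 2 * wint R φ (fun x => D (unitIdx i + unitIdx j) x ^ 2)
          + 8 * lam * (R + r) ^ 2 * (lam * wint R φ (fun x => D (unitIdx i) x ^ 2)) := by ring
      _ ≤ 2 * (C * (lam * A)) + 8 * lam * (R + r) ^ 2 * (C * A) := by gcongr; exact d2 j
      _ = C' * lam * A := by rw [hC']; ring
  -- At scale `1/λ` both contributions balance: `λ³ (A/λ)²` and `λ⁻¹ (λ A)²` are each `λ A²`. The
  -- condition `λ ≥ 2` puts the scale below `1/2`.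
  obtain ⟨m2, b2⟩ := hK q _ _ _ hwd S0 T0 lam⁻¹ (by positivity)
    (by rw [one_div]; gcongr)
  have b3 : nrm R (fun x => q x ^ 2) ^ 2 ≤ (√(K * (C ^ 2 + C' ^ 2)) * √lam * A) ^ 2 := by
    refine b2.trans (le_of_eq ?_)
    have s1 : √(C / lam * A) ^ 4 = (C / lam * A) ^ 2 := by
      rw [show 4 = 2 * 2 by norm_num, pow_mul, Real.sq_sqrt (by positivity)]
    have s2 : √(C' * lam * A) ^ 4 = (C' * lam * A) ^ 2 := by
      rw [show 4 = 2 * 2 by norm_num, pow_mul, Real.sq_sqrt (by positivity)]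
    have s3 : (√(K * (C ^ 2 + C' ^ 2)) * √lam * A) ^ 2
      = √(K * (C ^ 2 + C' ^ 2)) ^ 2 * √lam ^ 2 * A ^ 2 := by ring
    rw [s1, s2, s3, Real.sq_sqrt (by positivity), Real.sq_sqrt hl0.le]
    field_simp
  have b4 : nrm R (fun x => q x ^ 2) ≤ √(K * (C ^ 2 + C' ^ 2)) * √lam * A :=
    le_of_sq_le_sq b3 (by positivity)
  -- Cauchy–Schwarz
  have hgq2 : ∀ x, (|g x| * q x) ^ 2 = g x ^ 2 * q x ^ 2 := fun x => by rw [mul_pow, sq_abs]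
  have hgqm : MemLp (fun x => |g x| * q x) 2 (volume.restrict (cube R)) := by
    refine (memLp_two_iff_integrable_sq (hg.norm.mul hqm.1)).2 ?_
    refine (memLp_two_mul_integrable hg2 m2).congr (Eventually.of_forall fun x => ?_)
    exact (hgq2 x).symm
  have c3 : nrm R (fun x => |g x| * q x) ^ 2
      ≤ nrm R (fun x => g x ^ 2) * nrm R (fun x => q x ^ 2) := by
    rw [sq_nrm]
    simp_rw [hgq2]
    exact (le_abs_self _).trans (abs_setIntegral_mul_le hg2 m2)
  have c4 : (∫ x in cube R, |g x| * (φ (x 2) * D (unitIdx i) x ^ 2)) ^ 2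
      ≤ nrm R (fun x => |g x| * q x) ^ 2 * nrm R q ^ 2 := by
    rw [← mul_pow, ← sq_abs]
    have : ∫ x in cube R, |g x| * (φ (x 2) * D (unitIdx i) x ^ 2)
        = ∫ x in cube R, (|g x| * q x) * q x := by
      congr 1; ext x; rw [← hee]; simp only [hq]; ring
    rw [this]
    exact pow_le_pow_left₀ (abs_nonneg _) (abs_setIntegral_mul_le hgqm hqm) 2
  have hΓ := nrm_nonneg R (fun x => g x ^ 2)
  have hsl : 0 < √lam := Real.sqrt_pos.2 hl0
  constructor
  · refine (memLp_two_mul_integrable hgqm hqm).congr (Eventually.of_forall fun x => ?_)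
    simp only [hq, ← hee]; ring
  calc _ ≤ √lam * (nrm R (fun x => |g x| * q x) ^ 2 * nrm R q ^ 2) := by gcongr
    _ ≤ √lam * ((nrm R (fun x => g x ^ 2) * (√(K * (C ^ 2 + C' ^ 2)) * √lam * A))
          * nrm R q ^ 2) := by
        gcongr
        exact c3.trans (by gcongr)
    _ = nrm R (fun x => g x ^ 2) * √(K * (C ^ 2 + C' ^ 2)) * A * (√lam ^ 2 * nrm R q ^ 2) := by ring
    _ ≤ nrm R (fun x => g x ^ 2) * √(K * (C ^ 2 + C' ^ 2)) * A * (C * A) := by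
        rw [Real.sq_sqrt hl0.le, n0]; gcongr
    _ = √(K * (C ^ 2 + C' ^ 2)) * C * nrm R (fun x => g x ^ 2) * A ^ 2 := by ring
    _ ≤ _ := by gcongr; linarith

/-! ### The operator as a quadratic map into `L²` -/

theorem coeFn_finsetSum {α ι : Type*} [MeasurableSpace α] {μ : Measure α} {p : ENNReal}
    (s : Finset ι) (f : ι → Lp ℂ p μ) (g : ι → α → ℂ) (h : ∀ i, f i =ᵐ[μ] g i) :
    (∑ i ∈ s, f i : Lp ℂ p μ) =ᵐ[μ] fun x => ∑ i ∈ s, g i x := by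
  classical
  induction s using Finset.induction_on with
  | empty =>
    simp only [Finset.sum_empty]
    exact Lp.coeFn_zero ℂ p μ
  | insert i s hi ih =>
    rw [Finset.sum_insert hi]
    filter_upwards [Lp.coeFn_add (f i) (∑ i ∈ s, f i), ih, h i] with x h1 h2 h3
    rw [h1, Pi.add_apply, h2, h3, Finset.sum_insert hi]

/-- Multiplication by bounded functions. -/
def mulL (R : ℝ) : Lp ℂ ⊤ (volume.restrict (cube R)) →L[ℝ] L2 R →L[ℝ] L2 R :=
  (ContinuousLinearMap.mul ℝ ℂ).holderL (volume.restrict (cube R)) ⊤ 2 2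

section
variable {R : ℝ} {N : ℕ}

theorem coeFn_mulL (b : Lp ℂ ⊤ (volume.restrict (cube R))) (u : L2 R) :
    mulL R b u =ᵐ[volume.restrict (cube R)] fun x => b x * u x :=
  ContinuousLinearMap.coeFn_holder _ b u

/-- A measurable function that is bounded on the cube acts on `L²` by multiplication. -/
theorem exists_mul_clm {f : E3 → ℂ} (hf : Measurable f) {β : ℝ}
    (hb : ∀ x ∈ cube R, ‖f x‖ ≤ β) : ∃ T : L2 R →L[ℝ] L2 R, ∀ u : L2 R,
      T u =ᵐ[volume.restrict (cube R)] fun x => f x * u x := by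
  have hm : MemLp f ⊤ (volume.restrict (cube R)) := by
    refine memLp_top_of_bound hf.aestronglyMeasurable β ?_
    filter_upwards [ae_restrict_mem (measurableSet_cube R)] with x hx using hb x hx
  refine ⟨mulL R hm.toLp, fun u => ?_⟩
  filter_upwards [coeFn_mulL hm.toLp u, hm.coeFn_toLp] with x h1 h2
  rw [h1, h2]

/-- The map `V ↦ ∂^α v_n`. -/
def evalL (R : ℝ) (N : ℕ) (j : Fin N × multiIndices 3) : H3 R N →L[ℝ] L2 R :=
  (PiLp.proj 2 (fun _ : Fin N × multiIndices 3 => L2 R) j (𝕜 := ℝ)).comp (Sobolev R N 3).subtypeL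

/-- The map `V ↦ ∂ᵢ v_n`. -/
def d1L (R : ℝ) {N : ℕ} (n : Fin N) (i : Fin 3) : H3 R N →L[ℝ] L2 R :=
  evalL R N (n, ⟨Pi.single i 1, mem_multiIndices.2 (by simp)⟩)

/-- The map `V ↦ ∂ᵢ² v_n`. -/
def d2L (R : ℝ) {N : ℕ} (n : Fin N) (i : Fin 3) : H3 R N →L[ℝ] L2 R :=
  evalL R N (n, ⟨Pi.single i 2, mem_multiIndices.2 (by simp)⟩)

theorem d1L_apply (n : Fin N) (i : Fin 3) (V : H3 R N) : d1L R n i V = d1 V n i := rfl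

theorem d2L_apply (n : Fin N) (i : Fin 3) (V : H3 R N) : d2L R n i V = d2 V n i := rfl

/-- The gradient as a bounded map into `L^∞`. -/
theorem exists_gradient_clm (hR : 0 < R) (n : Fin N) (i : Fin 3) :
    ∃ P : H3 R N →L[ℝ] Lp ℂ ⊤ (volume.restrict (cube R)), ∀ V,
      P V =ᵐ[volume.restrict (cube R)] d1 V n i := by
  obtain ⟨C, hC0, hC⟩ := exists_norm_d1_le hR N
  have hm : ∀ V : H3 R N, MemLp (d1 V n i) ⊤ (volume.restrict (cube R)) := fun V =>
    memLp_top_of_bound (Lp.memLp _).1 _ (hC V n i)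
  let P : H3 R N →ₗ[ℝ] Lp ℂ ⊤ (volume.restrict (cube R)) :=
    { toFun := fun V => (hm V).toLp
      map_add' := fun V W => by
        refine Lp.ext ?_
        filter_upwards [(hm (V + W)).coeFn_toLp, (hm V).coeFn_toLp, (hm W).coeFn_toLp,
          Lp.coeFn_add (hm V).toLp (hm W).toLp, Lp.coeFn_add (d1 V n i) (d1 W n i)]
          with x h1 h2 h3 h4 h5
        rw [h1, h4, Pi.add_apply, h2, h3]
        exact h5
      map_smul' := fun t V => by
        refine Lp.ext ?_
        filter_upwards [(hm (t • V)).coeFn_toLp, (hm V).coeFn_toLp,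
          Lp.coeFn_smul t (hm V).toLp, Lp.coeFn_smul t (d1 V n i)] with x h1 h2 h4 h5
        rw [h1, RingHom.id_apply, h4, Pi.smul_apply, h2]
        exact h5 }
  refine ⟨P.mkContinuous C fun V => ?_, fun V => (hm V).coeFn_toLp⟩
  refine (Lp.norm_le_of_ae_bound (C := C * ‖V‖) (by positivity) ?_).trans ?_
  · filter_upwards [hC V n i, (hm V).coeFn_toLp] with x h1 h2
    exact (congrArg norm h2).trans_le h1
  · simp

/-- The weighted operator as a quadratic map. -/
theorem exists_quadratic_map (hR : 0 < R) {a d k : ℝ} {c : Fin N → Fin N → Fin N → ℂ}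
    {b : Fin N → Fin N → Fin 3 → E3 → ℂ} {β : ℝ} (hbm : ∀ m n i, Measurable (b m n i))
    (hb : ∀ m n i, ∀ x ∈ cube R, ‖b m n i x‖ ≤ β)
    (hL : ∀ x ∈ cube R, ∀ p m, nonlinK a d k N x p m
        = ∑ n, ∑ l, ∑ i, c m n l * (p n i * p l i) + ∑ n, ∑ i, b m n i x * p n i)
    {e : E3 → ℂ} (he : Measurable e) {ε : ℝ} (heb : ∀ x ∈ cube R, ‖e x‖ ≤ ε) (m : Fin N) :
    ∃ (A : H3 R N →L[ℝ] L2 R) (B : H3 R N →L[ℝ] H3 R N →L[ℝ] L2 R),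
      (∀ V, (A V + B V V : L2 R) =ᵐ[volume.restrict (cube R)] fun x => e x * opL a d k V x m) ∧
      ∀ V, B V V =ᵐ[volume.restrict (cube R)]
        fun x => e x * ∑ n, ∑ l, ∑ i, c m n l * (d1 V n i x * d1 V l i x) := by
  choose P hP using fun (n : Fin N) (i : Fin 3) => exists_gradient_clm (R := R) hR n i
  obtain ⟨E, hE⟩ := exists_mul_clm he heb
  have hT₁ : ∀ n i, ∃ T : L2 R →L[ℝ] L2 R, ∀ u : L2 R,
      T u =ᵐ[volume.restrict (cube R)] fun x => (e x * b m n i x) * u x := fun n i =>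
    exists_mul_clm (β := ε * β) (he.mul (hbm m n i)) fun x hx => by
      rw [norm_mul]
      exact mul_le_mul (heb x hx) (hb m n i x hx) (norm_nonneg _) ((norm_nonneg _).trans (heb x hx))
  choose T hT using hT₁
  have hT₂ : ∀ n l, ∃ S : L2 R →L[ℝ] L2 R, ∀ u : L2 R,
      S u =ᵐ[volume.restrict (cube R)] fun x => (e x * c m n l) * u x := fun n l =>
    exists_mul_clm (β := ε * ‖c m n l‖) (he.mul_const _) fun x hx => by
      rw [norm_mul]
      gcongr
      exact heb x hx
  choose S hS using hT₂
  -- In each product of two derivatives one factor is read in `L^∞` and the other in `L²`, which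
  -- makes the quadratic part bounded into `L²`.
  set B : H3 R N →L[ℝ] H3 R N →L[ℝ] L2 R :=
    ∑ n, ∑ l, ∑ i, (mulL R).bilinearComp (P n i) ((S n l).comp (d1L R l i)) with hB
  set A : H3 R N →L[ℝ] L2 R :=
    ∑ i, E.comp (d2L R m i) + ∑ n, ∑ i, (T n i).comp (d1L R n i) with hA
  have hBV : ∀ V, B V V =ᵐ[volume.restrict (cube R)]
        fun x => ∑ n, ∑ l, ∑ i, e x * (c m n l * (d1 V n i x * d1 V l i x)) := by
    intro V
    simp only [hB, _root_.sum_apply, ContinuousLinearMap.bilinearComp_apply,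
      ContinuousLinearMap.comp_apply, d1L_apply]
    refine coeFn_finsetSum _ _ _ fun n => coeFn_finsetSum _ _ _ fun l =>
      coeFn_finsetSum _ _ _ fun i => ?_
    filter_upwards [coeFn_mulL (P n i V) (S n l (d1 V l i)), hP n i V, hS n l (d1 V l i)]
      with x h1 h2 h3
    rw [h1, h2, h3]; ring
  have hAV : ∀ V, A V =ᵐ[volume.restrict (cube R)]
        fun x => ∑ i, e x * d2 V m i x + ∑ n, ∑ i, e x * b m n i x * d1 V n i x := by
    intro V
    simp only [hA, _root_.sum_apply, _root_.add_apply,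
      ContinuousLinearMap.comp_apply, d1L_apply, d2L_apply]
    refine (Lp.coeFn_add _ _).trans (EventuallyEq.add (coeFn_finsetSum _ _ _ fun i => hE _)
      (coeFn_finsetSum _ _ _ fun n => coeFn_finsetSum _ _ _ fun i => hT n i _))
  refine ⟨A, B, fun V => ?_, fun V => ?_⟩
  · filter_upwards [Lp.coeFn_add (A V) (B V V), hAV V, hBV V,
      ae_restrict_mem (measurableSet_cube R)] with x h1 h2 h3 hx
    rw [h1, Pi.add_apply, h2, h3, opL, hL x hx]
    simp only [mul_add, Finset.mul_sum]
    simp only [mul_assoc]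
    ring
  · filter_upwards [hBV V] with x h1
    rw [h1]
    simp only [Finset.mul_sum]

end

/-! ### Estimates for complex functions -/

/-- The Laplacian of `v_n`. -/
def lapC {R : ℝ} {N : ℕ} (V : H3 R N) (n : Fin N) (x : E3) : ℂ := ∑ i, d2 V n i x

section
variable {R : ℝ} {N : ℕ}

theorem nrm_add_le {u v : E3 → ℝ} (hu : MemLp u 2 (volume.restrict (cube R)))
    (hv : MemLp v 2 (volume.restrict (cube R))) :
    nrm R (fun x => u x + v x) ≤ nrm R u + nrm R v := by
  rw [nrm_eq_toReal hu, nrm_eq_toReal hv,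
    nrm_eq_toReal (u := fun x => u x + v x) (hu.add hv),
    ← ENNReal.toReal_add hu.2.ne hv.2.ne]
  exact ENNReal.toReal_mono (ENNReal.add_ne_top.2 ⟨hu.2.ne, hv.2.ne⟩)
    (eLpNorm_add_le hu.1 hv.1 (by norm_num))

theorem nrm_sum_le {ι : Type*} (s : Finset ι) {u : ι → E3 → ℝ}
    (hu : ∀ i, MemLp (u i) 2 (volume.restrict (cube R))) :
    nrm R (fun x => ∑ i ∈ s, u i x) ≤ ∑ i ∈ s, nrm R (u i) := by
  classical
  induction s using Finset.induction_on with
  | empty => simp [nrm]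
  | insert i s hi ih =>
    simp_rw [Finset.sum_insert hi]
    exact (nrm_add_le (hu i) (memLp_finsetSum s fun i _ => hu i)).trans (by gcongr)

theorem nrm_mono {u v : E3 → ℝ} (hu : MemLp u 2 (volume.restrict (cube R)))
    (hv : MemLp v 2 (volume.restrict (cube R))) (h : ∀ x, |u x| ≤ v x) : nrm R u ≤ nrm R v := by
  refine Real.sqrt_le_sqrt (integral_mono hu.integrable_sq hv.integrable_sq fun x => ?_)
  exact sq_le_sq' (neg_le_of_abs_le (h x)) (le_of_abs_le (h x))

theorem memLp_d1 (V : H3 R N) (n : Fin N) (i : Fin 3) :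
    MemLp (d1 V n i) 2 (volume.restrict (cube R)) := Lp.memLp _

theorem memLp_lapC (V : H3 R N) (n : Fin N) : MemLp (lapC V n) 2 (volume.restrict (cube R)) :=
  memLp_finsetSum _ fun _ _ => Lp.memLp _

theorem lap_realFam (ℓ : ℂ →L[ℝ] ℝ) (V : H3 R N) (n : Fin N) (x : E3) :
    lap (realFam ℓ V n) x = ℓ (lapC V n x) := by
  unfold lap realFam lapC
  rw [map_sum]
  refine Finset.sum_congr rfl fun i _ => ?_
  rw [derivFn_unitIdx_add]

theorem realFam_unitIdx (ℓ : ℂ →L[ℝ] ℝ) (V : H3 R N) (n : Fin N) (i : Fin 3) (x : E3) :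
    realFam ℓ V n (unitIdx i) x = ℓ (d1 V n i x) := by
  rw [realFam, derivFn_unitIdx]

theorem norm_sq_eq_re_im (z : ℂ) : ‖z‖ ^ 2 = Complex.reCLM z ^ 2 + Complex.imCLM z ^ 2 := by
  rw [Complex.sq_norm, Complex.normSq_apply]
  simp only [Complex.reCLM_apply, Complex.imCLM_apply]; ring

theorem integral_weight_norm_sq {ρ : ℝ → ℝ} (hρ : Continuous ρ) {f : E3 → ℂ}
    (hf : MemLp f 2 (volume.restrict (cube R))) :
    ∫ x in cube R, ρ (x 2) * ‖f x‖ ^ 2 = wint R ρ (fun x => Complex.reCLM (f x) ^ 2)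
      + wint R ρ (fun x => Complex.imCLM (f x) ^ 2) := by
  rw [wint_add (F := fun x => Complex.reCLM (f x) ^ 2) (G := fun x => Complex.imCLM (f x) ^ 2) hρ hρ
    (Complex.reCLM.comp_memLp' hf).integrable_sq (Complex.imCLM.comp_memLp' hf).integrable_sq]
  simp_rw [norm_sq_eq_re_im, mul_add]

/-- Second derivatives of elements of `H³` are in `L⁴`. -/
theorem exists_nrm_sq_lapC_le (hR : 0 < R) (N : ℕ) : ∃ C, 0 ≤ C ∧ ∀ (V : H3 R N) n,
    MemLp (fun x => ‖lapC V n x‖ ^ 2) 2 (volume.restrict (cube R)) ∧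
    nrm R (fun x => ‖lapC V n x‖ ^ 2) ≤ C * ‖V‖ ^ 2 := by
  obtain ⟨K, hK0, hK⟩ := exists_memLp_sq_nrm_sq_le hR
  have key : ∀ ℓ : ℂ →L[ℝ] ℝ, (∀ z, |ℓ z| ≤ ‖z‖) → ∀ (V : H3 R N) n i,
      MemLp (fun x => ℓ (d2 V n i x) ^ 2) 2 (volume.restrict (cube R)) ∧
      nrm R (fun x => ℓ (d2 V n i x) ^ 2) ≤ √(K * 9) * ‖V‖ ^ 2 := by
    intro ℓ hℓ V n i
    have h := isSob3_realFam ℓ V n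
    obtain ⟨h1, h2⟩ := hK _ _ ‖V‖ ‖V‖ (h.wd2 i i) (nrm_realFam_le hℓ V n _)
      (fun j => nrm_realFam_le hℓ V n _) (1 / 2) (by norm_num) le_rfl
    unfold realFam at h1 h2
    rw [derivFn_unitIdx_add] at h1 h2
    refine ⟨h1, le_of_sq_le_sq ?_ (by positivity)⟩
    rw [mul_pow, Real.sq_sqrt (by positivity)]
    refine h2.trans ?_
    nlinarith [mul_nonneg hK0 (by positivity : 0 ≤ ‖V‖ ^ 4)]
  refine ⟨3 * (6 * √(K * 9)), by positivity, fun V n => ?_⟩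
  set f : E3 → ℝ := fun x => 3 * ∑ i, (Complex.reCLM (d2 V n i x) ^ 2
    + Complex.imCLM (d2 V n i x) ^ 2) with hf
  have hre := key _ abs_reCLM_le V n
  have him := key _ abs_imCLM_le V n
  have hsum : MemLp (fun x => ∑ i, (Complex.reCLM (d2 V n i x) ^ 2
      + Complex.imCLM (d2 V n i x) ^ 2)) 2 (volume.restrict (cube R)) :=
    memLp_finsetSum _ fun i _ => (hre i).1.add (him i).1
  have hfm : MemLp f 2 (volume.restrict (cube R)) := hsum.const_mul 3
  have hle : ∀ x, |‖lapC V n x‖ ^ 2| ≤ f x := by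
    intro x
    rw [abs_of_nonneg (sq_nonneg _)]
    simp only [hf, ← norm_sq_eq_re_im]
    refine (pow_le_pow_left₀ (norm_nonneg _) (norm_sum_le _ _) 2).trans ?_
    have := sq_sum_le_card_mul_sum_sq (s := Finset.univ) (f := fun i => ‖d2 V n i x‖)
    simpa using this
  have hgm : MemLp (fun x => ‖lapC V n x‖ ^ 2) 2 (volume.restrict (cube R)) :=
    hfm.mono' ((memLp_lapC V n).1.norm.pow 2) (Eventually.of_forall fun x => hle x)
  refine ⟨hgm, (nrm_mono hgm hfm hle).trans ?_⟩
  have e1 : nrm R f = 3 * nrm R (fun x => ∑ i, (Complex.reCLM (d2 V n i x) ^ 2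
      + Complex.imCLM (d2 V n i x) ^ 2)) := by
    simp only [nrm, hf, mul_pow]
    rw [integral_const_mul, Real.sqrt_mul (by norm_num), Real.sqrt_sq (by norm_num)]
  rw [e1, mul_assoc]
  gcongr
  refine (nrm_sum_le _ fun i => (hre i).1.add (him i).1).trans ?_
  calc _ ≤ ∑ i : Fin 3, (√(K * 9) * ‖V‖ ^ 2 + √(K * 9) * ‖V‖ ^ 2) :=
        Finset.sum_le_sum fun i _ => (nrm_add_le (hre i).1 (him i).1).trans
          (add_le_add (hre i).2 (him i).2)
    _ = _ := by simp; ring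

/-- The Carleman estimate for the difference of two functions with the same boundary data. -/
theorem exists_carleman_sub {r : ℝ} (hR : 0 < R) (hr : R < r) (N : ℕ) : ∃ C : ℝ, 0 < C ∧
    ∀ lam : ℝ, 2 ≤ lam → ∀ (V₁ V₂ : H3 R N) (ψ₀ ψ₁ : Fin N → E3 → ℂ),
      HasBoundaryData V₁ ψ₀ ψ₁ → HasBoundaryData V₂ ψ₀ ψ₁ → ∀ n,
      (∀ i, lam * ∫ x in cube R, carlemanWeight r lam (x 2) * ‖d1 (V₂ - V₁) n i x‖ ^ 2
        ≤ C * ∫ x in cube R, carlemanWeight r lam (x 2) * ‖lapC (V₂ - V₁) n x‖ ^ 2) ∧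
      (∀ j : multiIndices 3, ∑ i, (j : Fin 3 → ℕ) i ≤ 2 → ‖(V₂ - V₁).1 (n, j)‖ ^ 2
        ≤ C * (lam * ∫ x in cube R, carlemanWeight r lam (x 2) * ‖lapC (V₂ - V₁) n x‖ ^ 2)) ∧
      ∀ (W : H3 R N) (m : Fin N) (i : Fin 3),
        Integrable (fun x => ‖lapC W m x‖ *
          (carlemanWeight r lam (x 2) * ‖d1 (V₂ - V₁) n i x‖ ^ 2)) (volume.restrict (cube R)) ∧
        ∀ η, 0 < η → C * ‖W‖ ^ 2 ≤ η ^ 2 * √lam →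
        ∫ x in cube R, ‖lapC W m x‖ * (carlemanWeight r lam (x 2) * ‖d1 (V₂ - V₁) n i x‖ ^ 2)
          ≤ η * ∫ x in cube R, carlemanWeight r lam (x 2) * ‖lapC (V₂ - V₁) n x‖ ^ 2 := by
  obtain ⟨C, hC0, hC⟩ := exists_carleman hR hr
  obtain ⟨K, hK0, hK⟩ := exists_weighted_cubic_le hR hr
  obtain ⟨L, hL0, hL⟩ := exists_nrm_sq_lapC_le hR N
  refine ⟨C + K * L, by positivity, fun lam hl V₁ V₂ ψ₀ ψ₁ h₁ h₂ n => ?_⟩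
  have hl0 : 0 < lam := by linarith
  have hφ := contDiff_carlemanWeight r lam
  have hφp := carlemanWeight_pos r lam
  set h := V₂ - V₁ with hh
  have hs := fun ℓ => isSob3_realFam ℓ h n
  have hz := fun ℓ => zeroData_realFam hR ℓ h₁ h₂ n
  obtain ⟨r0, r1, r2⟩ := hC lam (by linarith) _ (hs Complex.reCLM) (hz Complex.reCLM)
  obtain ⟨i0, i1, i2⟩ := hC lam (by linarith) _ (hs Complex.imCLM) (hz Complex.imCLM)
  have kr := hK lam hl _ (hs Complex.reCLM) (hz Complex.reCLM)
  have ki := hK lam hl _ (hs Complex.imCLM) (hz Complex.imCLM)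
  set φ := carlemanWeight r lam with hφdef
  have hA := integral_weight_norm_sq hφ.continuous (memLp_lapC h n)
  simp_rw [← lap_realFam] at hA
  set A := ∫ x in cube R, φ (x 2) * ‖lapC h n x‖ ^ 2 with hAdef
  set Ar := wint R φ (fun x => lap (realFam Complex.reCLM h n) x ^ 2) with hAr
  set Ai := wint R φ (fun x => lap (realFam Complex.imCLM h n) x ^ 2) with hAi
  have hwn : ∀ F : E3 → ℝ, 0 ≤ wint R φ (fun x => F x ^ 2) := fun F =>
    wint_nonneg fun x => by have := hφp (x 2); positivity
  have hAr0 : 0 ≤ Ar := hwn _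
  have hAi0 : 0 ≤ Ai := hwn _
  have hA0 : 0 ≤ A := by rw [hA]; positivity
  refine ⟨fun i => ?_, fun j hj => ?_, fun W m i => ?_⟩
  · rw [integral_weight_norm_sq hφ.continuous (memLp_d1 h n i)]
    simp_rw [← realFam_unitIdx]
    have s1 := Finset.single_le_sum (f := fun i => wint R φ (fun x =>
      realFam Complex.reCLM h n (unitIdx i) x ^ 2)) (fun i _ => hwn _) (Finset.mem_univ i)
    have s2 := Finset.single_le_sum (f := fun i => wint R φ (fun x =>
      realFam Complex.imCLM h n (unitIdx i) x ^ 2)) (fun i _ => hwn _) (Finset.mem_univ i)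
    calc _ ≤ lam * (∑ i, wint R φ (fun x => realFam Complex.reCLM h n (unitIdx i) x ^ 2)
        + ∑ i, wint R φ (fun x => realFam Complex.imCLM h n (unitIdx i) x ^ 2)) := by gcongr
      _ ≤ C * A := by rw [hA]; linarith
      _ ≤ _ := by gcongr; linarith [mul_nonneg hK0.le hL0]
  -- A multi-index of order at most two is zero, a unit, or a sum of two units; each case falls
  -- under one of the three Carleman bounds, the weakest being the one with the factor `λ`.
  · have main : ∀ α : Fin 3 → ℕ, ∑ i, α i ≤ 2 → ∀ ℓ : ℂ →L[ℝ] ℝ,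
        wint R φ (fun x => realFam ℓ h n α x ^ 2)
          ≤ C * (lam * wint R φ (fun x => lap (realFam ℓ h n) x ^ 2)) := by
      intro α hα ℓ
      obtain ⟨c0, c1, c2⟩ := hC lam (by linarith) _ (hs ℓ) (hz ℓ)
      rw [← hφdef] at c0 c1 c2
      have hB0 := hwn (lap (realFam ℓ h n))
      set B := wint R φ (fun x => lap (realFam ℓ h n) x ^ 2) with hB
      have hBl : C * B ≤ C * (lam * B) := by gcongr; nlinarith
      by_cases h0 : α = 0
      · subst h0
        have h1 : 1 ≤ lam ^ 3 := one_le_pow₀ (by linarith)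
        have := hwn (realFam ℓ h n 0)
        nlinarith
      obtain ⟨i, hi⟩ := Function.ne_iff.1 h0
      have hle : unitIdx i ≤ α := by
        intro l
        by_cases hl : l = i
        · subst hl; simpa [unitIdx] using Nat.one_le_iff_ne_zero.2 hi
        · simp [unitIdx, hl]
      obtain ⟨β, rfl⟩ := exists_add_of_le hle
      have hβ : ∑ l, β l ≤ 1 := by
        simp only [Pi.add_apply, Finset.sum_add_distrib, unitIdx, Finset.sum_pi_single',
          Finset.mem_univ, if_true] at hα
        omega
      by_cases h1 : β = 0
      · subst h1
        rw [add_zero]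
        have s1 := Finset.single_le_sum (f := fun i => wint R φ (fun x =>
          realFam ℓ h n (unitIdx i) x ^ 2)) (fun i _ => hwn _) (Finset.mem_univ i)
        have := hwn (realFam ℓ h n (unitIdx i))
        nlinarith
      obtain ⟨l, hl'⟩ := Function.ne_iff.1 h1
      have hβe : β = unitIdx l := by
        have hle : unitIdx l ≤ β := by
          intro l'
          by_cases hl : l' = l
          · subst hl; simpa [unitIdx] using Nat.one_le_iff_ne_zero.2 hl'
          · simp [unitIdx, hl]
        obtain ⟨δ, rfl⟩ := exists_add_of_le hle
        simp only [Pi.add_apply, Finset.sum_add_distrib, unitIdx, Finset.sum_pi_single',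
          Finset.mem_univ, if_true] at hβ
        have hδ : ∀ l, δ l = 0 := fun l => by
          have := Finset.single_le_sum (f := δ) (fun _ _ => Nat.zero_le _) (Finset.mem_univ l)
          omega
        ext l; simp [hδ]
      subst hβe
      refine le_trans ?_ c2
      refine (Finset.single_le_sum (f := fun l => wint R φ (fun x =>
        realFam ℓ h n (unitIdx i + unitIdx l) x ^ 2)) (fun _ _ => hwn _)
        (Finset.mem_univ l)).trans ?_
      exact Finset.single_le_sum (f := fun i => ∑ l, wint R φ (fun x =>
        realFam ℓ h n (unitIdx i + unitIdx l) x ^ 2))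
        (fun _ _ => Finset.sum_nonneg fun _ _ => hwn _) (Finset.mem_univ i)
    have hj3 : ∑ i, (j : Fin 3 → ℕ) i ≤ 3 := by omega
    have m1 : wint R φ (fun x => realFam Complex.reCLM h n j x ^ 2) ≤ C * (lam * Ar) :=
      main _ hj Complex.reCLM
    have m2 : wint R φ (fun x => realFam Complex.imCLM h n j x ^ 2) ≤ C * (lam * Ai) :=
      main _ hj Complex.imCLM
    have e1 : ‖h.1 (n, j)‖ ^ 2 ≤ ∫ x in cube R, φ (x 2) * ‖h.1 (n, j) x‖ ^ 2 := by
      rw [sq_norm_L2]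
      have hi : Integrable (fun x => ‖h.1 (n, j) x‖ ^ 2) (volume.restrict (cube R)) :=
        (memLp_two_iff_integrable_sq_norm (Lp.memLp _).1).1 (Lp.memLp _)
      refine integral_mono hi (integrable_weight_mul hφ.continuous hi) fun x => ?_
      -- The exponent of the weight is nonnegative, so the unweighted norm is bounded by the
      -- weighted one.
      have : 1 ≤ φ (x 2) := by
        rw [hφdef]; unfold carlemanWeight
        exact Real.one_le_exp (by positivity)
      exact le_mul_of_one_le_left (sq_nonneg _) this
    refine e1.trans ?_
    rw [integral_weight_norm_sq hφ.continuous (Lp.memLp _)]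
    unfold realFam at m1 m2
    rw [derivFn_of_le h n hj3] at m1 m2
    calc _ ≤ C * (lam * A) := by rw [hA]; linarith
      _ ≤ _ := by gcongr; linarith [mul_nonneg hK0.le hL0]
  · obtain ⟨gm, gb⟩ := hL W m
    have gs : AEStronglyMeasurable (fun x => ‖lapC W m x‖) (volume.restrict (cube R)) :=
      (memLp_lapC W m).1.norm
    obtain ⟨ir, br⟩ := kr _ gs gm i
    obtain ⟨ii, bi⟩ := ki _ gs gm i
    simp only [abs_norm, realFam_unitIdx] at ir br ii bi
    have hsplit : (fun x => ‖lapC W m x‖ * (φ (x 2) * ‖d1 h n i x‖ ^ 2))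
        = fun x => ‖lapC W m x‖ * (φ (x 2) * Complex.reCLM (d1 h n i x) ^ 2)
          + ‖lapC W m x‖ * (φ (x 2) * Complex.imCLM (d1 h n i x) ^ 2) := by
      ext x; rw [norm_sq_eq_re_im]; ring
    rw [hsplit]
    refine ⟨ir.add ii, fun η hη hle => ?_⟩
    rw [integral_add ir ii, hA]
    have hsl : 0 < √lam := Real.sqrt_pos.2 hl0
    have hKL : K * (L * ‖W‖ ^ 2) ≤ η ^ 2 * √lam := by
      have : 0 ≤ C * ‖W‖ ^ 2 := by positivity
      linarith
    have fin : ∀ I a : ℝ, 0 ≤ a → √lam * I ^ 2 ≤ K * nrm R (fun x => ‖lapC W m x‖ ^ 2) * a ^ 2 →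
        I ≤ η * a := by
      intro I a ha hI
      refine le_of_sq_le_sq (le_of_mul_le_mul_left (hI.trans ?_) hsl) (by positivity)
      calc _ ≤ K * (L * ‖W‖ ^ 2) * a ^ 2 := by gcongr
        _ ≤ (η ^ 2 * √lam) * a ^ 2 := by gcongr
        _ = _ := by ring
    rw [mul_add]
    exact add_le_add (fin _ _ hAr0 br) (fin _ _ hAi0 bi)

end

/-! ### Functionals given by squares of quadratic maps -/

section
variable {X Y ι : Type*} [NormedAddCommGroup X] [InnerProductSpace ℝ X] [NormedAddCommGroup Y]
  [InnerProductSpace ℝ Y] [Fintype ι]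

/-- The quadratic map `V ↦ A V + B(V, V)`. -/
def quadMap (A : X →L[ℝ] Y) (B : X →L[ℝ] X →L[ℝ] Y) (V : X) : Y := A V + B V V

theorem hasFDerivAt_quadMap (A : X →L[ℝ] Y) (B : X →L[ℝ] X →L[ℝ] Y) (V : X) :
    HasFDerivAt (quadMap A B) (A + (B V + B.flip V)) V := by
  have h := (A.hasFDerivAt (x := V)).add ((B.hasFDerivAt (x := V)).clm_apply (hasFDerivAt_id V))
  refine h.congr_fderiv ?_
  ext h; simp

theorem quadMap_sub (A : X →L[ℝ] Y) (B : X →L[ℝ] X →L[ℝ] Y) (V W : X) :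
    quadMap A B W - quadMap A B V
      = (A + (B V + B.flip V)) (W - V) + B (W - V) (W - V) := by
  simp [quadMap]; abel

/-- A functional of least-squares type. -/
def quadFun (E γ : ℝ) (A : ι → X →L[ℝ] Y) (B : ι → X →L[ℝ] X →L[ℝ] Y) (V : X) : ℝ :=
  E * (∑ m, ‖quadMap (A m) (B m) V‖ ^ 2) + γ * ‖V‖ ^ 2

theorem contDiff_quadFun (E γ : ℝ) (A : ι → X →L[ℝ] Y) (B : ι → X →L[ℝ] X →L[ℝ] Y) :
    ContDiff ℝ ∞ (quadFun E γ A B) := by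
  have h : ∀ m, ContDiff ℝ ∞ (quadMap (A m) (B m)) := fun m =>
    (A m).contDiff.add ((B m).contDiff.clm_apply contDiff_id)
  exact (contDiff_const.mul (ContDiff.sum fun m _ => (h m).norm_sq ℝ)).add
    (contDiff_const.mul (contDiff_id.norm_sq ℝ))

/-- For a quadratic map, `q(W) - q(V) = q'(V)(W - V) + B(W - V, W - V)` exactly. Expanding the
squared norms and removing the linear part leaves a remainder without error term. -/
theorem quadFun_taylor (E γ : ℝ) (A : ι → X →L[ℝ] Y) (B : ι → X →L[ℝ] X →L[ℝ] Y) (V W : X) :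
    quadFun E γ A B W - quadFun E γ A B V - fderiv ℝ (quadFun E γ A B) V (W - V)
      = E * (∑ m, (‖quadMap (A m) (B m) W - quadMap (A m) (B m) V‖ ^ 2
          + 2 * inner ℝ (quadMap (A m) (B m) V) (B m (W - V) (W - V)))) + γ * ‖W - V‖ ^ 2 := by
  have hd := ((HasFDerivAt.fun_sum (u := Finset.univ) fun m _ =>
    (hasFDerivAt_quadMap (A m) (B m) V).norm_sq).const_mul E).add
    ((hasFDerivAt_id V).norm_sq.const_mul γ)
  have hd' : fderiv ℝ (quadFun E γ A B) V (W - V)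
      = E * (∑ m, 2 * inner ℝ (quadMap (A m) (B m) V)
        ((A m + (B m V + (B m).flip V)) (W - V))) + γ * (2 * inner ℝ V (W - V)) := by
    rw [show fderiv ℝ (quadFun E γ A B) V = _ from hd.fderiv]
    simp [Finset.mul_sum, inner_add_right, mul_add]
  have hsq : ‖W‖ ^ 2 = ‖V‖ ^ 2 + 2 * inner ℝ V (W - V) + ‖W - V‖ ^ 2 := by
    rw [← norm_add_sq_real]; simp
  have hq : ∀ m, ‖quadMap (A m) (B m) W‖ ^ 2 = ‖quadMap (A m) (B m) V‖ ^ 2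
      + 2 * inner ℝ (quadMap (A m) (B m) V) ((A m + (B m V + (B m).flip V)) (W - V))
      + (‖quadMap (A m) (B m) W - quadMap (A m) (B m) V‖ ^ 2
          + 2 * inner ℝ (quadMap (A m) (B m) V) (B m (W - V) (W - V))) := by
    intro m
    have e1 := quadMap_sub (A m) (B m) V W
    have e2 : ‖quadMap (A m) (B m) W‖ ^ 2 = ‖quadMap (A m) (B m) V
      + (quadMap (A m) (B m) W - quadMap (A m) (B m) V)‖ ^ 2 := by simp
    rw [e2, norm_add_sq_real]
    nth_rw 1 [e1]
    rw [inner_add_right]; ring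
  rw [hd']
  unfold quadFun
  simp_rw [hq, hsq, Finset.sum_add_distrib]
  ring

end

/-! ### The nonlinearity -/

/-- The coefficients of the nonlinearity `K`. -/
structure SystemCoeff (R a d k : ℝ) (N : ℕ) where
  c : Fin N → Fin N → Fin N → ℂ
  b : Fin N → Fin N → Fin 3 → E3 → ℂ
  β : ℝ
  β_nonneg : 0 ≤ β
  measurable : ∀ m n i, Measurable (b m n i)
  norm_le : ∀ m n i, ∀ x ∈ cube R, ‖b m n i x‖ ≤ β
  norm_le' : ∀ m n l, ‖c m n l‖ ≤ β
  eq : ∀ x ∈ cube R, ∀ p m, nonlinK a d k N x p m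
        = ∑ n, ∑ l, ∑ i, c m n l * (p n i * p l i) + ∑ n, ∑ i, b m n i x * p n i

theorem nonempty_systemCoeff {R a d k : ℝ} (N : ℕ) (ha : 0 < a) (hd : R < d) (hk : 0 < k) :
    Nonempty (SystemCoeff R a d k N) := by
  obtain ⟨c, b, β, h0, h1, h2, h3⟩ := exists_nonlinK_eq (R := R) (N := N) ha hd hk
  obtain ⟨β', hβ'⟩ := (Set.finite_range fun q : Fin N × Fin N × Fin N =>
    ‖c q.1 q.2.1 q.2.2‖).bddAbove
  refine ⟨⟨c, b, max β β', h0.trans (le_max_left _ _), h1,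
    fun m n i x hx => (h2 m n i x hx).trans (le_max_left _ _),
    fun m n l => (hβ' ⟨(m, n, l), rfl⟩).trans (le_max_right _ _), h3⟩⟩

section
variable {R a d k : ℝ} {N : ℕ} (S : SystemCoeff R a d k N)

theorem sum_sum_norm_sq_le (p : Fin N → Fin 3 → ℂ) :
    (∑ n, ∑ i, ‖p n i‖) ^ 2 ≤ 3 * N * ∑ n, ∑ i, ‖p n i‖ ^ 2 := by
  have := sq_sum_le_card_mul_sum_sq (s := (Finset.univ : Finset (Fin N × Fin 3)))
    (f := fun q => ‖p q.1 q.2‖)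
  simp only [Fintype.sum_prod_type, Finset.card_univ, Fintype.card_prod, Fintype.card_fin] at this
  refine this.trans (le_of_eq ?_)
  push_cast; ring

theorem norm_quadratic_le (m : Fin N) (p : Fin N → Fin 3 → ℂ) :
    ‖∑ n, ∑ l, ∑ i, S.c m n l * (p n i * p l i)‖ ≤ S.β * N * ∑ n, ∑ i, ‖p n i‖ ^ 2 := by
  have h0 := S.β_nonneg
  calc _ ≤ ∑ n : Fin N, ∑ l : Fin N, ∑ i, S.β * ((‖p n i‖ ^ 2 + ‖p l i‖ ^ 2) / 2) := by
        refine (norm_sum_le _ _).trans (Finset.sum_le_sum fun n _ => ?_)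
        refine (norm_sum_le _ _).trans (Finset.sum_le_sum fun l _ => ?_)
        refine (norm_sum_le _ _).trans (Finset.sum_le_sum fun i _ => ?_)
        rw [norm_mul, norm_mul]
        refine mul_le_mul (S.norm_le' m n l) ?_ (by positivity) h0
        nlinarith [sq_nonneg (‖p n i‖ - ‖p l i‖)]
    _ = S.β * N * ∑ n, ∑ i, ‖p n i‖ ^ 2 := by
        simp_rw [← Finset.mul_sum, add_div, Finset.sum_add_distrib]
        simp only [Finset.sum_const, Finset.card_univ, Fintype.card_fin, nsmul_eq_mul]
        simp_rw [← Finset.mul_sum, ← Finset.sum_div]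
        ring

/-- A quadratic polynomial is Lipschitz on bounded sets: `q q - p p = q (q - p) + (q - p) p`. The
factor `2 N G` comes from the quadratic part, the `1` from the linear one. -/
theorem norm_nonlinK_sub_le {x : E3} (hx : x ∈ cube R) {p q : Fin N → Fin 3 → ℂ} {G : ℝ}
    (hp : ∀ n i, ‖p n i‖ ≤ G) (hq : ∀ n i, ‖q n i‖ ≤ G) (m : Fin N) :
    ‖nonlinK a d k N x q m - nonlinK a d k N x p m‖
      ≤ S.β * (2 * N * G + 1) * ∑ n, ∑ i, ‖q n i - p n i‖ := by
  have h0 := S.β_nonneg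
  have e : nonlinK a d k N x q m - nonlinK a d k N x p m
      = ∑ n, ∑ l, ∑ i, S.c m n l * (q n i * (q l i - p l i) + (q n i - p n i) * p l i)
        + ∑ n, ∑ i, S.b m n i x * (q n i - p n i) := by
    rw [S.eq x hx, S.eq x hx, add_sub_add_comm]
    simp_rw [← Finset.sum_sub_distrib]
    congr 1
    · refine Finset.sum_congr rfl fun n _ => Finset.sum_congr rfl fun l _ =>
        Finset.sum_congr rfl fun i _ => by ring
    · refine Finset.sum_congr rfl fun n _ => Finset.sum_congr rfl fun i _ => by ring
  rw [e]
  refine (norm_add_le _ _).trans ?_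
  have h1 : ‖∑ n, ∑ l, ∑ i, S.c m n l * (q n i * (q l i - p l i) + (q n i - p n i) * p l i)‖
      ≤ ∑ n : Fin N, ∑ l : Fin N, ∑ i, S.β * (G * (‖q l i - p l i‖ + ‖q n i - p n i‖)) := by
    refine (norm_sum_le _ _).trans (Finset.sum_le_sum fun n _ => ?_)
    refine (norm_sum_le _ _).trans (Finset.sum_le_sum fun l _ => ?_)
    refine (norm_sum_le _ _).trans (Finset.sum_le_sum fun i _ => ?_)
    rw [norm_mul]
    refine mul_le_mul (S.norm_le' m n l) ((norm_add_le _ _).trans ?_) (by positivity) h0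
    rw [norm_mul, norm_mul, mul_add, mul_comm ‖q n i - p n i‖]
    gcongr
    · exact hq n i
    · exact hp l i
  have h2 : ‖∑ n, ∑ i, S.b m n i x * (q n i - p n i)‖ ≤ ∑ n, ∑ i, S.β * ‖q n i - p n i‖ := by
    refine (norm_sum_le _ _).trans (Finset.sum_le_sum fun n _ => ?_)
    refine (norm_sum_le _ _).trans (Finset.sum_le_sum fun i _ => ?_)
    rw [norm_mul]
    gcongr
    exact S.norm_le m n i x hx
  refine (add_le_add h1 h2).trans (le_of_eq ?_)
  simp_rw [← Finset.mul_sum, Finset.sum_add_distrib]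
  simp only [Finset.sum_const, Finset.card_univ, Fintype.card_fin, nsmul_eq_mul]
  simp_rw [← Finset.mul_sum]
  ring

theorem nonlinK_zero (S : SystemCoeff R a d k N) {x : E3} (hx : x ∈ cube R) (m : Fin N) : nonlinK a d k N x 0 m = 0 := by
  rw [S.eq x hx]; simp

end

/-! ### Strict convexity of the weighted functional -/

section
variable {R r a d k : ℝ} {N : ℕ}

/-- The functional `J` is the square of the norm of a quadratic map. -/
theorem exists_J_eq (hR : 0 < R) (S : SystemCoeff R a d k N) (r lam : ℝ) :
    ∃ (A : Fin N → H3 R N →L[ℝ] L2 R) (B : Fin N → H3 R N →L[ℝ] H3 R N →L[ℝ] L2 R),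
      (∀ γ, (J r a d k lam γ : H3 R N → ℝ)
        = quadFun (Real.exp (-2 * lam * (R + r) ^ 2)) γ A B) ∧
      (∀ m (V : H3 R N), (quadMap (A m) (B m) V : L2 R) =ᵐ[volume.restrict (cube R)]
        fun x => (carlemanWeight r (lam / 2) (x 2) : ℂ) * opL a d k V x m) ∧
      ∀ m (V : H3 R N), B m V V =ᵐ[volume.restrict (cube R)]
        fun x => (carlemanWeight r (lam / 2) (x 2) : ℂ) *
          ∑ n, ∑ l, ∑ i, S.c m n l * (d1 V n i x * d1 V l i x) := by
  have hw : Continuous fun x : E3 => (carlemanWeight r (lam / 2) (x 2) : ℂ) :=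
    Complex.continuous_ofReal.comp ((contDiff_carlemanWeight r _).continuous.comp (by fun_prop))
  obtain ⟨ε, hε⟩ := (isCompact_closure_cube R).exists_bound_of_continuousOn hw.continuousOn
  choose A B hA hB using fun m => exists_quadratic_map hR S.measurable S.norm_le S.eq hw.measurable
    (fun x hx => hε x (subset_closure hx)) m
  refine ⟨A, B, fun γ => ?_, hA, hB⟩
  ext V
  have hn : ∀ m x, ‖(carlemanWeight r (lam / 2) (x 2) : ℂ) * opL a d k V x m‖ ^ 2
      = ‖opL a d k V x m‖ ^ 2 * carlemanWeight r lam (x 2) := by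
    intro m x
    rw [norm_mul, mul_pow, Complex.norm_real, Real.norm_eq_abs, sq_abs, sq_carlemanWeight_half,
      mul_comm]
  have hi : ∀ m, Integrable (fun x => ‖opL a d k V x m‖ ^ 2 * carlemanWeight r lam (x 2))
      (volume.restrict (cube R)) := by
    intro m
    refine ((memLp_two_iff_integrable_sq_norm (Lp.memLp _).1).1
      (Lp.memLp (quadMap (A m) (B m) V))).congr ?_
    filter_upwards [hA m V] with x hx
    rw [← hn, ← hx]; rfl
  unfold J quadFun
  congr 2
  simp_rw [Finset.sum_mul]
  rw [integral_finsetSum _ fun m _ => hi m]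
  refine Finset.sum_congr rfl fun m _ => ?_
  rw [sq_norm_L2]
  refine integral_congr_ae ?_
  filter_upwards [hA m V] with x hx
  rw [← hn, ← hx]; rfl

theorem norm_add_sq_ge (z w : ℂ) : 1 / 2 * ‖z‖ ^ 2 - ‖w‖ ^ 2 ≤ ‖z + w‖ ^ 2 := by
  have h : ‖z‖ ≤ ‖z + w‖ + ‖w‖ := by
    calc ‖z‖ = ‖(z + w) - w‖ := by simp
      _ ≤ _ := norm_sub_le _ _
  nlinarith [sq_nonneg (‖z + w‖ - ‖w‖), norm_nonneg z, norm_nonneg w, norm_nonneg (z + w)]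

theorem neg_mul_norm_le_inner (z w : ℂ) : -(‖z‖ * ‖w‖) ≤ inner ℝ z w :=
  neg_le_of_abs_le (abs_real_inner_le_norm z w)

/-- The remainder in the Taylor formula for `J`, bounded from below pointwise. -/
theorem remainder_pointwise (S : SystemCoeff R a d k N) {x : E3} (hx : x ∈ cube R) {G : ℝ}
    {p q : Fin N → Fin 3 → ℂ} (hp : ∀ n i, ‖p n i‖ ≤ G)
    (hq : ∀ n i, ‖q n i‖ ≤ G) (m : Fin N) (z z' : ℂ) :
    1 / 2 * ‖z' - z‖ ^ 2
      - (3 * N * (S.β * (2 * N * G + 1)) ^ 2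
          + 2 * (S.β * (2 * N * G + 1) * (3 * N * G)) * (S.β * N)) * ∑ n, ∑ i, ‖q n i - p n i‖ ^ 2
      - 2 * (S.β * N) * (‖z‖ * ∑ n, ∑ i, ‖q n i - p n i‖ ^ 2)
      ≤ ‖(z' + nonlinK a d k N x q m) - (z + nonlinK a d k N x p m)‖ ^ 2
        + 2 * inner ℝ (z + nonlinK a d k N x p m)
          (∑ n, ∑ l, ∑ i, S.c m n l * ((q n i - p n i) * (q l i - p l i))) := by
  have hβ := S.β_nonneg
  have hG : 0 ≤ G := (norm_nonneg _).trans (hp m 0)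
  set T := ∑ n, ∑ i, ‖q n i - p n i‖ ^ 2 with hT
  have hT0 : 0 ≤ T := by positivity
  set κ := S.β * (2 * N * G + 1) with hκ
  have hκ0 : 0 ≤ κ := by positivity
  have h1 : ‖nonlinK a d k N x q m - nonlinK a d k N x p m‖ ^ 2 ≤ κ ^ 2 * (3 * N * T) := by
    refine (pow_le_pow_left₀ (norm_nonneg _) (norm_nonlinK_sub_le S hx hp hq m) 2).trans ?_
    rw [mul_pow]
    gcongr
    exact sum_sum_norm_sq_le fun n i => q n i - p n i
  have h2 : ‖nonlinK a d k N x p m‖ ≤ κ * (3 * N * G) := by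
    have := norm_nonlinK_sub_le S hx (p := 0) (G := G) (fun _ _ => by simpa using hG) hp m
    rw [nonlinK_zero S hx, sub_zero] at this
    refine this.trans ?_
    gcongr
    calc ∑ n, ∑ i, ‖p n i - (0 : Fin N → Fin 3 → ℂ) n i‖ ≤ ∑ n : Fin N, ∑ i : Fin 3, G :=
          Finset.sum_le_sum fun n _ => Finset.sum_le_sum fun i _ => by simpa using hp n i
      _ = _ := by simp; ring
  have h3 := norm_quadratic_le S m fun n i => q n i - p n i
  have h4 := neg_mul_norm_le_inner (z + nonlinK a d k N x p m)
          (∑ n, ∑ l, ∑ i, S.c m n l * ((q n i - p n i) * (q l i - p l i)))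
  have h5 : ‖z + nonlinK a d k N x p m‖ ≤ ‖z‖ + κ * (3 * N * G) :=
    (norm_add_le _ _).trans (by gcongr)
  have h6 := norm_add_sq_ge (z' - z) (nonlinK a d k N x q m - nonlinK a d k N x p m)
  rw [sub_add_sub_comm] at h6
  have h7 := mul_le_mul h5 h3 (norm_nonneg _) ((norm_nonneg _).trans h5)
  rw [← hT] at h7
  -- The factor `½` on `‖z' - z‖²` pays for separating the difference of the nonlinearities, which
  -- costs `3 N κ² T`. The inner product costs at most twice the norm of `z + K(p)` times `β N T`.
  nlinarith

theorem lapC_sub_ae (V W : H3 R N) (n : Fin N) :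
    ∀ᵐ x ∂(volume.restrict (cube R)), lapC (W - V) n x = lapC W n x - lapC V n x := by
  have h : ∀ i, ∀ᵐ x ∂(volume.restrict (cube R)), d2 (W - V) n i x = d2 W n i x - d2 V n i x :=
    fun i => Lp.coeFn_sub (d2 W n i) (d2 V n i)
  filter_upwards [ae_all_iff.2 h] with x hx
  unfold lapC
  simp_rw [hx, Finset.sum_sub_distrib]

theorem d1_sub_ae (V W : H3 R N) :
    ∀ᵐ x ∂(volume.restrict (cube R)), ∀ n i, d1 (W - V) n i x = d1 W n i x - d1 V n i x :=
  ae_all_iff.2 fun n => ae_all_iff.2 fun i => Lp.coeFn_sub (d1 W n i) (d1 V n i)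

set_option maxHeartbeats 1000000 in
/-- Strict convexity between points with the same boundary data. -/
theorem exists_convexity_of_boundaryData (hR : 0 < R) (hr : R < r)
    (S : SystemCoeff R a d k N) (M : ℝ) (hM : 0 < M) : ∃ Λ : ℝ, 1 < Λ ∧ ∀ lam : ℝ, Λ ≤ lam →
      ∃ c : ℝ, 0 < c ∧ ∀ (γ : ℝ) (ψ₀ ψ₁ : Fin N → E3 → ℂ) (V₁ V₂ : H3 R N),
        V₁ ∈ setB R N M ψ₀ ψ₁ → V₂ ∈ setB R N M ψ₀ ψ₁ →
        c * normH2 (V₂ - V₁) ^ 2 + γ * ‖V₂ - V₁‖ ^ 2 ≤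
            J r a d k lam γ V₂ - J r a d k lam γ V₁
              - fderiv ℝ (J r a d k lam γ : H3 R N → ℝ) V₁ (V₂ - V₁) := by
  obtain ⟨C, hC0, hC⟩ := exists_carleman_sub hR hr N
  obtain ⟨D, hD0, hD⟩ := exists_norm_d1_le hR N
  have hβ := S.β_nonneg
  set G := D * M with hG
  have hG0 : 0 ≤ G := by positivity
  set κ₁ := 3 * N * (S.β * (2 * N * G + 1)) ^ 2
          + 2 * (S.β * (2 * N * G + 1) * (3 * N * G)) * (S.β * N) with hκ₁
  have hκ₁0 : 0 ≤ κ₁ := by positivity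
  set κ₂ := 2 * (S.β * N) with hκ₂
  have hκ₂0 : 0 ≤ κ₂ := by positivity
  -- Chosen so that the terms with `|ΔV₁|`, summed over `m` and the three directions, use at most
  -- one eighth of the total of the `Q n`. The `+ 1` keeps the denominator positive.
  set η := 1 / (24 * (N * κ₂ + 1)) with hη
  have hη0 : 0 < η := by positivity
  -- The `2` meets the requirement `λ ≥ 2` of the Carleman bounds, the second summand absorbs the
  -- gradient terms, and the third ensures `C M² ≤ η² √λ`, as needed for the cubic terms.
  refine ⟨2 + 24 * N * κ₁ * C + (C * M ^ 2 / η ^ 2) ^ 2, by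
    have : 0 ≤ 24 * N * κ₁ * C := by positivity
    nlinarith [sq_nonneg (C * M ^ 2 / η ^ 2)], fun lam hl => ?_⟩
  have t1 : 0 ≤ 24 * N * κ₁ * C := by positivity
  have t2 : 0 ≤ (C * M ^ 2 / η ^ 2) ^ 2 := by positivity
  have hl2 : 2 ≤ lam := by linarith
  have hl0 : 0 < lam := by linarith
  have hlC : 24 * N * κ₁ * C ≤ lam := by linarith
  have hls : C * M ^ 2 ≤ η ^ 2 * √lam := by
    have : C * M ^ 2 / η ^ 2 ≤ √lam := Real.le_sqrt_of_sq_le (by linarith)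
    rwa [div_le_iff₀ (by positivity), mul_comm √lam] at this
  set E := Real.exp (-2 * lam * (R + r) ^ 2) with hE
  have hE0 : 0 < E := Real.exp_pos _
  set cd : ℝ := (Fintype.card (multiIndices 3) : ℝ) + 1 with hcd
  have hcd0 : 0 < cd := by positivity
  -- `normH2² ≤ cd C λ ∑ Q` and the remainder is at least `E ∑ Q / 4`. The constant depends on `λ`
  -- but on neither `γ` nor the boundary data.
  refine ⟨E / (4 * cd * C * lam), by positivity, fun γ ψ₀ ψ₁ V₁ V₂ h₁ h₂ => ?_⟩
  obtain ⟨A, B, hJ, hq, hB⟩ := exists_J_eq hR S r lam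
  have hC' := hC lam hl2 V₁ V₂ ψ₀ ψ₁ h₁.2 h₂.2
  rw [hJ, quadFun_taylor, ← hE]
  have hφ := contDiff_carlemanWeight r lam
  have hφp := carlemanWeight_pos r lam
  have hee := sq_carlemanWeight_half r lam
  set φ := carlemanWeight r lam with hφdef
  set h := V₂ - V₁ with hh
  set Q : Fin N → ℝ := fun n => ∫ x in cube R, φ (x 2) * ‖lapC h n x‖ ^ 2 with hQ
  have hQ0 : ∀ n, 0 ≤ Q n := fun n => integral_nonneg fun x => by
    have := hφp (x 2); simp only [Pi.zero_apply]; positivity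
  have hQ0' : 0 ≤ ∑ n, Q n := Finset.sum_nonneg fun n _ => hQ0 n
  -- the `H²` norm
  have hH2 : normH2 h ^ 2 ≤ cd * C * lam * ∑ n, Q n := by
    rw [normH2, Real.sq_sqrt (Finset.sum_nonneg fun j _ => by positivity)]
    rw [Fintype.sum_prod_type]
    calc _ ≤ ∑ n : Fin N, ∑ j : multiIndices 3, C * (lam * Q n) := by
          refine Finset.sum_le_sum fun n _ => Finset.sum_le_sum fun j _ => ?_
          have := hQ0 n
          split_ifs with hj
          · exact (hC' n).2.1 j hj
          · positivity
      _ = Fintype.card (multiIndices 3) * C * lam * ∑ n, Q n := by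
          simp only [Finset.sum_const, Finset.card_univ, nsmul_eq_mul]
          rw [Finset.mul_sum]
          refine Finset.sum_congr rfl fun n _ => by ring
      _ ≤ _ := by gcongr; linarith
  -- the remainder
  have hrem : ∀ m, 1 / 2 * Q m - κ₁ * (∑ n : Fin N, ∑ _i : Fin 3, C / lam * Q n)
      - κ₂ * (∑ n : Fin N, ∑ _i : Fin 3, η * Q n)
      ≤ ‖quadMap (A m) (B m) V₂ - quadMap (A m) (B m) V₁‖ ^ 2
          + 2 * inner ℝ (quadMap (A m) (B m) V₁) (B m h h) := by
    intro m
    have i0 : Integrable (fun x => φ (x 2) * ‖lapC h m x‖ ^ 2) (volume.restrict (cube R)) :=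
      integrable_weight_mul hφ.continuous
        ((memLp_two_iff_integrable_sq_norm (memLp_lapC h m).1).1 (memLp_lapC h m))
    have i1 : ∀ n i, Integrable (fun x => φ (x 2) * ‖d1 h n i x‖ ^ 2)
        (volume.restrict (cube R)) := fun n i =>
      integrable_weight_mul hφ.continuous
        ((memLp_two_iff_integrable_sq_norm (memLp_d1 h n i).1).1 (memLp_d1 h n i))
    have i2 : ∀ n i, Integrable (fun x => ‖lapC V₁ m x‖ * (φ (x 2) * ‖d1 h n i x‖ ^ 2))
        (volume.restrict (cube R)) := fun n i => ((hC' n).2.2 V₁ m i).1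
    have I1 : Integrable (fun x => ∑ n, ∑ i, φ (x 2) * ‖d1 h n i x‖ ^ 2)
        (volume.restrict (cube R)) :=
      integrable_finsetSum _ fun n _ => integrable_finsetSum _ fun i _ => i1 n i
    have I2 : Integrable (fun x => ∑ n, ∑ i, ‖lapC V₁ m x‖ * (φ (x 2) * ‖d1 h n i x‖ ^ 2))
        (volume.restrict (cube R)) :=
      integrable_finsetSum _ fun n _ => integrable_finsetSum _ fun i _ => i2 n i
    have I01 : Integrable (fun x => 1 / 2 * (φ (x 2) * ‖lapC h m x‖ ^ 2)
        - κ₁ * ∑ n, ∑ i, φ (x 2) * ‖d1 h n i x‖ ^ 2) (volume.restrict (cube R)) :=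
      (i0.const_mul _).sub (I1.const_mul _)
    have b1 : ∀ n i, ∫ x in cube R, φ (x 2) * ‖d1 h n i x‖ ^ 2 ≤ C / lam * Q n := by
      intro n i
      rw [div_mul_eq_mul_div, le_div_iff₀ hl0, mul_comm]
      exact (hC' n).1 i
    have hV₁ : C * ‖V₁‖ ^ 2 ≤ η ^ 2 * √lam := by
      refine le_trans ?_ hls
      have := h₁.1.le
      gcongr
    have b2 : ∀ n i, ∫ x in cube R, ‖lapC V₁ m x‖ * (φ (x 2) * ‖d1 h n i x‖ ^ 2) ≤ η * Q n :=
      fun n i => ((hC' n).2.2 V₁ m i).2 η hη0 hV₁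
    have lower : 1 / 2 * Q m - κ₁ * (∑ n : Fin N, ∑ _i : Fin 3, C / lam * Q n)
      - κ₂ * (∑ n : Fin N, ∑ _i : Fin 3, η * Q n)
      ≤ ∫ x in cube R, ((1 / 2 * (φ (x 2) * ‖lapC h m x‖ ^ 2)
        - κ₁ * ∑ n, ∑ i, φ (x 2) * ‖d1 h n i x‖ ^ 2)
        - κ₂ * ∑ n, ∑ i, ‖lapC V₁ m x‖ * (φ (x 2) * ‖d1 h n i x‖ ^ 2)) := by
      rw [integral_sub I01 (I2.const_mul _), integral_sub (i0.const_mul _) (I1.const_mul _),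
        integral_const_mul, integral_const_mul, integral_const_mul,
        integral_finsetSum _ fun n _ => integrable_finsetSum _ fun i _ => i1 n i,
        integral_finsetSum _ fun n _ => integrable_finsetSum _ fun i _ => i2 n i]
      simp_rw [integral_finsetSum _ fun i _ => i1 _ i, integral_finsetSum _ fun i _ => i2 _ i]
      have s1 : ∑ n, ∑ i, ∫ x in cube R, φ (x 2) * ‖d1 h n i x‖ ^ 2
          ≤ ∑ n : Fin N, ∑ _i : Fin 3, C / lam * Q n :=
        Finset.sum_le_sum fun n _ => Finset.sum_le_sum fun i _ => b1 n i
      have s2 : ∑ n, ∑ i, ∫ x in cube R, ‖lapC V₁ m x‖ * (φ (x 2) * ‖d1 h n i x‖ ^ 2)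
          ≤ ∑ n : Fin N, ∑ _i : Fin 3, η * Q n :=
        Finset.sum_le_sum fun n _ => Finset.sum_le_sum fun i _ => b2 n i
      gcongr
    refine lower.trans ?_
    rw [sq_norm_L2, L2.inner_def, ← integral_const_mul]
    have j1 : Integrable (fun x => ‖(quadMap (A m) (B m) V₂ - quadMap (A m) (B m) V₁ : L2 R) x‖ ^ 2)
        (volume.restrict (cube R)) := (memLp_two_iff_integrable_sq_norm (Lp.memLp _).1).1
          (Lp.memLp _)
    have j2 := L2.integrable_inner (𝕜 := ℝ) (quadMap (A m) (B m) V₁) (B m h h)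
    rw [← integral_add j1 (j2.const_mul 2)]
    refine integral_mono_ae (I01.sub (I2.const_mul _)) (j1.add (j2.const_mul 2)) ?_
    filter_upwards [Lp.coeFn_sub (quadMap (A m) (B m) V₂) (quadMap (A m) (B m) V₁), hq m V₁,
      hq m V₂, hB m h, lapC_sub_ae V₁ V₂ m, d1_sub_ae V₁ V₂,
      ae_all_iff.2 fun n => ae_all_iff.2 fun i => hD V₁ n i,
      ae_all_iff.2 fun n => ae_all_iff.2 fun i => hD V₂ n i,
      ae_restrict_mem (measurableSet_cube R)] with x e1 e2 e3 e4 e5 e6 e7 e8 hx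
    rw [e1, Pi.sub_apply, e2, e3, e4, ← mul_sub, norm_mul, mul_pow]
    rw [← hh] at e5 e6
    simp_rw [e5, e6]
    have hw : ∀ (t : ℝ) (z w : ℂ), inner ℝ ((t : ℂ) * z) ((t : ℂ) * w) = t ^ 2 * inner ℝ z w := by
      intro t z w
      rw [← Complex.real_smul, ← Complex.real_smul, real_inner_smul_left, real_inner_smul_right]
      ring
    rw [hw, hee, Complex.norm_real, Real.norm_eq_abs, sq_abs, hee]
    have hpt := remainder_pointwise S hx (G := G) (p := fun n i => d1 V₁ n i x)
      (q := fun n i => d1 V₂ n i x)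
      (fun n i => (e7 n i).trans (by rw [hG]; have := h₁.1.le; gcongr))
      (fun n i => (e8 n i).trans (by rw [hG]; have := h₂.1.le; gcongr)) m
      (lapC V₁ m x) (lapC V₂ m x)
    have hmul := mul_le_mul_of_nonneg_left hpt (hφp (x 2)).le
    refine le_trans (le_of_eq ?_) (hmul.trans (le_of_eq ?_))
    · simp_rw [← Finset.mul_sum]
      ring
    · simp only [opL, lapC]; ring
  -- conclusion
  have hN1 : (∑ m : Fin N, (1 / 2 * Q m - κ₁ * (∑ n : Fin N, ∑ _i : Fin 3, C / lam * Q n)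
      - κ₂ * (∑ n : Fin N, ∑ _i : Fin 3, η * Q n)))
      = (1 / 2 - 3 * N * κ₁ * C / lam - 3 * N * κ₂ * η) * ∑ n, Q n := by
    simp only [Finset.sum_sub_distrib, Finset.sum_const, Finset.card_univ, Fintype.card_fin,
      nsmul_eq_mul, ← Finset.mul_sum]
    push_cast; ring
  -- Of the factor `1/2`, one eighth is lost to each of the two kinds of negative terms, and `1/4`
  -- remains.
  have hc1 : 3 * N * κ₁ * C / lam ≤ 1 / 8 := by
    rw [div_le_iff₀ hl0]; linarith
  have hc2 : 3 * N * κ₂ * η ≤ 1 / 8 := by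
    rw [hη, mul_one_div, div_le_iff₀ (by positivity)]
    linarith
  have htot : 1 / 4 * ∑ n, Q n ≤ ∑ m, (‖quadMap (A m) (B m) V₂ - quadMap (A m) (B m) V₁‖ ^ 2
          + 2 * inner ℝ (quadMap (A m) (B m) V₁) (B m h h)) := by
    refine le_trans ?_ (Finset.sum_le_sum fun m _ => hrem m)
    rw [hN1]
    gcongr
    linarith
  have hfin : E / (4 * cd * C * lam) * normH2 h ^ 2 ≤ E * (1 / 4 * ∑ n, Q n) := by
    calc _ ≤ E / (4 * cd * C * lam) * (cd * C * lam * ∑ n, Q n) := by gcongr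
      _ = _ := by field_simp
  have := mul_le_mul_of_nonneg_left htot hE0.le
  linarith

end

/-! ### Convexity thresholds -/

/-- For a smooth functional the inequality is a closed condition on the pair `(u, v)`. It thus
extends to the closure without showing that limits in `H³` keep the boundary data. -/
theorem le_taylor_remainder_closure {X : Type*} [NormedAddCommGroup X] [NormedSpace ℝ X]
    {F g : X → ℝ} (hF : ContDiff ℝ ∞ F) (hg : Continuous g) {s : Set X}
    (h : ∀ u ∈ s, ∀ v ∈ s, g (v - u) ≤ F v - F u - fderiv ℝ F u (v - u)) :
    ∀ u ∈ closure s, ∀ v ∈ closure s, g (v - u) ≤ F v - F u - fderiv ℝ F u (v - u) := by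
  intro u hu v hv
  have hclosed : IsClosed {q : X × X |
      g (q.2 - q.1) ≤ F q.2 - F q.1 - fderiv ℝ F q.1 (q.2 - q.1)} := by
    have c1 := hF.continuous
    have c2 := hF.continuous_fderiv (by simp)
    exact isClosed_le (hg.comp (continuous_snd.sub continuous_fst))
      (((c1.comp continuous_snd).sub (c1.comp continuous_fst)).sub
        ((c2.comp continuous_fst).clm_apply (continuous_snd.sub continuous_fst)))
  have hmem : (u, v) ∈ closure (s ×ˢ s) := by
    rw [closure_prod_eq]; exact ⟨hu, hv⟩
  exact closure_minimal (fun q hq => h q.1 hq.1 q.2 hq.2) hclosed hmem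

section
variable {R r a d k : ℝ} {N : ℕ}

theorem sq_normH2 (V : H3 R N) : normH2 V ^ 2
    = ∑ j : Fin N × multiIndices 3, if ∑ i, (j.2 : Fin 3 → ℕ) i ≤ 2 then ‖V.1 j‖ ^ 2 else 0 :=
  Real.sq_sqrt (Finset.sum_nonneg fun j _ => by positivity)

theorem continuous_normH2 : Continuous (normH2 : H3 R N → ℝ) := by
  unfold normH2
  refine (continuous_finsetSum _ fun j _ => ?_).sqrt
  split_ifs
  · exact ((evalL R N j).continuous.norm).pow 2
  · exact continuous_const

theorem sq_normH2_le (V : H3 R N) : normH2 V ^ 2 ≤ ‖V‖ ^ 2 := by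
  rw [sq_normH2, show ‖V‖ = ‖(V.1 : DerivFamily R N 3)‖ from rfl, PiLp.norm_sq_eq_of_L2]
  refine Finset.sum_le_sum fun j _ => ?_
  split_ifs
  · exact le_rfl
  · positivity

theorem sq_normH2_sub_le (V W : H3 R N) :
    normH2 (V - W) ^ 2 ≤ 2 * normH2 V ^ 2 + 2 * normH2 W ^ 2 := by
  simp_rw [sq_normH2, Finset.mul_sum, ← Finset.sum_add_distrib]
  refine Finset.sum_le_sum fun j _ => ?_
  split_ifs
  · have h : ‖(V - W).1 j‖ ≤ ‖V.1 j‖ + ‖W.1 j‖ := norm_sub_le (V.1 j) (W.1 j)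
    nlinarith [sq_nonneg (‖V.1 j‖ - ‖W.1 j‖), norm_nonneg ((V - W).1 j)]
  · simp

theorem contDiff_J (hR : 0 < R) (S : SystemCoeff R a d k N) (r lam γ : ℝ) :
    ContDiff ℝ ∞ (J r a d k lam γ : H3 R N → ℝ) := by
  obtain ⟨A, B, hJ, -⟩ := exists_J_eq hR S r lam
  rw [hJ]; exact contDiff_quadFun _ _ _ _

theorem exists_isConvexityThreshold (hR : 0 < R) (hr : R < r) (S : SystemCoeff R a d k N) (M : ℝ)
    (hM : 0 < M) : ∃ Λ, IsConvexityThreshold R r a d k N M Λ := by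
  obtain ⟨Λ, h1, h⟩ := exists_convexity_of_boundaryData hR hr S M hM
  refine ⟨Λ, h1, fun lam hl => ?_⟩
  obtain ⟨c, hc, hconv⟩ := h lam hl
  refine ⟨c, hc, fun γ _ _ ψ₀ ψ₁ V₁ hV₁ => ⟨?_, fun V₂ hV₂ => ?_⟩⟩
  · exact (contDiff_J hR S r lam γ).differentiable (by simp) V₁
  have hg : Continuous fun V : H3 R N => c * normH2 V ^ 2 + γ * ‖V‖ ^ 2 :=
    ((continuous_normH2.pow 2).const_mul c).add ((continuous_norm.pow 2).const_mul γ)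
  exact le_taylor_remainder_closure (contDiff_J hR S r lam γ) hg
    (fun u hu v hv => hconv γ ψ₀ ψ₁ u v hu hv) V₁ hV₁ V₂ hV₂

theorem IsConvexityThreshold.mono {M M' Λ Λ' : ℝ} (h : IsConvexityThreshold R r a d k N M' Λ)
    (hM : M ≤ M') (hΛ : Λ ≤ Λ') : IsConvexityThreshold R r a d k N M Λ' := by
  refine ⟨h.1.trans_le hΛ, fun lam hl => ?_⟩
  obtain ⟨c, hc, hconv⟩ := h.2 lam (hΛ.trans hl)
  have hsub : ∀ ψ₀ ψ₁, closure (setB R N M ψ₀ ψ₁) ⊆ closure (setB R N M' ψ₀ ψ₁) :=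
    fun ψ₀ ψ₁ => closure_mono fun V hV => ⟨hV.1.trans_le hM, hV.2⟩
  refine ⟨c, hc, fun γ h0 h1 ψ₀ ψ₁ V₁ hV₁ => ?_⟩
  obtain ⟨hd, hi⟩ := hconv γ h0 h1 ψ₀ ψ₁ V₁ (hsub _ _ hV₁)
  exact ⟨hd, fun V₂ hV₂ => hi V₂ (hsub _ _ hV₂)⟩

/-- Thresholds stay valid when they are enlarged or the radius is reduced, so it suffices to choose
one for each radius `n + 1` and to add them up. -/
theorem exists_threshold_function (hR : 0 < R) (hr : R < r) (S : SystemCoeff R a d k N) :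
    ∃ lam₂ : ℝ → ℝ, ∀ M : ℝ, 0 < M →
      IsConvexityThreshold R r a d k N M (lam₂ M) ∧ lam₂ M < lam₂ (3 * M) := by
  choose f hf using fun n : ℕ =>
    exists_isConvexityThreshold hR hr S ((n : ℝ) + 1) (by positivity)
  have hf0 : ∀ n, 0 ≤ f n := fun n => by linarith [(hf n).1]
  -- The last term of the sum is the threshold for the radius `⌈M⌉ + 1 ≥ M`; the summand `M` makes
  -- the function strictly increasing.
  refine ⟨fun M => ∑ n ∈ Finset.range (⌈M⌉₊ + 1), f n + M, fun M hM => ⟨?_, ?_⟩⟩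
  · refine (hf ⌈M⌉₊).mono ?_ ?_
    · linarith [Nat.le_ceil M]
    · have := Finset.single_le_sum (f := f) (fun n _ => hf0 n)
        (Finset.self_mem_range_succ ⌈M⌉₊)
      linarith
  · have h1 : ⌈M⌉₊ ≤ ⌈3 * M⌉₊ := Nat.ceil_mono (by linarith)
    have h2 : ∑ n ∈ Finset.range (⌈M⌉₊ + 1), f n ≤ ∑ n ∈ Finset.range (⌈3 * M⌉₊ + 1), f n :=
      Finset.sum_le_sum_of_subset_of_nonneg (Finset.range_subset_range.2 (by omega))
        fun n _ _ => hf0 n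
    simp only
    linarith

/-! ### Completeness and convexity -/

theorem continuous_integral_smul {c : E3 → ℝ} (hc : Continuous c) (hs : HasCompactSupport c) :
    Continuous fun u : L2 R => ∫ x in cube R, c x • u x := by
  have hm : MemLp (fun x => (c x : ℂ)) 2 (volume.restrict (cube R)) := by
    have hc2 : MemLp c 2 (volume.restrict (cube R)) := hc.memLp_of_hasCompactSupport hs
    exact hc2.ofReal
  have : (fun u : L2 R => ∫ x in cube R, c x • u x) = fun u : L2 R => inner ℂ hm.toLp u := by
    ext u
    rw [L2.inner_def]
    refine integral_congr_ae ?_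
    filter_upwards [hm.coeFn_toLp] with x hx
    rw [hx]
    simp [mul_comm]
  rw [this]
  fun_prop

/-- Each weak-derivative identity equates two continuous functions of the family in `L²`. Closedness
makes `H³` complete, which the existence of a minimizer relies on. -/
theorem isClosed_sobolev (R : ℝ) (N s : ℕ) : IsClosed (Sobolev R N s : Set (DerivFamily R N s)) := by
  have : (Sobolev R N s : Set (DerivFamily R N s)) = ⋂ (n : Fin N), ⋂ (i : Fin 3),
      ⋂ (α : multiIndices s), ⋂ (β : multiIndices s),
      ⋂ (_ : (β : Fin 3 → ℕ) = (α : Fin 3 → ℕ) + Pi.single i 1), ⋂ (φ : E3 → ℝ),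
      ⋂ (_ : IsTestFunction R φ), {V : DerivFamily R N s |
        ∫ x in cube R, fderiv ℝ φ x (EuclideanSpace.single i 1) • V (n, α) x
          = - ∫ x in cube R, φ x • V (n, β) x} := by
    ext V
    simp only [mem_iInter, mem_ofPred_eq]
    rfl
  rw [this]
  refine isClosed_iInter fun n => isClosed_iInter fun i => isClosed_iInter fun α =>
    isClosed_iInter fun β => isClosed_iInter fun _ => isClosed_iInter fun φ =>
    isClosed_iInter fun hφ => isClosed_eq ?_ ?_
  · exact (continuous_integral_smul ((hφ.smooth.continuous_fderiv (by simp)).clm_apply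
      continuous_const) (hφ.compact.fderiv_apply (𝕜 := ℝ) _)).comp
      (PiLp.proj 2 (fun _ : Fin N × multiIndices s => L2 R) (n, α) (𝕜 := ℝ)).continuous
  · exact ((continuous_integral_smul hφ.smooth.continuous hφ.compact).comp
      (PiLp.proj 2 (fun _ : Fin N × multiIndices s => L2 R) (n, β) (𝕜 := ℝ)).continuous).neg

instance instCompleteSpaceH3 (R : ℝ) (N : ℕ) : CompleteSpace (H3 R N) :=
  (isClosed_sobolev R N 3).completeSpace_coe

theorem HasBoundaryValue.add_smul {u v : L2 R} {S : Set E3} {ψ χ : E3 → ℂ}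
    (hu : HasBoundaryValue u S ψ) (hv : HasBoundaryValue v S χ) (s t : ℝ) :
    HasBoundaryValue (s • u + t • v) S (s • ψ + t • χ) := by
  obtain ⟨w, hw, hwe, hw0⟩ := hu
  obtain ⟨w', hw', hwe', hw0'⟩ := hv
  refine ⟨s • w + t • w', (hw.const_smul s).add (hw'.const_smul t), ?_, fun x hx => ?_⟩
  · exact (Lp.coeFn_add _ _).trans (((Lp.coeFn_smul s u).trans (hwe.const_smul s)).add
      ((Lp.coeFn_smul t v).trans (hwe'.const_smul t)))
  · simp [hw0 x hx, hw0' x hx]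

theorem HasBoundaryData.add_smul {V W : H3 R N} {ψ₀ ψ₁ χ₀ χ₁ : Fin N → E3 → ℂ}
    (hV : HasBoundaryData V ψ₀ ψ₁) (hW : HasBoundaryData W χ₀ χ₁) (s t : ℝ) :
    HasBoundaryData (s • V + t • W) (s • ψ₀ + t • χ₀) (s • ψ₁ + t • χ₁) := fun n =>
  ⟨(hV n).1.add_smul (hW n).1 s t, (hV n).2.add_smul (hW n).2 s t⟩

theorem convex_setB (M : ℝ) (ψ₀ ψ₁ : Fin N → E3 → ℂ) : Convex ℝ (setB R N M ψ₀ ψ₁) := by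
  intro V hV W hW s t hs ht hst
  refine ⟨?_, ?_⟩
  · have := convex_ball (0 : H3 R N) M (mem_ball_zero_iff.2 hV.1) (mem_ball_zero_iff.2 hW.1) hs ht hst
    exact mem_ball_zero_iff.1 this
  · have := hV.2.add_smul hW.2 s t
    rwa [← add_smul, ← add_smul, hst, one_smul, one_smul] at this

end

/-! ### Minimization of strongly convex functionals -/

section
variable {X : Type*} [NormedAddCommGroup X] [NormedSpace ℝ X] {K : Set X} {F : X → ℝ} {γ : ℝ}

/-- The convexity inequality is applied at the midpoint in the two opposite directions, so that the
derivative terms cancel in the sum. -/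
theorem norm_sub_sq_le_of_stronglyConvex (hK : Convex ℝ K)
    (hF : ∀ u ∈ K, ∀ v ∈ K, γ * ‖v - u‖ ^ 2 ≤ F v - F u - fderiv ℝ F u (v - u)) {m : ℝ}
    (hm : ∀ u ∈ K, m ≤ F u) {u v : X} (hu : u ∈ K) (hv : v ∈ K) :
    γ / 2 * ‖u - v‖ ^ 2 ≤ F u + F v - 2 * m := by
  set w : X := (1 / 2 : ℝ) • u + (1 / 2 : ℝ) • v with hw
  have hwK : w ∈ K := hK hu hv (by norm_num) (by norm_num) (by norm_num)
  have e1 : u - w = (1 / 2 : ℝ) • (u - v) := by rw [hw]; module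
  have e2 : v - w = -((1 / 2 : ℝ) • (u - v)) := by rw [hw]; module
  have h1 := hF w hwK u hu
  have h2 := hF w hwK v hv
  rw [e2, map_neg, norm_neg] at h2
  rw [e1] at h1
  have h3 := hm w hwK
  rw [norm_smul, mul_pow] at h1 h2
  norm_num at h1 h2
  linarith

/-- The midpoint inequality makes every minimizing sequence Cauchy. Completeness then replaces weak
compactness, and the same inequality gives uniqueness. -/
theorem exists_unique_min_of_stronglyConvex [CompleteSpace X] (hγ : 0 < γ) (hK : Convex ℝ K)
    (hKc : IsClosed K) (hKn : K.Nonempty) (hc : Continuous F) (h0 : ∀ u, 0 ≤ F u)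
    (hF : ∀ u ∈ K, ∀ v ∈ K, γ * ‖v - u‖ ^ 2 ≤ F v - F u - fderiv ℝ F u (v - u)) :
    ∃ u ∈ K, (∀ v ∈ K, F u ≤ F v) ∧ ∀ w ∈ K, (∀ v ∈ K, F w ≤ F v) → w = u := by
  set m := sInf (F '' K) with hm
  have hbdd : BddBelow (F '' K) := ⟨0, by rintro _ ⟨u, -, rfl⟩; exact h0 u⟩
  have hmle : ∀ u ∈ K, m ≤ F u := fun u hu => csInf_le hbdd ⟨u, hu, rfl⟩
  have hseq : ∀ n : ℕ, ∃ u ∈ K, F u < m + 1 / ((n : ℝ) + 1) := by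
    intro n
    obtain ⟨_, ⟨u, hu, rfl⟩, hlt⟩ := exists_lt_of_csInf_lt (hKn.image F)
      (show sInf (F '' K) < m + 1 / ((n : ℝ) + 1) by
        have : 0 < 1 / ((n : ℝ) + 1) := by positivity
        linarith)
    exact ⟨u, hu, hlt⟩
  choose u huK hu using hseq
  have hkey := fun {u v : X} => norm_sub_sq_le_of_stronglyConvex (u := u) (v := v) hK hF hmle
  have hlim : Tendsto (fun n : ℕ => 1 / ((n : ℝ) + 1)) atTop (𝓝 0) :=
    tendsto_one_div_add_atTop_nhds_zero_nat
  have hcauchy : CauchySeq u := by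
    refine cauchySeq_of_le_tendsto_0 (fun n : ℕ => √(4 / γ * (1 / ((n : ℝ) + 1)))) ?_ ?_
    · intro n p q hn hp
      rw [dist_eq_norm]
      refine Real.le_sqrt_of_sq_le ?_
      have h1 := hkey (huK n) (huK p)
      have h2 := hu n
      have h3 := hu p
      have h4 : 1 / ((n : ℝ) + 1) ≤ 1 / ((q : ℝ) + 1) := by gcongr
      have h5 : 1 / ((p : ℝ) + 1) ≤ 1 / ((q : ℝ) + 1) := by gcongr
      rw [div_mul_eq_mul_div, le_div_iff₀ hγ]
      linarith
    · have := (hlim.const_mul (4 / γ)).sqrt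
      simpa using this
  obtain ⟨v, hv⟩ := cauchySeq_tendsto_of_complete hcauchy
  have hvK : v ∈ K := hKc.mem_of_tendsto hv (Eventually.of_forall huK)
  have hFv : F v ≤ m := by
    have h1 : Tendsto (fun n : ℕ => m + 1 / ((n : ℝ) + 1)) atTop (𝓝 (m + 0)) := hlim.const_add m
    rw [add_zero] at h1
    exact le_of_tendsto_of_tendsto' ((hc.tendsto v).comp hv) h1 fun n => (hu n).le
  refine ⟨v, hvK, fun w hw => hFv.trans (hmle w hw), fun w hwK hw => ?_⟩
  have h1 := hkey hwK hvK
  have h2 : F w ≤ m := (hw v hvK).trans hFv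
  have h3 : ‖w - v‖ ^ 2 ≤ 0 := by
    by_contra hcon
    push Not at hcon
    have : 0 < γ / 2 * ‖w - v‖ ^ 2 := by positivity
    linarith
  have : ‖w - v‖ = 0 := pow_eq_zero_iff two_ne_zero |>.1 (le_antisymm h3 (sq_nonneg _))
  exact sub_eq_zero.1 (norm_eq_zero.1 this)

theorem fderiv_nonneg_of_min (hK : Convex ℝ K) {u v : X} (hu : u ∈ K) (hv : v ∈ K)
    (hmin : ∀ w ∈ K, F u ≤ F w) (hd : DifferentiableAt ℝ F u) : 0 ≤ fderiv ℝ F u (v - u) := by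
  have h1 : IsLocalMinOn F K u := IsMinOn.localize hmin
  exact h1.hasFDerivWithinAt_nonneg hd.hasFDerivAt.hasFDerivWithinAt
    (mem_posTangentConeAt_of_segment_subset (by
      simpa using hK.segment_subset hu hv))

end

/-! ### Accuracy of the minimizer -/

section
variable {R r a d k : ℝ} {N : ℕ}

/-- Local Lipschitz bound; the quadratic remainder `‖B‖ δ²` is at most `‖B‖ δ` because `δ ≤ 1`. -/
theorem exists_norm_quadMap_sub_le {X Y : Type*} [NormedAddCommGroup X] [InnerProductSpace ℝ X]
    [NormedAddCommGroup Y] [InnerProductSpace ℝ Y] (A : X →L[ℝ] Y) (B : X →L[ℝ] X →L[ℝ] Y) (M : ℝ) :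
    ∃ C, 0 ≤ C ∧ ∀ (V W : X) (δ : ℝ), ‖V‖ ≤ M → δ ≤ 1 → ‖W - V‖ ≤ δ →
      ‖quadMap A B W - quadMap A B V‖ ≤ C * δ := by
  refine ⟨‖A‖ + 2 * ‖B‖ * |M| + ‖B‖, by positivity, fun V W δ hV' hδ h => ?_⟩
  have hV : ‖V‖ ≤ |M| := hV'.trans (le_abs_self M)
  have hδ0 : 0 ≤ δ := (norm_nonneg _).trans h
  have e : quadMap A B W - quadMap A B V
      = A (W - V) + (B V (W - V) + B (W - V) V) + B (W - V) (W - V) := by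
    rw [quadMap_sub]; simp [add_assoc]
  rw [e]
  have b1 : ‖A (W - V)‖ ≤ ‖A‖ * δ := A.le_opNorm_of_le h
  have b2 : ‖B V (W - V)‖ ≤ ‖B‖ * |M| * δ := B.le_of_opNorm₂_le_of_le le_rfl hV h
  have b3 : ‖B (W - V) V‖ ≤ ‖B‖ * δ * |M| := B.le_of_opNorm₂_le_of_le le_rfl h hV
  have b4 : ‖B (W - V) (W - V)‖ ≤ ‖B‖ * δ * δ := B.le_of_opNorm₂_le_of_le le_rfl h h
  have b5 : ‖B‖ * δ * δ ≤ ‖B‖ * δ * 1 := by gcongr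
  refine (norm_add_le _ _).trans ?_
  have b6 := norm_add_le (A (W - V)) (B V (W - V) + B (W - V) V)
  have b7 := norm_add_le (B V (W - V)) (B (W - V) V)
  linarith

/-- The functional is of order `δ²` at distance `δ` from a solution. -/
theorem exists_J_le (hR : 0 < R) (S : SystemCoeff R a d k N) (r lam M : ℝ) :
    ∃ C : ℝ, 0 ≤ C ∧ ∀ (δ : ℝ) (V W : H3 R N), δ ≤ 1 → IsSolution a d k V → ‖V‖ ≤ M →
      ‖W‖ ≤ M → ‖W - V‖ ≤ δ → J r a d k lam (δ ^ 2) W ≤ C * δ ^ 2 := by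
  obtain ⟨A, B, hJ, hq, -⟩ := exists_J_eq hR S r lam
  choose T hT0 hT using fun m => exists_norm_quadMap_sub_le (A m) (B m) M
  set E := Real.exp (-2 * lam * (R + r) ^ 2) with hE
  have hE0 : 0 < E := Real.exp_pos _
  -- The first part bounds the residual, which is Lipschitz and vanishes at the solution `V`; the
  -- second is the regularization term, of the same order thanks to `γ = δ²`.
  refine ⟨E * (∑ m, T m ^ 2) + M ^ 2, by positivity,
    fun δ V W hδ hV hVM hWM h => ?_⟩
  rw [hJ]
  have hzero : ∀ m, quadMap (A m) (B m) V = 0 := by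
    intro m
    refine Lp.ext ?_
    filter_upwards [hq m V, hV, Lp.coeFn_zero ℂ 2 (volume.restrict (cube R))] with x h1 h2 h3
    rw [h1, h2 m, mul_zero, h3]; rfl
  have hle : ∀ m, ‖quadMap (A m) (B m) W‖ ^ 2 ≤ T m ^ 2 * δ ^ 2 := by
    intro m
    have := hT m V W δ hVM hδ h
    rw [hzero m, sub_zero] at this
    rw [← mul_pow]
    gcongr
  unfold quadFun
  calc _ ≤ E * (∑ m, T m ^ 2 * δ ^ 2) + δ ^ 2 * M ^ 2 := by
        gcongr with m _
        exact hle m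
    _ = _ := by rw [← Finset.sum_mul]; ring

theorem J_nonneg (r a d k lam : ℝ) {γ : ℝ} (hγ : 0 ≤ γ) (V : H3 R N) :
    0 ≤ J r a d k lam γ V := by
  unfold J
  have : 0 ≤ ∫ x in cube R, (∑ m, ‖opL a d k V x m‖ ^ 2) * carlemanWeight r lam (x 2) :=
    integral_nonneg fun x => mul_nonneg (by positivity) (carlemanWeight_pos _ _ _).le
  have := Real.exp_pos (-2 * lam * (R + r) ^ 2)
  positivity

theorem setB_subset_three {M : ℝ} (hM : 0 < M) (ψ₀ ψ₁ : Fin N → E3 → ℂ) :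
    setB R N M ψ₀ ψ₁ ⊆ setB R N (3 * M) ψ₀ ψ₁ := fun _ hV => ⟨hV.1.trans (by linarith), hV.2⟩

/-- The data `G - G'` transfers an element with the data of `G'` to the data of `G`. -/
theorem add_sub_mem_setB {M δ : ℝ} {ψ₀ ψ₁ ψ₀' ψ₁' : Fin N → E3 → ℂ} {G G' V : H3 R N}
    (hG : HasBoundaryData G ψ₀ ψ₁) (hG' : HasBoundaryData G' ψ₀' ψ₁')
    (hV : HasBoundaryData V ψ₀' ψ₁') (hδ : ‖G - G'‖ < δ) (hM : ‖V‖ < M - δ) :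
    V + (G - G') ∈ setB R N M ψ₀ ψ₁ := by
  constructor
  · have := norm_add_le V (G - G')
    linarith
  · have h := (hG'.add_smul hV (-1) 1).add_smul hG 1 1
    convert h using 1 <;> module

theorem exists_minimizer (hR : 0 < R) (S : SystemCoeff R a d k N) {M lam : ℝ} (hM : 0 < M)
    (hlam : IsConvexityThreshold R r a d k N (3 * M) lam) :
    ∃ C : ℝ, 0 < C ∧ ∀ δ : ℝ, 0 < δ → δ < 1 →
        ∀ (ψ₀ ψ₁ ψ₀' ψ₁' : Fin N → E3 → ℂ) (G G' V' : H3 R N),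
          HasBoundaryData G ψ₀ ψ₁ →
          HasBoundaryData G' ψ₀' ψ₁' →
          IsSolution a d k V' → HasBoundaryData V' ψ₀' ψ₁' →
          ‖G - G'‖ < δ → ‖V'‖ < M - δ → ‖G'‖ < M - δ →
          ∃ Vmin : H3 R N,
            IsMinimizer r a d k lam (δ ^ 2) M ψ₀ ψ₁ Vmin ∧
            (∀ W : H3 R N, IsMinimizer r a d k lam (δ ^ 2) M ψ₀ ψ₁ W → W = Vmin) ∧
            normH2 (Vmin - V') ≤ C * δ := by
  obtain ⟨c, hc, hconv⟩ := hlam.2 lam le_rfl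
  obtain ⟨C, hC0, hC⟩ := exists_J_le hR S r lam M
  -- From `‖U - V'‖² ≤ 2 ‖W - V'‖² + 2 ‖W - U‖²` in the `H²` norm, with the bounds `δ²` and `(C/c)
  -- δ²`.
  refine ⟨√(2 * (C / c) + 2), by positivity, ?_⟩
  intro δ hδ0 hδ1 ψ₀ ψ₁ ψ₀' ψ₁' G G' V' hG hG' hsol hV' hGG hVM hGM
  have hγ0 : 0 < δ ^ 2 := by positivity
  have hγ1 : δ ^ 2 < 1 := by nlinarith
  set K := closure (setB R N M ψ₀ ψ₁) with hK
  have hsub : K ⊆ closure (setB R N (3 * M) ψ₀ ψ₁) := closure_mono (setB_subset_three hM ψ₀ ψ₁)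
  have hJ := contDiff_J (N := N) hR S r lam (δ ^ 2)
  have hKconv : Convex ℝ K := (convex_setB M ψ₀ ψ₁).closure
  have hF : ∀ u ∈ K, ∀ v ∈ K, c * normH2 (v - u) ^ 2 + δ ^ 2 * ‖v - u‖ ^ 2
      ≤ J r a d k lam (δ ^ 2) v - J r a d k lam (δ ^ 2) u
        - fderiv ℝ (J r a d k lam (δ ^ 2) : H3 R N → ℝ) u (v - u) := fun u hu v hv =>
    (hconv (δ ^ 2) hγ0 hγ1 ψ₀ ψ₁ u (hsub hu)).2 v (hsub hv)
  -- The competitor: the exact solution corrected to carry the noisy boundary data. The margin in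
  -- `‖V'‖ < M - δ` keeps it in `B(M)`.
  set W := V' + (G - G') with hW
  have hWB : W ∈ setB R N M ψ₀ ψ₁ := add_sub_mem_setB hG hG' hV' hGG hVM
  have hWK : W ∈ K := subset_closure hWB
  obtain ⟨U, hUK, hUmin, hUuniq⟩ := exists_unique_min_of_stronglyConvex hγ0 hKconv isClosed_closure
    ⟨W, hWK⟩ hJ.continuous (J_nonneg r a d k lam hγ0.le) fun u hu v hv =>
      (le_add_of_nonneg_left (by positivity)).trans (hF u hu v hv)
  refine ⟨U, ⟨hUK, hUmin⟩, fun w hw => hUuniq w hw.1 hw.2, ?_⟩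
  have h1 := fderiv_nonneg_of_min hKconv hUK hWK hUmin (hJ.differentiable (by simp) U)
  have h2 := hF U hUK W hWK
  have h3 := J_nonneg r a d k lam hγ0.le U
  have hWV : W - V' = G - G' := by rw [hW]; abel
  have h4 : J r a d k lam (δ ^ 2) W ≤ C * δ ^ 2 :=
    hC δ V' W hδ1.le hsol (by linarith) hWB.1.le (by rw [hWV]; exact hGG.le)
  -- Convexity at the minimizer: the derivative towards `W` and the value `J(U)` are both
  -- nonnegative and can be discarded.
  have h5 : normH2 (W - U) ^ 2 ≤ C / c * δ ^ 2 := by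
    rw [div_mul_eq_mul_div, le_div_iff₀ hc]
    have : 0 ≤ δ ^ 2 * ‖W - U‖ ^ 2 := by positivity
    linarith
  have h6 : normH2 (W - V') ^ 2 ≤ δ ^ 2 := by
    refine (sq_normH2_le _).trans ?_
    rw [hWV]
    gcongr
  have h7 := sq_normH2_sub_le (W - V') (W - U)
  rw [sub_sub_sub_cancel_left] at h7
  refine le_of_sq_le_sq ?_ (by positivity)
  rw [mul_pow, Real.sq_sqrt (by positivity)]
  linarith

end

end Convexification

end

/-- The first conjunct provides the number `λ₂(M)`; the second one is the accuracy estimate, for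
`λ = λ₂(3M)` and `γ = δ²`, whatever admissible value of `λ₂(3M)` has been chosen. -/
theorem theorem5p4 (R r a d k : ℝ) (N : ℕ) (hR : 0 < R) (hr : R < r) (ha : 0 < a) (hd : R < d)
    (hk : 0 < k) (hN : 1 ≤ N) :
    (∃ lam₂ : ℝ → ℝ, ∀ M : ℝ, 0 < M →
      IsConvexityThreshold R r a d k N M (lam₂ M) ∧ lam₂ M < lam₂ (3 * M)) ∧
    ∀ M : ℝ, 0 < M → ∀ lam₃ : ℝ, IsConvexityThreshold R r a d k N (3 * M) lam₃ →
      ∃ C : ℝ, 0 < C ∧ ∀ δ : ℝ, 0 < δ → δ < 1 →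
        ∀ (ψ₀ ψ₁ ψ₀' ψ₁' : Fin N → E3 → ℂ) (G G' V' : H3 R N),
          HasBoundaryData G ψ₀ ψ₁ →
          HasBoundaryData G' ψ₀' ψ₁' →
          IsSolution a d k V' → HasBoundaryData V' ψ₀' ψ₁' →
          ‖G - G'‖ < δ → ‖V'‖ < M - δ → ‖G'‖ < M - δ →
          ∃ Vmin : H3 R N,
            IsMinimizer r a d k lam₃ (δ ^ 2) M ψ₀ ψ₁ Vmin ∧
            (∀ W : H3 R N, IsMinimizer r a d k lam₃ (δ ^ 2) M ψ₀ ψ₁ W → W = Vmin) ∧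
            normH2 (Vmin - V') ≤ C * δ := by
  obtain ⟨S⟩ := nonempty_systemCoeff N ha hd hk
  exact ⟨exists_threshold_function hR hr S, fun M hM lam₃ h => exists_minimizer hR S hM h⟩
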